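/- Let $G$ be a $4$-dimensional real Lie group with a left-invariant Riemannian metric $g$, and let $X,Y,Z,W$ be a $g$-orthonormal basis of its Lie algebra $\mathfrak g$. For a left-invariant vector field $Q$ put $F(v)=\sqrt{g(v,v)}+g(Q,v)$, $v\in TG$. The flag curvature of a Finsler metric $F$ for the flag with pole $U$ and plane $P=\mathrm{span}\{U,V\}$ is $$K(P,U)=\frac{g_U(R(V,U)U,V)}{g_U(U,U)g_U(V,V)-g_U(U,V)^2},\qquad g_U(A,B)=\tfrac12\,\frac{\partial^2}{\partial s\,\partial t}F^2(U+sA+tB)\Big|_{s=t=0},$$ where $R$ is the curvature of the Chern connection of $F$ with reference vector $U$; $F$ is of Berwald type if the coefficients of its Chern connection in local coordinates do not depend on the direction. (A) If $Q$ is parallel for the Levi-Civita connection of $g$ and $0<\|Q\|<1$, then $F$ is a left-invariant Finsler metric (a Randers metric) of Berwald type, and for all linearly independent $U,V\in T_pG$, $p\in G$, $$K(P,U)=\frac{g(R^g(V,U)U,V)}{\big(\|U\|^2\|V\|^2-g(U,V)^2\big)\big(1+g(Q,U)/\|U\|\big)^2},$$ where $R^g$ is the Riemann curvature of $g$. (B)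 Let $U=aX+bY+cZ+dW$ and $V=\tilde aX+\tilde bY+\tilde cZ+\tilde dW$ be left-invariant. In each case below (brackets of basis vectors that are not listed are zero) the left-invariant parallel fields $Q$ are exactly the stated ones. If moreover $0<\|Q\|<1$, then $F$ is a left-invariant Finsler metric of Berwald type and, at every point of $G$, $K(P,U)=N/(1+g(Q,U))^2$ for $g$-orthonormal $U,V$, and more generally $K(P,U)=N/\{(\|U\|^2\|V\|^2-g(U,V)^2)(1+g(Q,U)/\|U\|)^2\}$ for linearly independent $U,V$, with $N$ as stated. 1. $[X,Y]=Y$, $[X,W]=W$: $Q=qZ$, $N=-\{(a\tilde b-b\tilde a)^2+(a\tilde d-d\tilde a)^2+(b\tilde d-d\tilde b)^2\}$; here $g(Q,U)=qc$. 2. $[X,Y]=Z$: $Q=qW$, $N=\frac14\{(a\tilde c-c\tilde a)^2+(b\tilde c-c\tilde b)^2-3(a\tilde b-b\tilde a)^2\}$. 3. $[X,Y]=X$: $Q=q_1Z+q_2W$, $N=-(a\tilde b-b\tilde a)^2$. 4. $[X,Z]=X$, $[X,W]=Y$, $[Y,Z]=Y$, $[Y,W]=\alpha X+\beta Y$ with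 $\alpha,\beta\in\mathbb R$: a nonzero parallel left-invariant field exists if and only if $\alpha=-1$ and $\beta=0$. For $\alpha=-1$, $\beta=0$: $Q=qW$, $N=-\{(a\tilde b-b\tilde a)^2+(a\tilde c-c\tilde a)^2+(b\tilde c-c\tilde b)^2\}$. 6. $[X,Y]=W$, $[X,W]=-Y$, $[Y,W]=-X$: $Q=qZ$, $N=\frac14\{(a\tilde b-b\tilde a)^2+(a\tilde d-d\tilde a)^2-7(b\tilde d-d\tilde b)^2\}$. (C) Consequently, in Case 1, in Case 3, and in Case 4 with $\alpha=-1$, $\beta=0$, every such $F$ has non-positive flag curvature (for all flags at all points), while in Case 6 every such $F$ has, at every point of $G$, flags of positive and flags of negative flag curvature. -/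

import Mathlib

open scoped Manifold ContDiff

noncomputable section

namespace FinslerLie

/-- The coordinate space `ℝⁿ`. -/
abbrev Coord (n : ℕ) : Type := EuclideanSpace ℝ (Fin n)

/-! ### Finsler geometry in coordinates

`L x y` is a Finsler function on (an open part of) `ℝⁿ`, where `x` is the position and `y` the
direction. A function of the two arguments has partial derivatives `∂/∂xᵏ` and `∂/∂yᵏ`. -/

section Coordinates

variable {n : ℕ}

/-- `∂f/∂xᵏ` at `(x, y)`. -/
def pdx (k : Fin n) (f : Coord n → Coord n → ℝ) (x y : Coord n) : ℝ :=
  fderiv ℝ (fun x' => f x' y) x (EuclideanSpace.single k 1)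

/-- `∂f/∂yᵏ` at `(x, y)`. -/
def pdy (k : Fin n) (f : Coord n → Coord n → ℝ) (x y : Coord n) : ℝ :=
  fderiv ℝ (fun y' => f x y') y (EuclideanSpace.single k 1)

/-- `g_ij(x, y) = ½ ∂²(L²)/∂yⁱ∂yʲ`. -/
def gCoeff (L : Coord n → Coord n → ℝ) (i j : Fin n) (x y : Coord n) : ℝ :=
  (1 / 2) * pdy i (pdy j (fun x' y' => L x' y' ^ 2)) x y

/-- The inverse matrix `g^ij(x, y)`. -/
def gInv (L : Coord n → Coord n → ℝ) (i j : Fin n) (x y : Coord n) : ℝ :=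
  ((Matrix.of fun a b => gCoeff L a b x y)⁻¹ : Matrix (Fin n) (Fin n) ℝ) i j

/-- The Cartan tensor `C_ijk = ½ ∂g_ij/∂yᵏ`. -/
def cartanCoeff (L : Coord n → Coord n → ℝ) (i j k : Fin n) (x y : Coord n) : ℝ :=
  (1 / 2) * pdy k (gCoeff L i j) x y

/-- The formal Christoffel symbols
`γⁱ_jk = ½ gⁱˢ (∂g_sj/∂xᵏ - ∂g_jk/∂xˢ + ∂g_ks/∂xʲ)`. -/
def formalChristoffel (L : Coord n → Coord n → ℝ) (i j k : Fin n) (x y : Coord n) : ℝ :=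
  (1 / 2) * ∑ s, gInv L i s x y *
    (pdx k (gCoeff L s j) x y - pdx s (gCoeff L j k) x y + pdx j (gCoeff L k s) x y)

/-- The nonlinear connection `Nⁱ_j = γⁱ_jk yᵏ - Cⁱ_jk γᵏ_rs yʳ yˢ`. -/
def nonlinearConnection (L : Coord n → Coord n → ℝ) (i j : Fin n) (x y : Coord n) : ℝ :=
  (∑ k, formalChristoffel L i j k x y * y k) -
    ∑ k, (∑ m, gInv L i m x y * cartanCoeff L m j k x y) *
      ∑ r, ∑ s, formalChristoffel L k r s x y * y r * y s

/-- The horizontal derivative `δf/δxᵏ = ∂f/∂xᵏ - Nˢ_k ∂f/∂yˢ`. -/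
def hDeriv (L : Coord n → Coord n → ℝ) (k : Fin n) (f : Coord n → Coord n → ℝ)
    (x y : Coord n) : ℝ :=
  pdx k f x y - ∑ s, nonlinearConnection L s k x y * pdy s f x y

/-- The coefficients of the Chern connection,
`Γⁱ_jk = ½ gⁱˢ (δg_sj/δxᵏ - δg_jk/δxˢ + δg_ks/δxʲ)`. -/
def chernCoeff (L : Coord n → Coord n → ℝ) (i j k : Fin n) (x y : Coord n) : ℝ :=
  (1 / 2) * ∑ s, gInv L i s x y *
    (hDeriv L k (gCoeff L s j) x y - hDeriv L s (gCoeff L j k) x y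
      + hDeriv L j (gCoeff L k s) x y)

/-- The (horizontal) curvature of the Chern connection,
`R_jⁱ_kl = δΓⁱ_jl/δxᵏ - δΓⁱ_jk/δxˡ + Γⁱ_hk Γʰ_jl - Γⁱ_hl Γʰ_jk`,
so that `R(∂_k, ∂_l) ∂_j = R_jⁱ_kl ∂_i`. -/
def chernCurvatureCoeff (L : Coord n → Coord n → ℝ) (j i k l : Fin n) (x y : Coord n) : ℝ :=
  hDeriv L k (chernCoeff L i j l) x y - hDeriv L l (chernCoeff L i j k) x y
    + ∑ h, (chernCoeff L i h k x y * chernCoeff L h j l x y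
      - chernCoeff L i h l x y * chernCoeff L h j k x y)

end Coordinates

/-! ### Finsler and Riemannian metrics on manifolds -/

section Manifolds

variable {n : ℕ} {M : Type*} [TopologicalSpace M] [ChartedSpace (Coord n) M]

/-- The tangent vector at the point with coordinates `x` (in the chart at `p`) with components
`y`. -/
def chartVec (p : M) (x y : Coord n) :
    TangentSpace (𝓡 n) ((extChartAt (𝓡 n) p).symm x) :=
  mfderiv (𝓡 n) (𝓡 n) (extChartAt (𝓡 n) p).symm x y

/-- The components, in the chart at `p`, of a tangent vector at `q`. -/
def components (p q : M) (v : TangentSpace (𝓡 n) q) : Coord n :=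
  mfderiv (𝓡 n) (𝓡 n) (extChartAt (𝓡 n) p) q v

/-- The tangent vector at `p` with given components in the chart at `p`. -/
def ofComponents (p : M) (w : Coord n) : TangentSpace (𝓡 n) p :=
  (mfderiv (𝓡 n) (𝓡 n) (extChartAt (𝓡 n) p) p).inverse w

/-- The coordinate expression of a function on the tangent bundle in the chart at `p`. -/
def localExpr (F : TangentBundle (𝓡 n) M → ℝ) (p : M) (x y : Coord n) : ℝ :=
  F ⟨(extChartAt (𝓡 n) p).symm x, chartVec p x y⟩

/-- `g_Y(U, V) = ½ ∂²/∂s∂t F²(Y + sU + tV)` at `s = t = 0`. -/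
def fundamentalTensor (F : TangentBundle (𝓡 n) M → ℝ) (p : M)
    (Y U V : TangentSpace (𝓡 n) p) : ℝ :=
  (1 / 2) * deriv (fun s : ℝ => deriv (fun t : ℝ => F ⟨p, Y + s • U + t • V⟩ ^ 2) 0) 0

/-- Finsler metrics: non-negative, smooth off the zero section, positively homogeneous of degree
one, and with positive definite fundamental tensor. -/
structure IsFinslerMetric [IsManifold (𝓡 n) 1 M] (F : TangentBundle (𝓡 n) M → ℝ) : Prop where
  nonneg : ∀ v, 0 ≤ F v
  smooth : ContMDiffOn (𝓡 n).tangent 𝓘(ℝ, ℝ) ∞ F {v | v.2 ≠ 0}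
  homogeneous : ∀ (p : M) (Y : TangentSpace (𝓡 n) p) (c : ℝ), 0 < c →
    F ⟨p, c • Y⟩ = c * F ⟨p, Y⟩
  posDef : ∀ (p : M) (Y : TangentSpace (𝓡 n) p), Y ≠ 0 →
    ∀ U : TangentSpace (𝓡 n) p, U ≠ 0 → 0 < fundamentalTensor F p Y U U

/-- `F` is of Berwald type: in the charts of `M` the coefficients of the Chern connection depend on
the position only, not on the direction. -/
def IsBerwald (F : TangentBundle (𝓡 n) M → ℝ) : Prop :=
  ∀ p : M, ∀ x ∈ (extChartAt (𝓡 n) p).target, ∀ y y' : Coord n, y ≠ 0 → y' ≠ 0 →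
    ∀ i j k, chernCoeff (localExpr F p) i j k x y = chernCoeff (localExpr F p) i j k x y'

/-- The curvature `R(U, V) W` at `p` of the Chern connection of `F` with reference vector `Y`. -/
def chernCurvature (F : TangentBundle (𝓡 n) M → ℝ) (p : M)
    (Y U V W : TangentSpace (𝓡 n) p) : TangentSpace (𝓡 n) p :=
  ofComponents p (WithLp.toLp 2 fun i => ∑ j, ∑ k, ∑ l,
    chernCurvatureCoeff (localExpr F p) j i k l (extChartAt (𝓡 n) p p) (components p p Y)
      * components p p W j * components p p U k * components p p V l)

/-- The flag curvature `K(P, Y)` of the flag with pole `Y` and plane `P = span {U, Y}`. -/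
def flagCurvature (F : TangentBundle (𝓡 n) M → ℝ) (p : M) (Y U : TangentSpace (𝓡 n) p) : ℝ :=
  fundamentalTensor F p Y (chernCurvature F p Y U Y Y) U /
    (fundamentalTensor F p Y Y Y * fundamentalTensor F p Y U U
      - fundamentalTensor F p Y Y U ^ 2)

variable [IsManifold (𝓡 n) 1 M]

/-- Smooth Riemannian metrics on `M`. -/
abbrev RiemMetric (n : ℕ) (M : Type*) [TopologicalSpace M] [ChartedSpace (Coord n) M]
    [IsManifold (𝓡 n) 1 M] :=
  Bundle.ContMDiffRiemannianMetric (𝓡 n) ∞ (Coord n) (fun p : M => TangentSpace (𝓡 n) p)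

/-- The norm of a tangent vector. -/
def gNorm (g : RiemMetric n M) (p : M) (v : TangentSpace (𝓡 n) p) : ℝ :=
  √(g.inner p v v)

/-- The Gram determinant `g(U,U) g(V,V) - g(U,V)²`. -/
def gram (g : RiemMetric n M) (p : M) (U V : TangentSpace (𝓡 n) p) : ℝ :=
  g.inner p U U * g.inner p V V - g.inner p U V ^ 2

/-- The components `g_ij(x)` in the chart at `p`. -/
def riemCoeff (g : RiemMetric n M) (p : M) (i j : Fin n) (x : Coord n) : ℝ :=
  g.inner ((extChartAt (𝓡 n) p).symm x)
    (chartVec p x (EuclideanSpace.single i 1)) (chartVec p x (EuclideanSpace.single j 1))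

/-- `∂f/∂xᵏ` at `x`. -/
def pd (k : Fin n) (f : Coord n → ℝ) (x : Coord n) : ℝ :=
  fderiv ℝ f x (EuclideanSpace.single k 1)

/-- The Christoffel symbols of the Levi-Civita connection in the chart at `p`,
`Γⁱ_jk = ½ gⁱˢ (∂_k g_sj - ∂_s g_jk + ∂_j g_ks)`. -/
def christoffel (g : RiemMetric n M) (p : M) (i j k : Fin n) (x : Coord n) : ℝ :=
  (1 / 2) * ∑ s, ((Matrix.of fun a b => riemCoeff g p a b x)⁻¹ : Matrix (Fin n) (Fin n) ℝ) i s *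
    (pd k (riemCoeff g p s j) x - pd s (riemCoeff g p j k) x + pd j (riemCoeff g p k s) x)

/-- The vector field `Q` is parallel for the Levi-Civita connection of `g`:
`∂_k Qⁱ + Γⁱ_jk Qʲ = 0` in the charts of `M`. -/
def IsParallel (g : RiemMetric n M) (Q : ∀ p : M, TangentSpace (𝓡 n) p) : Prop :=
  ∀ p : M, ∀ x ∈ (extChartAt (𝓡 n) p).target, ∀ i k,
    pd k (fun x' => components p ((extChartAt (𝓡 n) p).symm x')
        (Q ((extChartAt (𝓡 n) p).symm x')) i) x
      + ∑ j, christoffel g p i j k x *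
        components p ((extChartAt (𝓡 n) p).symm x) (Q ((extChartAt (𝓡 n) p).symm x)) j = 0

/-- The Riemann curvature tensor in the chart at `p`,
`R_jⁱ_kl = ∂_k Γⁱ_jl - ∂_l Γⁱ_jk + Γⁱ_hk Γʰ_jl - Γⁱ_hl Γʰ_jk`. -/
def riemCurvatureCoeff (g : RiemMetric n M) (p : M) (j i k l : Fin n) (x : Coord n) : ℝ :=
  pd k (christoffel g p i j l) x - pd l (christoffel g p i j k) x
    + ∑ h, (christoffel g p i h k x * christoffel g p h j l x
      - christoffel g p i h l x * christoffel g p h j k x)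

/-- The Riemann curvature `R(U, V) W` at `p`. -/
def riemCurvature (g : RiemMetric n M) (p : M) (U V W : TangentSpace (𝓡 n) p) :
    TangentSpace (𝓡 n) p :=
  ofComponents p (WithLp.toLp 2 fun i => ∑ j, ∑ k, ∑ l,
    riemCurvatureCoeff g p j i k l (extChartAt (𝓡 n) p p)
      * components p p W j * components p p U k * components p p V l)

/-- The Randers function `√g(Y,Y) + g(Q,Y)`. -/
def randers (g : RiemMetric n M) (Q : ∀ p : M, TangentSpace (𝓡 n) p) :
    TangentBundle (𝓡 n) M → ℝ :=
  fun v => √(g.inner v.1 v.2 v.2) + g.inner v.1 (Q v.1) v.2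

end Manifolds

/-! ### Left-invariant objects on Lie groups -/

section LieGroups

variable {n : ℕ} {G : Type*} [TopologicalSpace G] [ChartedSpace (Coord n) G] [Group G]

/-- Left-invariant Riemannian metrics. -/
def IsLeftInvariantMetric [IsManifold (𝓡 n) 1 G] (g : RiemMetric n G) : Prop :=
  ∀ (a b : G) (u v : TangentSpace (𝓡 n) b),
    g.inner (a * b) (mfderiv (𝓡 n) (𝓡 n) (a * ·) b u) (mfderiv (𝓡 n) (𝓡 n) (a * ·) b v)
      = g.inner b u v

/-- Left-invariant functions on the tangent bundle. -/
def IsLeftInvariantFinsler (F : TangentBundle (𝓡 n) G → ℝ) : Prop :=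
  ∀ (a b : G) (y : TangentSpace (𝓡 n) b),
    F ⟨a * b, mfderiv (𝓡 n) (𝓡 n) (a * ·) b y⟩ = F ⟨b, y⟩

/-- The left-invariant vector field with value `u` at the identity. -/
abbrev leftInv (u : GroupLieAlgebra (𝓡 n) G) : ∀ a : G, TangentSpace (𝓡 n) a :=
  mulInvariantVectorField u

end LieGroups

section DimensionFour

variable {G : Type*} [TopologicalSpace G] [ChartedSpace (Coord 4) G] [Group G]

/-- The brackets of the basis `e = (X, Y, Z, W)` of the Lie algebra. -/
structure HasBrackets (e : Module.Basis (Fin 4) ℝ (GroupLieAlgebra (𝓡 4) G))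
    (bXY bXZ bXW bYZ bYW bZW : GroupLieAlgebra (𝓡 4) G) : Prop where
  XY : ⁅e 0, e 1⁆ = bXY
  XZ : ⁅e 0, e 2⁆ = bXZ
  XW : ⁅e 0, e 3⁆ = bXW
  YZ : ⁅e 1, e 2⁆ = bYZ
  YW : ⁅e 1, e 3⁆ = bYW
  ZW : ⁅e 2, e 3⁆ = bZW

/-- `[X,Y] = Y`, `[X,W] = W`. -/
def IsAlgebra1 (e : Module.Basis (Fin 4) ℝ (GroupLieAlgebra (𝓡 4) G)) : Prop :=
  HasBrackets e (e 1) 0 (e 3) 0 0 0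

/-- `[X,Y] = Z`. -/
def IsAlgebra2 (e : Module.Basis (Fin 4) ℝ (GroupLieAlgebra (𝓡 4) G)) : Prop :=
  HasBrackets e (e 2) 0 0 0 0 0

/-- `[X,Y] = X`. -/
def IsAlgebra3 (e : Module.Basis (Fin 4) ℝ (GroupLieAlgebra (𝓡 4) G)) : Prop :=
  HasBrackets e (e 0) 0 0 0 0 0

/-- `[X,Z] = X`, `[X,W] = Y`, `[Y,Z] = Y`, `[Y,W] = αX + βY`. -/
def IsAlgebra4 (e : Module.Basis (Fin 4) ℝ (GroupLieAlgebra (𝓡 4) G)) (α β : ℝ) : Prop :=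
  HasBrackets e 0 (e 0) (e 1) (e 1) (α • e 0 + β • e 1) 0

/-- `[X,Y] = W`, `[X,W] = -Y`, `[Y,W] = -X`. -/
def IsAlgebra6 (e : Module.Basis (Fin 4) ℝ (GroupLieAlgebra (𝓡 4) G)) : Prop :=
  HasBrackets e (e 3) 0 (-e 1) 0 (-e 0) 0

variable [IsManifold (𝓡 4) 1 G]

/-- The Randers metric `F` of `g` and the left-invariant field of `q` is a left-invariant Finsler
metric of Berwald type. -/
def IsLeftInvariantBerwaldRanders (g : RiemMetric 4 G) (q : GroupLieAlgebra (𝓡 4) G) : Prop :=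
  IsFinslerMetric (randers g (leftInv q)) ∧ IsLeftInvariantFinsler (randers g (leftInv q)) ∧
    IsBerwald (randers g (leftInv q))

/-- The flag curvature of the Randers metric of `g` and `q` has numerator `N`, a function of the
coordinates of `U` and `V` in the orthonormal basis `e`: one has
`K(P,U) = N(U,V) / (1 + g(Q,U))²` for orthonormal left-invariant `U, V`, and
`K(P,U) = N(U,V) / ((‖U‖²‖V‖² - g(U,V)²) (1 + g(Q,U)/‖U‖)²)` for independent ones, where
`P = span {U, V}`. -/
def FlagCurvatureFormula (g : RiemMetric 4 G)
    (e : Module.Basis (Fin 4) ℝ (GroupLieAlgebra (𝓡 4) G)) (q : GroupLieAlgebra (𝓡 4) G)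
    (N : (Fin 4 → ℝ) → (Fin 4 → ℝ) → ℝ) : Prop :=
  (∀ (a : G) (u v : GroupLieAlgebra (𝓡 4) G),
    g.inner 1 u u = 1 → g.inner 1 v v = 1 → g.inner 1 u v = 0 →
    flagCurvature (randers g (leftInv q)) a (leftInv u a) (leftInv v a)
      = N (e.equivFun u) (e.equivFun v) / (1 + g.inner 1 q u) ^ 2) ∧
  (∀ (a : G) (u v : GroupLieAlgebra (𝓡 4) G), LinearIndependent ℝ ![u, v] →
    flagCurvature (randers g (leftInv q)) a (leftInv u a) (leftInv v a)
      = N (e.equivFun u) (e.equivFun v) /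
        (gram g 1 u v * (1 + g.inner 1 q u / gNorm g 1 u) ^ 2))

/-- Every flag of `F` at every point has non-positive flag curvature. -/
def NonposFlagCurvature (F : TangentBundle (𝓡 4) G → ℝ) : Prop :=
  ∀ (p : G) (y u : TangentSpace (𝓡 4) p), LinearIndependent ℝ ![y, u] →
    flagCurvature F p y u ≤ 0

end DimensionFour

end FinslerLie

end

/-! Parallel transport of `g` preserves `√g(y,y)`, and it preserves `g(Q,y)` when `Q` is parallel;
hence it preserves `F`. In a chart this says that the energy `E = L²` satisfies `∂E/∂xᵏ = Γˢ_mk yᵐ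
∂E/∂yˢ`, with `Γ` the Levi-Civita symbols. For any torsion-free linear connection `Γ` and any
homogeneous non-degenerate energy, this equation forces the Chern connection to be `Γ`.
Differentiating it twice in `y` expresses `∂g_ij/∂xᵏ` through `Γ` and the Cartan tensor `C`. By the
symmetry of `C` and `C_ijk yᵏ = 0`, the Cartan terms then cancel in the nonlinear connection, which
becomes `Γⁱ_mj yᵐ`, and the horizontal derivatives of `g_ij` contain no `C` at all
(`IsBerwaldConnection.chernCoeff_eq`). So `F` is of Berwald type and its Chern curvature is the
Riemann curvature of `g`.

For the flag curvature put `α = √g(y,y)`. The fundamental tensor at `y` is the explicit form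
`randersTensor`, which is positive definite when `‖Q‖ < 1`. The vector `R(u,y)y` is orthogonal to
`y` because `R(u,y)` is skew, and orthogonal to `Q` because `R(u,y)Q = 0`. Pairing with such a
vector multiplies `g` by `F/α`, while the Gram determinant of the flag is multiplied by `(F/α)³`.
The quotient therefore differs from the sectional curvature by `(F/α)⁻² = (1 + g(Q,y)/α)⁻²`
(`randersTensor_flag`).

On a Lie group a left-invariant orthonormal frame has constant structure functions, so the Koszul
formula gives constant connection coefficients `connCoeff`. Parallelism of a left-invariant field
becomes a linear system (`isParallel_leftInv_iff`) and the curvature a polynomial in the structure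
constants (`inner_riemCurvature`). The five algebras are settled by computing both explicitly. The
numerators in Cases 1, 3 and 4 are minus sums of squares, as for `H³ × ℝ`, `H² × ℝ²` and `H³ × ℝ`.
In Case 6 the plane of `X, Y` has sectional curvature `1/4` and that of `Y, W` has `-7/4`. -/

noncomputable section

namespace FinslerLie

/-! ### Partial derivatives of functions of position and nonzero direction. -/

section PairCalculus

variable {n : ℕ} {T : Set (Coord n)} {f h : Coord n → Coord n → ℝ} {x y : Coord n}

/-- Smoothness on `T × (ℝⁿ ∖ {0})`. -/
def SmoothOffZero (T : Set (Coord n)) (f : Coord n → Coord n → ℝ) : Prop :=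
  ContDiffOn ℝ ∞ (fun z : Coord n × Coord n => f z.1 z.2) (T ×ˢ {0}ᶜ)

lemma isOpen_offZero (hT : IsOpen T) : IsOpen (T ×ˢ ({0}ᶜ : Set (Coord n))) :=
  hT.prod isOpen_compl_singleton

lemma SmoothOffZero.contDiffAt (hf : SmoothOffZero T f) (hT : IsOpen T) (hx : x ∈ T) (hy : y ≠ 0) :
    ContDiffAt ℝ ∞ (fun z : Coord n × Coord n => f z.1 z.2) (x, y) :=
  ContDiffOn.contDiffAt hf ((isOpen_offZero hT).mem_nhds ⟨hx, hy⟩)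

lemma SmoothOffZero.differentiableAt (hf : SmoothOffZero T f) (hT : IsOpen T) (hx : x ∈ T)
    (hy : y ≠ 0) : DifferentiableAt ℝ (fun z : Coord n × Coord n => f z.1 z.2) (x, y) :=
  (hf.contDiffAt hT hx hy).differentiableAt (by simp)

lemma SmoothOffZero.differentiableAt_fst (hf : SmoothOffZero T f) (hT : IsOpen T) (hx : x ∈ T)
    (hy : y ≠ 0) : DifferentiableAt ℝ (fun x' => f x' y) x :=
  (hf.differentiableAt hT hx hy).comp (f := fun x' => (x', y)) x (by fun_prop)

lemma SmoothOffZero.differentiableAt_snd (hf : SmoothOffZero T f) (hT : IsOpen T) (hx : x ∈ T)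
    (hy : y ≠ 0) : DifferentiableAt ℝ (fun y' => f x y') y :=
  (hf.differentiableAt hT hx hy).comp (f := fun y' => (x, y')) y (by fun_prop)

/-- Partial derivatives become values of the total derivative in `x` and `y` jointly; their
smoothness and their commutation are then inherited from it. -/
lemma SmoothOffZero.pdx_eq (hf : SmoothOffZero T f) (hT : IsOpen T) (hx : x ∈ T) (hy : y ≠ 0)
    (k : Fin n) : pdx k f x y = fderiv ℝ (fun z : Coord n × Coord n => f z.1 z.2) (x, y)
      (EuclideanSpace.single k 1, 0) := by
  have h1 : HasFDerivAt (fun x' : Coord n => (x', y)) (ContinuousLinearMap.inl ℝ _ _) x :=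
    hasFDerivAt_prodMk_left x y
  have h2 := (hf.differentiableAt hT hx hy).hasFDerivAt.comp x h1
  have h3 : HasFDerivAt (fun x' => f x' y) _ x := h2
  rw [pdx, h3.fderiv]
  simp

lemma SmoothOffZero.pdy_eq (hf : SmoothOffZero T f) (hT : IsOpen T) (hx : x ∈ T) (hy : y ≠ 0)
    (k : Fin n) : pdy k f x y = fderiv ℝ (fun z : Coord n × Coord n => f z.1 z.2) (x, y)
      (0, EuclideanSpace.single k 1) := by
  have h1 : HasFDerivAt (fun y' : Coord n => (x, y')) (ContinuousLinearMap.inr ℝ _ _) y :=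
    hasFDerivAt_prodMk_right x y
  have h2 := (hf.differentiableAt hT hx hy).hasFDerivAt.comp y h1
  have h3 : HasFDerivAt (fun y' => f x y') _ y := h2
  rw [pdy, h3.fderiv]
  simp

lemma SmoothOffZero.fderiv_apply (hf : SmoothOffZero T f) (hT : IsOpen T) (v : Coord n × Coord n) :
    ContDiffOn ℝ ∞ (fun z => fderiv ℝ (fun z : Coord n × Coord n => f z.1 z.2) z v)
      (T ×ˢ {0}ᶜ) :=
  (ContDiffOn.fderiv_of_isOpen hf (isOpen_offZero hT) (by simp)).clm_apply contDiffOn_const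

lemma SmoothOffZero.smooth_pdx (hf : SmoothOffZero T f) (hT : IsOpen T) (k : Fin n) :
    SmoothOffZero T (pdx k f) :=
  (hf.fderiv_apply hT _).congr fun _ hz => hf.pdx_eq hT hz.1 hz.2 k

lemma SmoothOffZero.smooth_pdy (hf : SmoothOffZero T f) (hT : IsOpen T) (k : Fin n) :
    SmoothOffZero T (pdy k f) :=
  (hf.fderiv_apply hT _).congr fun _ hz => hf.pdy_eq hT hz.1 hz.2 k

lemma pdx_congr (hT : IsOpen T) (hfh : ∀ x ∈ T, ∀ y ≠ 0, f x y = h x y) (hx : x ∈ T) (hy : y ≠ 0)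
    (k : Fin n) : pdx k f x y = pdx k h x y := by
  have : (fun x' => f x' y) =ᶠ[nhds x] fun x' => h x' y := by
    filter_upwards [hT.mem_nhds hx] with x' hx' using hfh x' hx' y hy
  rw [pdx, pdx, this.fderiv_eq]

lemma pdy_congr (hfh : ∀ x ∈ T, ∀ y ≠ 0, f x y = h x y) (hx : x ∈ T) (hy : y ≠ 0)
    (k : Fin n) : pdy k f x y = pdy k h x y := by
  have : (fun y' => f x y') =ᶠ[nhds y] fun y' => h x y' := by
    filter_upwards [isOpen_compl_singleton.mem_nhds hy] with y' hy' using hfh x hx y' hy'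
  rw [pdy, pdy, this.fderiv_eq]

lemma SmoothOffZero.fderiv_fderiv_comm (hf : SmoothOffZero T f) (hT : IsOpen T) (hx : x ∈ T)
    (hy : y ≠ 0) (v w : Coord n × Coord n) :
    fderiv ℝ (fun z => fderiv ℝ (fun z : Coord n × Coord n => f z.1 z.2) z v) (x, y) w
      = fderiv ℝ (fun z => fderiv ℝ (fun z : Coord n × Coord n => f z.1 z.2) z w) (x, y) v := by
  have hc := hf.contDiffAt hT hx hy
  have hd : DifferentiableAt ℝ (fderiv ℝ (fun z : Coord n × Coord n => f z.1 z.2)) (x, y) :=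
    (hc.fderiv_right (m := 1) (by
      rw [one_add_one_eq_two]; exact ENat.LEInfty.out)).differentiableAt (by simp)
  have key : ∀ v w : Coord n × Coord n,
      fderiv ℝ (fun z => fderiv ℝ (fun z : Coord n × Coord n => f z.1 z.2) z v) (x, y) w
      = fderiv ℝ (fderiv ℝ (fun z : Coord n × Coord n => f z.1 z.2)) (x, y) w v := by
    intro v w
    rw [fderiv_clm_apply hd (by fun_prop)]
    simp
  rw [key, key]
  exact (hc.isSymmSndFDerivAt (by
    rw [minSmoothness_of_isRCLikeNormedField]; exact ENat.LEInfty.out)) w v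

lemma SmoothOffZero.pdx_pdy (hf : SmoothOffZero T f) (hT : IsOpen T) (hx : x ∈ T) (hy : y ≠ 0)
    (k i : Fin n) : pdx k (pdy i f) x y
      = pdy i (pdx k f) x y := by
  rw [(hf.smooth_pdy hT i).pdx_eq hT hx hy, (hf.smooth_pdx hT k).pdy_eq hT hx hy]
  have e := (isOpen_offZero hT).mem_nhds (show (x, y) ∈ T ×ˢ ({0}ᶜ : Set (Coord n)) from ⟨hx, hy⟩)
  have hi := Filter.EventuallyEq.fderiv_eq (𝕜 := ℝ)
    (Filter.eventually_of_mem e fun z hz => hf.pdy_eq hT hz.1 hz.2 i)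
  have hk := Filter.EventuallyEq.fderiv_eq (𝕜 := ℝ)
    (Filter.eventually_of_mem e fun z hz => hf.pdx_eq hT hz.1 hz.2 k)
  rw [hi, hk]
  exact hf.fderiv_fderiv_comm hT hx hy _ _

lemma SmoothOffZero.pdy_pdy (hf : SmoothOffZero T f) (hT : IsOpen T) (hx : x ∈ T) (hy : y ≠ 0)
    (k i : Fin n) : pdy k (pdy i f) x y
      = pdy i (pdy k f) x y := by
  rw [(hf.smooth_pdy hT i).pdy_eq hT hx hy, (hf.smooth_pdy hT k).pdy_eq hT hx hy]
  have e := (isOpen_offZero hT).mem_nhds (show (x, y) ∈ T ×ˢ ({0}ᶜ : Set (Coord n)) from ⟨hx, hy⟩)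
  have hi := Filter.EventuallyEq.fderiv_eq (𝕜 := ℝ)
    (Filter.eventually_of_mem e fun z hz => hf.pdy_eq hT hz.1 hz.2 i)
  have hk := Filter.EventuallyEq.fderiv_eq (𝕜 := ℝ)
    (Filter.eventually_of_mem e fun z hz => hf.pdy_eq hT hz.1 hz.2 k)
  rw [hi, hk]
  exact hf.fderiv_fderiv_comm hT hx hy _ _

/-- Derivative of a combination `∑ₛ,ₘ c s m yᵐ f s` whose coefficients depend on `x` only. -/
lemma pdy_sum_sum_coord_mul {F : Fin n → Coord n → Coord n → ℝ} (c : Fin n → Fin n → Coord n → ℝ)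
    (hF : ∀ s, DifferentiableAt ℝ (fun y' => F s x y') y) (i : Fin n) :
    pdy i (fun x y => ∑ s, ∑ m, c s m x * y m * F s x y) x y
      = ∑ s, c s i x * F s x y + ∑ s, (∑ m, c s m x * y m) * pdy i (F s) x y := by
  have h1 : ∀ m, HasFDerivAt (fun y' : Coord n => y' m) (EuclideanSpace.proj m : Coord n →L[ℝ] ℝ) y :=
    fun m => (EuclideanSpace.proj m : Coord n →L[ℝ] ℝ).hasFDerivAt
  have h2 : HasFDerivAt (fun y' => ∑ s, ∑ m, c s m x * y' m * F s x y') _ y :=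
    HasFDerivAt.fun_sum fun s _ => HasFDerivAt.fun_sum fun m _ =>
      ((h1 m).const_mul (c s m x)).mul (hF s).hasFDerivAt
  rw [pdy, h2.fderiv, ← Finset.sum_add_distrib]
  simp only [sum_apply]
  refine Finset.sum_congr rfl fun s _ => ?_
  simp only [add_apply, smul_apply, smul_eq_mul,
    Finset.sum_add_distrib, pdy, PiLp.proj_apply, Finset.sum_mul]
  rw [add_comm]
  congr 1
  rw [Finset.sum_eq_single i]
  · simp; ring
  · intro m _ hm
    simp [hm]
  · simp

end PairCalculus

/-! ### The Chern connection of an energy preserved by a torsion-free linear connection. -/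

section ChernConnection

variable {n : ℕ} {T : Set (Coord n)} {x y : Coord n}

lemma pdx_const_mul {f : Coord n → Coord n → ℝ} (c : ℝ)
    (hf : DifferentiableAt ℝ (fun x' => f x' y) x) (k : Fin n) :
    pdx k (fun x y => c * f x y) x y = c * pdx k f x y := by
  rw [pdx, fderiv_const_mul hf]; rfl

lemma pdy_const_mul {f : Coord n → Coord n → ℝ} (c : ℝ)
    (hf : DifferentiableAt ℝ (fun y' => f x y') y) (k : Fin n) :
    pdy k (fun x y => c * f x y) x y = c * pdy k f x y := by
  rw [pdy, fderiv_const_mul hf]; rfl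

lemma pdy_sum_mul {F : Fin n → Coord n → Coord n → ℝ} (c : Fin n → Coord n → ℝ)
    (hF : ∀ s, DifferentiableAt ℝ (fun y' => F s x y') y) (i : Fin n) :
    pdy i (fun x y => ∑ s, c s x * F s x y) x y = ∑ s, c s x * pdy i (F s) x y := by
  have h2 : HasFDerivAt (fun y' => ∑ s, c s x * F s x y') _ y :=
    HasFDerivAt.fun_sum fun s _ => ((hF s).hasFDerivAt).const_mul (c s x)
  rw [pdy, h2.fderiv]
  simp [pdy]

/-- The product rule applied to an Euler-type identity. Each use lowers the degree of homogeneity by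
one: from `E` to its first derivatives, then to its second. -/
lemma SmoothOffZero.pdy_euler {F : Fin n → Coord n → Coord n → ℝ} {H : Coord n → Coord n → ℝ}
    (hT : IsOpen T) (hF : ∀ s, SmoothOffZero T (F s))
    (h : ∀ x ∈ T, ∀ y ≠ 0, ∑ s, y s * F s x y = H x y) (hx : x ∈ T) (hy : y ≠ 0) (i : Fin n) :
    F i x y + ∑ s, y s * pdy i (F s) x y = pdy i H x y := by
  -- Kronecker coefficients put the single sum into the form covered by `pdy_sum_sum_coord_mul`.
  have h1 : ∀ x ∈ T, ∀ y ≠ 0,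
      ∑ s, ∑ m, (if s = m then (1 : ℝ) else 0) * y m * F s x y = H x y := by
    intro x hx y hy
    simp [h x hx y hy]
  have h2 := pdy_congr h1 hx hy i
  rw [pdy_sum_sum_coord_mul (fun s m _ => if s = m then (1 : ℝ) else 0)
    fun s => (hF s).differentiableAt_snd hT hx hy] at h2
  simpa using h2

variable {L : Coord n → Coord n → ℝ} {Γ : Fin n → Fin n → Fin n → Coord n → ℝ}

/-- The hypotheses under which the Chern connection of `L` is the linear connection `Γ`: the energy
`L²` is smooth, homogeneous and non-degenerate, and it is invariant under the parallel transport of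
the symmetric connection `Γ`. -/
structure IsBerwaldConnection (T : Set (Coord n)) (L : Coord n → Coord n → ℝ)
    (Γ : Fin n → Fin n → Fin n → Coord n → ℝ) : Prop where
  isOpen : IsOpen T
  smooth : SmoothOffZero T (fun x y => L x y ^ 2)
  euler : ∀ x ∈ T, ∀ y ≠ 0, ∑ s, y s * pdy s (fun x y => L x y ^ 2) x y = 2 * L x y ^ 2
  symm : ∀ x ∈ T, ∀ i j k, Γ i j k x = Γ i k j x
  parallel : ∀ x ∈ T, ∀ y ≠ 0, ∀ k, pdx k (fun x y => L x y ^ 2) x y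
    = ∑ s, ∑ m, Γ s m k x * y m * pdy s (fun x y => L x y ^ 2) x y
  nondeg : ∀ x ∈ T, ∀ y ≠ 0, IsUnit (Matrix.of fun a b => gCoeff L a b x y).det

namespace IsBerwaldConnection

lemma gCoeff_symm (h : IsBerwaldConnection T L Γ) (hx : x ∈ T) (hy : y ≠ 0) (i j : Fin n) :
    gCoeff L i j x y = gCoeff L j i x y := by
  rw [gCoeff, gCoeff, h.smooth.pdy_pdy h.isOpen hx hy]

lemma cartanCoeff_eq (h : IsBerwaldConnection T L Γ) (hx : x ∈ T) (hy : y ≠ 0) (i j k : Fin n) :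
    cartanCoeff L i j k x y
      = (1 / 4) * pdy k (pdy i (pdy j (fun x y => L x y ^ 2))) x y := by
  have : pdy k (gCoeff L i j) x y
      = (1 / 2) * pdy k (pdy i (pdy j (fun x y => L x y ^ 2))) x y :=
    pdy_const_mul _ (((h.smooth.smooth_pdy h.isOpen j).smooth_pdy h.isOpen i).differentiableAt_snd
      h.isOpen hx hy) k
  rw [cartanCoeff, this]; ring

lemma cartanCoeff_swap (h : IsBerwaldConnection T L Γ) (hx : x ∈ T) (hy : y ≠ 0) (i j k : Fin n) :
    cartanCoeff L i j k x y = cartanCoeff L j i k x y := by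
  rw [h.cartanCoeff_eq hx hy, h.cartanCoeff_eq hx hy, pdy_congr
    (fun x hx y hy => h.smooth.pdy_pdy h.isOpen hx hy i j) hx hy]

lemma cartanCoeff_rotate (h : IsBerwaldConnection T L Γ) (hx : x ∈ T) (hy : y ≠ 0)
    (i j k : Fin n) : cartanCoeff L i j k x y = cartanCoeff L k j i x y := by
  rw [h.cartanCoeff_eq hx hy, h.cartanCoeff_eq hx hy,
    (h.smooth.smooth_pdy h.isOpen j).pdy_pdy h.isOpen hx hy]

lemma sum_pdy_pdy (h : IsBerwaldConnection T L Γ) (hx : x ∈ T) (hy : y ≠ 0) (i : Fin n) :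
    ∑ s, y s * pdy i (pdy s (fun x y => L x y ^ 2)) x y = pdy i (fun x y => L x y ^ 2) x y := by
  have h1 := SmoothOffZero.pdy_euler h.isOpen (fun s => h.smooth.smooth_pdy h.isOpen s) h.euler
    hx hy i
  rw [pdy_const_mul _ (h.smooth.differentiableAt_snd h.isOpen hx hy)] at h1
  linarith

/-- The coefficients `g_ij` are homogeneous of degree zero in `y`, so their radial derivative
vanishes. -/
lemma sum_cartanCoeff (h : IsBerwaldConnection T L Γ) (hx : x ∈ T) (hy : y ≠ 0) (i j : Fin n) :
    ∑ k, cartanCoeff L i j k x y * y k = 0 := by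
  have h1 := SmoothOffZero.pdy_euler h.isOpen
    (fun s => (h.smooth.smooth_pdy h.isOpen s).smooth_pdy h.isOpen i)
    (fun x hx y hy => h.sum_pdy_pdy hx hy i) hx hy j
  have h2 : ∀ k, cartanCoeff L i j k x y * y k = (1 / 4) *
      (y k * pdy j (pdy i (pdy k (fun x y => L x y ^ 2))) x y) := by
    intro k
    -- Total symmetry moves the contracted index to the innermost derivative, where the Euler
    -- identity applies.
    rw [h.cartanCoeff_swap hx hy, h.cartanCoeff_rotate hx hy, h.cartanCoeff_swap hx hy,
      h.cartanCoeff_eq hx hy]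
    ring
  rw [Finset.sum_congr rfl fun k _ => h2 k, ← Finset.mul_sum]
  rw [h.smooth.pdy_pdy h.isOpen hx hy] at h1
  linarith

lemma pdx_pdy (h : IsBerwaldConnection T L Γ) (hx : x ∈ T) (hy : y ≠ 0) (k i : Fin n) :
    pdx k (pdy i (fun x y => L x y ^ 2)) x y
      = ∑ s, Γ s i k x * pdy s (fun x y => L x y ^ 2) x y
        + ∑ s, (∑ m, Γ s m k x * y m) * pdy i (pdy s (fun x y => L x y ^ 2)) x y := by
  rw [h.smooth.pdx_pdy h.isOpen hx hy, pdy_congr (fun x hx y hy => h.parallel x hx y hy k) hx hy]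
  exact pdy_sum_sum_coord_mul (fun s m x => Γ s m k x)
    (fun s => (h.smooth.smooth_pdy h.isOpen s).differentiableAt_snd h.isOpen hx hy) i

/-- This is the `y`-Hessian of the invariance equation for `E`. The first two terms are those of a
metric connection; the third arises because `g_ij` depends on the direction. -/
lemma pdx_gCoeff (h : IsBerwaldConnection T L Γ) (hx : x ∈ T) (hy : y ≠ 0) (k i j : Fin n) :
    pdx k (gCoeff L i j) x y
      = ∑ s, (Γ s i k x * gCoeff L s j x y + Γ s j k x * gCoeff L i s x y
        + (∑ m, Γ s m k x * y m) * (2 * cartanCoeff L i j s x y)) := by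
  have hs := h.smooth
  have hT := h.isOpen
  have h0 : pdx k (gCoeff L i j) x y
      = (1 / 2) * pdx k (pdy i (pdy j (fun x y => L x y ^ 2))) x y :=
    pdx_const_mul _ (((hs.smooth_pdy hT j).smooth_pdy hT i).differentiableAt_fst hT hx hy) k
  have hd1 : ∀ s, DifferentiableAt ℝ
      (fun y' => pdy s (fun x y => L x y ^ 2) x y') y :=
    fun s => (hs.smooth_pdy hT s).differentiableAt_snd hT hx hy
  have hd2 : ∀ s, DifferentiableAt ℝ
      (fun y' => pdy j (pdy s (fun x y => L x y ^ 2)) x y') y :=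
    fun s => ((hs.smooth_pdy hT s).smooth_pdy hT j).differentiableAt_snd hT hx hy
  -- The `x`-derivative is moved inside the outer `y`-derivative, so that the equation already
  -- differentiated once can be substituted.
  rw [h0, (hs.smooth_pdy hT j).pdx_pdy hT hx hy,
    pdy_congr (fun x hx y hy => h.pdx_pdy hx hy k j) hx hy]
  have h1 : pdy i (fun x y => ∑ s, Γ s j k x * pdy s (fun x y => L x y ^ 2) x y
        + ∑ s, (∑ m, Γ s m k x * y m) * pdy j (pdy s (fun x y => L x y ^ 2)) x y) x y
      = pdy i (fun x y => ∑ s, Γ s j k x * pdy s (fun x y => L x y ^ 2) x y) x y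
        + pdy i (fun x y => ∑ s, ∑ m, Γ s m k x * y m
          * pdy j (pdy s (fun x y => L x y ^ 2)) x y) x y := by
    simp only [pdy, Finset.sum_mul]
    rw [fderiv_fun_add]
    · rfl
    · exact DifferentiableAt.fun_sum fun s _ => (hd1 s).const_mul _
    · refine DifferentiableAt.fun_sum fun s _ => DifferentiableAt.fun_sum fun m _ => ?_
      exact (DifferentiableAt.const_mul
        (EuclideanSpace.proj m : Coord n →L[ℝ] ℝ).differentiableAt _).mul (hd2 s)
  rw [h1, pdy_sum_mul (fun s x => Γ s j k x) hd1,
    pdy_sum_sum_coord_mul (fun s m x => Γ s m k x) hd2]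
  rw [← Finset.sum_add_distrib, ← Finset.sum_add_distrib, Finset.mul_sum]
  refine Finset.sum_congr rfl fun s _ => ?_
  rw [h.cartanCoeff_rotate hx hy, h.cartanCoeff_swap hx hy, h.cartanCoeff_eq hx hy,
    hs.pdy_pdy hT hx hy j s, gCoeff, gCoeff]
  ring

lemma sum_gInv (h : IsBerwaldConnection T L Γ) (hx : x ∈ T) (hy : y ≠ 0) (v : Fin n → ℝ)
    (i : Fin n) : ∑ s, gInv L i s x y * ∑ m, gCoeff L s m x y * v m = v i := by
  have h1 := congrFun (Matrix.mulVec_mulVec v (Matrix.of fun a b => gCoeff L a b x y)⁻¹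
    (Matrix.of fun a b => gCoeff L a b x y)) i
  rw [Matrix.nonsing_inv_mul _ (h.nondeg x hx y hy), Matrix.one_mulVec] at h1
  exact h1

/-- In the cyclic combination of derivatives the metric terms collapse to `Γ` by the symmetry of
`Γ`, as in the classical uniqueness proof for Levi-Civita; the Cartan terms remain. -/
lemma formalChristoffel_eq (h : IsBerwaldConnection T L Γ) (hx : x ∈ T) (hy : y ≠ 0)
    (i j k : Fin n) : formalChristoffel L i j k x y = Γ i j k x + ∑ s, gInv L i s x y *
      ∑ t, ((∑ m, Γ t m k x * y m) * cartanCoeff L s j t x y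
        - (∑ m, Γ t m s x * y m) * cartanCoeff L j k t x y
        + (∑ m, Γ t m j x * y m) * cartanCoeff L s k t x y) := by
  -- Writing `Γ` as `g⁻¹ g Γ` gives both sides the common factor `gInv L i s`.
  rw [formalChristoffel, ← h.sum_gInv hx hy (fun m => Γ m j k x) i, Finset.mul_sum,
    ← Finset.sum_add_distrib]
  refine Finset.sum_congr rfl fun s _ => ?_
  rw [h.pdx_gCoeff hx hy, h.pdx_gCoeff hx hy, h.pdx_gCoeff hx hy, ← mul_add,
    mul_left_comm]
  congr 1
  rw [← Finset.sum_add_distrib, ← Finset.sum_sub_distrib, ← Finset.sum_add_distrib, Finset.mul_sum]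
  refine Finset.sum_congr rfl fun t _ => ?_
  rw [h.gCoeff_symm hx hy t j, h.gCoeff_symm hx hy t k, h.gCoeff_symm hx hy t s,
    h.cartanCoeff_swap hx hy k s, h.symm x hx t k j, h.symm x hx t s j, h.symm x hx t s k]
  ring

/-- Two of the three Cartan terms carry the index contracted with `y` on `C` itself, and vanish. -/
lemma sum_sum_cartanCoeff_mul (h : IsBerwaldConnection T L Γ) (hx : x ∈ T) (hy : y ≠ 0)
    (s j : Fin n) (N : Fin n → Fin n → ℝ) :
    ∑ k, (∑ t, (N t k * cartanCoeff L s j t x y - N t s * cartanCoeff L j k t x y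
      + N t j * cartanCoeff L s k t x y)) * y k
      = ∑ t, cartanCoeff L s j t x y * ∑ k, N t k * y k := by
  have hz : ∀ i t, ∑ k, cartanCoeff L i k t x y * y k = 0 := by
    intro i t
    rw [← h.sum_cartanCoeff hx hy t i]
    refine Finset.sum_congr rfl fun k _ => ?_
    rw [h.cartanCoeff_swap hx hy, h.cartanCoeff_rotate hx hy]
  simp only [Finset.sum_mul]
  rw [Finset.sum_comm]
  refine Finset.sum_congr rfl fun t _ => ?_
  have : ∀ k, (N t k * cartanCoeff L s j t x y - N t s * cartanCoeff L j k t x y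
      + N t j * cartanCoeff L s k t x y) * y k
      = cartanCoeff L s j t x y * (N t k * y k) - N t s * (cartanCoeff L j k t x y * y k)
        + N t j * (cartanCoeff L s k t x y * y k) := fun k => by ring
  simp only [this, Finset.sum_add_distrib, Finset.sum_sub_distrib, ← Finset.mul_sum, hz]
  ring

lemma sum_formalChristoffel (h : IsBerwaldConnection T L Γ) (hx : x ∈ T) (hy : y ≠ 0)
    (i j : Fin n) : ∑ k, formalChristoffel L i j k x y * y k
      = ∑ m, Γ i m j x * y m + ∑ s, gInv L i s x y * ∑ t, cartanCoeff L s j t x y *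
        ∑ k, (∑ m, Γ t m k x * y m) * y k := by
  simp only [h.formalChristoffel_eq hx hy, add_mul, Finset.sum_add_distrib]
  congr 1
  · exact Finset.sum_congr rfl fun k _ => by rw [h.symm x hx]
  · rw [Finset.sum_congr rfl fun k _ => Finset.sum_mul _ _ _, Finset.sum_comm]
    refine Finset.sum_congr rfl fun s _ => ?_
    rw [← h.sum_sum_cartanCoeff_mul hx hy s j (fun t k => ∑ m, Γ t m k x * y m), Finset.mul_sum]
    exact Finset.sum_congr rfl fun k _ => by
      rw [mul_assoc]
      simp only [Finset.sum_add_distrib, Finset.sum_sub_distrib]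

/-- The second contraction with `y` kills the last Cartan term: `L` and `Γ` have the same spray. -/
lemma sum_sum_formalChristoffel (h : IsBerwaldConnection T L Γ) (hx : x ∈ T) (hy : y ≠ 0)
    (k : Fin n) : ∑ r, ∑ s, formalChristoffel L k r s x y * y r * y s
      = ∑ r, (∑ m, Γ k m r x * y m) * y r := by
  have h1 : ∀ r, ∑ s, formalChristoffel L k r s x y * y r * y s
      = (∑ m, Γ k m r x * y m) * y r + ∑ s, gInv L k s x y * (∑ t, (cartanCoeff L s t r x y * y r) *
        ∑ k, (∑ m, Γ t m k x * y m) * y k) := by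
    intro r
    have : ∀ s, formalChristoffel L k r s x y * y r * y s
        = formalChristoffel L k r s x y * y s * y r := fun s => by ring
    rw [Finset.sum_congr rfl fun s _ => this s, ← Finset.sum_mul, h.sum_formalChristoffel hx hy,
      add_mul]
    congr 1
    rw [Finset.sum_mul]
    refine Finset.sum_congr rfl fun s _ => ?_
    rw [mul_assoc, Finset.sum_mul]
    congr 1
    refine Finset.sum_congr rfl fun t _ => ?_
    rw [h.cartanCoeff_rotate hx hy s r t, h.cartanCoeff_swap hx hy t r,
      h.cartanCoeff_rotate hx hy r t]
    ring
  rw [Finset.sum_congr rfl fun r _ => h1 r, Finset.sum_add_distrib, add_eq_left, Finset.sum_comm]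
  refine Finset.sum_eq_zero fun s _ => ?_
  rw [← Finset.mul_sum, Finset.sum_comm]
  simp only [← Finset.sum_mul, h.sum_cartanCoeff hx hy, zero_mul, Finset.sum_const_zero, mul_zero]

/-- The Cartan term left in `sum_formalChristoffel` is exactly the correction subtracted in the
definition of the nonlinear connection. -/
lemma nonlinearConnection_eq (h : IsBerwaldConnection T L Γ) (hx : x ∈ T) (hy : y ≠ 0)
    (i j : Fin n) : nonlinearConnection L i j x y = ∑ m, Γ i m j x * y m := by
  rw [nonlinearConnection, h.sum_formalChristoffel hx hy]
  simp only [h.sum_sum_formalChristoffel hx hy]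
  have aux : ∀ v : Fin n → ℝ, ∑ s, gInv L i s x y * ∑ t, cartanCoeff L s j t x y * v t
      = ∑ k, (∑ m, gInv L i m x y * cartanCoeff L m j k x y) * v k := by
    intro v
    simp only [Finset.sum_mul, Finset.mul_sum, mul_assoc]
    exact Finset.sum_comm
  rw [sub_eq_iff_eq_add, add_right_inj]
  exact aux _

/-- Since `∂g_ij/∂yˢ = 2 C_ijs`, the vertical part of the horizontal derivative cancels the
direction-dependent term of `pdx_gCoeff`. -/
lemma hDeriv_gCoeff (h : IsBerwaldConnection T L Γ) (hx : x ∈ T) (hy : y ≠ 0) (k i j : Fin n) :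
    hDeriv L k (gCoeff L i j) x y
      = ∑ s, (Γ s i k x * gCoeff L s j x y + Γ s j k x * gCoeff L i s x y) := by
  rw [hDeriv, h.pdx_gCoeff hx hy, ← Finset.sum_sub_distrib]
  refine Finset.sum_congr rfl fun s _ => ?_
  rw [h.nonlinearConnection_eq hx hy, cartanCoeff]
  ring

/-- The Chern connection is the linear connection that preserves the energy. -/
theorem chernCoeff_eq (h : IsBerwaldConnection T L Γ) (hx : x ∈ T) (hy : y ≠ 0)
    (i j k : Fin n) : chernCoeff L i j k x y = Γ i j k x := by
  rw [chernCoeff, ← h.sum_gInv hx hy (fun m => Γ m j k x) i, Finset.mul_sum]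
  refine Finset.sum_congr rfl fun s _ => ?_
  rw [h.hDeriv_gCoeff hx hy, h.hDeriv_gCoeff hx hy, h.hDeriv_gCoeff hx hy, mul_left_comm]
  congr 1
  rw [← Finset.sum_sub_distrib, ← Finset.sum_add_distrib, Finset.mul_sum]
  refine Finset.sum_congr rfl fun t _ => ?_
  rw [h.gCoeff_symm hx hy t j, h.gCoeff_symm hx hy t k, h.gCoeff_symm hx hy t s,
    h.symm x hx t k j, h.symm x hx t s j, h.symm x hx t s k]
  ring

lemma hDeriv_chernCoeff (h : IsBerwaldConnection T L Γ) (hx : x ∈ T) (hy : y ≠ 0)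
    (i j k l : Fin n) : hDeriv L l (chernCoeff L i j k) x y = pd l (Γ i j k) x := by
  rw [hDeriv, pdx_congr h.isOpen (fun x hx y hy => h.chernCoeff_eq hx hy i j k) hx hy]
  have : ∀ s, pdy s (chernCoeff L i j k) x y = 0 := by
    intro s
    rw [pdy_congr (fun x hx y hy => h.chernCoeff_eq hx hy i j k) hx hy, pdy, fderiv_const_apply]
    rfl
  simp only [this, mul_zero, Finset.sum_const_zero, sub_zero]
  rfl

theorem chernCurvatureCoeff_eq (h : IsBerwaldConnection T L Γ) (hx : x ∈ T) (hy : y ≠ 0)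
    (i j k l : Fin n) : chernCurvatureCoeff L j i k l x y
      = pd k (Γ i j l) x - pd l (Γ i j k) x
        + ∑ m, (Γ i m k x * Γ m j l x - Γ i m l x * Γ m j k x) := by
  rw [chernCurvatureCoeff, h.hDeriv_chernCoeff hx hy, h.hDeriv_chernCoeff hx hy]
  simp only [h.chernCoeff_eq hx hy]

end IsBerwaldConnection

end ChernConnection

/-! ### Linear algebra of a Randers norm on one vector space. -/

section RandersNorm

variable {V : Type*} [AddCommGroup V] [Module ℝ V] [TopologicalSpace V]

/-- The bilinear form `(F/α) (a(U,V) - a(ℓ,U) a(ℓ,V)) + (a(ℓ,U) + b(U)) (a(ℓ,V) + b(V))`, where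
`α = √a(y,y)`, `F = α + b(y)` and `ℓ = y/α`. -/
def randersTensor (a : V →L[ℝ] V →L[ℝ] ℝ) (b : V →L[ℝ] ℝ) (y : V) : V →ₗ[ℝ] V →ₗ[ℝ] ℝ :=
  LinearMap.mk₂ ℝ (fun u v => (√(a y y) + b y) / √(a y y) * (a u v - a y u * a y v / a y y)
    + (a y u / √(a y y) + b u) * (a y v / √(a y y) + b v))
    (fun u u' v => by simp; ring) (fun c u v => by simp; ring)
    (fun u v v' => by simp; ring) (fun c u v => by simp; ring)

variable {a : V →L[ℝ] V →L[ℝ] ℝ} {b : V →L[ℝ] ℝ} {y : V}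

lemma randersTensor_apply (u v : V) : randersTensor a b y u v
    = (√(a y y) + b y) / √(a y y) * (a u v - a y u * a y v / a y y)
      + (a y u / √(a y y) + b u) * (a y v / √(a y y) + b v) := rfl

lemma quadratic_add_smul (ha : ∀ u v, a u v = a v u) (u v : V) (t : ℝ) :
    a (u + t • v) (u + t • v) = a u u + 2 * t * a u v + t ^ 2 * a v v := by
  simp [ha v u]; ring

lemma hasDerivAt_sqrt_quadratic (ha : ∀ u v, a u v = a v u) (u v : V) (hu : 0 < a u u) :
    HasDerivAt (fun t : ℝ => √(a (u + t • v) (u + t • v))) (a u v / √(a u u)) 0 := by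
  simp only [quadratic_add_smul ha]
  have h1 : HasDerivAt (fun t : ℝ => a u u + 2 * t * a u v + t ^ 2 * a v v) (2 * a u v) 0 := by
    have := ((((hasDerivAt_id (0 : ℝ)).const_mul 2).mul_const (a u v)).const_add (a u u)).add
      (((hasDerivAt_id (0 : ℝ)).pow 2).mul_const (a v v))
    refine this.congr_deriv ?_
    simp
  refine (h1.sqrt (by simpa using hu.ne')).congr_deriv ?_
  simp
  field_simp

lemma hasDerivAt_linear (b : V →L[ℝ] ℝ) (u v : V) (s : ℝ) :
    HasDerivAt (fun t : ℝ => b (u + t • v)) (b v) s := by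
  simp only [map_add, map_smul, smul_eq_mul]
  simpa using ((hasDerivAt_id s).mul_const (b v)).const_add (b u)

lemma hasDerivAt_randers_sq (ha : ∀ u v, a u v = a v u) (u v : V) (hu : 0 < a u u) :
    HasDerivAt (fun t : ℝ => (√(a (u + t • v) (u + t • v)) + b (u + t • v)) ^ 2)
      (2 * (√(a u u) + b u) * (a u v / √(a u u) + b v)) 0 := by
  refine (((hasDerivAt_sqrt_quadratic ha u v hu).add (hasDerivAt_linear b u v 0)).pow 2).congr_deriv
    ?_
  simp

/-- The inner derivative is `2F(a(·,v)/α + b(v))` at `y + su`. This holds for small `s`, as long as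
`a` stays positive there, and the product rule then gives the Hessian. -/
lemma deriv_deriv_randers_sq (ha : ∀ u v, a u v = a v u) (u v : V) (hy : 0 < a y y) :
    (1 / 2) * deriv (fun s : ℝ => deriv (fun t : ℝ =>
      (√(a (y + s • u + t • v) (y + s • u + t • v)) + b (y + s • u + t • v)) ^ 2) 0) 0
      = randersTensor a b y u v := by
  have hc : Continuous fun s : ℝ => a (y + s • u) (y + s • u) := by
    simp only [quadratic_add_smul ha]; fun_prop
  have hev : ∀ᶠ s : ℝ in nhds 0, 0 < a (y + s • u) (y + s • u) :=
    hc.continuousAt.eventually (lt_mem_nhds (by simpa using hy))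
  have h1 : (fun s : ℝ => deriv (fun t : ℝ =>
      (√(a (y + s • u + t • v) (y + s • u + t • v)) + b (y + s • u + t • v)) ^ 2) 0)
      =ᶠ[nhds 0] fun s => 2 * (√(a (y + s • u) (y + s • u)) + b (y + s • u)) *
        (a (y + s • u) v / √(a (y + s • u) (y + s • u)) + b v) := by
    filter_upwards [hev] with s hs using (hasDerivAt_randers_sq ha _ v hs).deriv
  rw [h1.deriv_eq]
  have hs := hasDerivAt_sqrt_quadratic ha y u hy
  have h2 := hs.add (hasDerivAt_linear b y u 0)
  have h3 : HasDerivAt (fun s : ℝ => a (y + s • u) v) (a u v) 0 := by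
    simpa [ha _ v] using hasDerivAt_linear (a v) y u 0
  have h4 := (h3.div hs (by simpa using (Real.sqrt_pos.2 hy).ne')).add_const (b v)
  have h5 := (h2.const_mul 2).mul h4
  have h6 := h5.deriv
  simp only [Pi.add_apply, zero_smul, add_zero] at h6
  refine (congrArg _ h6).trans ?_
  rw [randersTensor_apply]
  have hα := Real.sqrt_pos.2 hy
  have hsq : a y y = √(a y y) ^ 2 := (Real.sq_sqrt hy.le).symm
  simp only [Pi.div_apply, zero_smul, add_zero]
  generalize √(a y y) = α at hα hsq ⊢
  rw [hsq]
  field_simp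
  ring

/-- Cauchy–Schwarz with its equality case: the Gram determinant is `a(u,u) a(w,w)`, with `w` the
component of `v` orthogonal to `u`. -/
lemma gram_nonneg_of_posDef (ha : ∀ u v, a u v = a v u) (hpos : ∀ u, u ≠ 0 → 0 < a u u) (u v : V)
    (hu : u ≠ 0) : 0 ≤ a u u * a v v - a u v ^ 2 ∧
      (a u u * a v v - a u v ^ 2 = 0 → v = (a u v / a u u) • u) := by
  have hu' := hpos u hu
  set w := v - (a u v / a u u) • u with hw
  have h1 : a u u * a w w = a u u * a v v - a u v ^ 2 := by
    simp [hw, ha v u]; field_simp; ring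
  rw [← h1]
  rcases eq_or_ne w 0 with h0 | h0
  · simp only [h0, map_zero, mul_zero, le_refl, true_and, forall_const]
    exact sub_eq_zero.1 h0
  · have := mul_pos hu' (hpos w h0)
    exact ⟨this.le, fun h => absurd h this.ne'⟩

/-- The form is a positive multiple of a Gram determinant plus a square. If the determinant vanishes
then `u = c y`, and the square is `(cF)² > 0`. -/
lemma randersTensor_pos (ha : ∀ u v, a u v = a v u) (hpos : ∀ u, u ≠ 0 → 0 < a u u)
    (hy : y ≠ 0) (hF : 0 < √(a y y) + b y) {u : V} (hu : u ≠ 0) :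
    0 < randersTensor a b y u u := by
  have hyy := hpos y hy
  have hα := Real.sqrt_pos.2 hyy
  obtain ⟨h1, h2⟩ := gram_nonneg_of_posDef ha hpos y u hy
  have h3 : a u u - a y u * a y u / a y y = (a y y * a u u - a y u ^ 2) / a y y := by
    field_simp
  rw [randersTensor_apply, h3]
  rcases h1.lt_or_eq with h | h
  · exact add_pos_of_pos_of_nonneg (mul_pos (div_pos hF hα) (div_pos h hyy)) (mul_self_nonneg _)
  · rw [← h]
    have hu' := h2 h.symm
    set c := a y u / a y y
    have hc : c ≠ 0 := by
      rintro h0; rw [h0, zero_smul] at hu'; exact hu hu'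
    have h4 : a y u / √(a y y) + b u = c * (√(a y y) + b y) := by
      rw [hu']
      simp only [map_smul, smul_eq_mul]
      rw [mul_div_assoc, Real.div_sqrt]; ring
    rw [h4]
    have : 0 < (c * (√(a y y) + b y)) ^ 2 := by positivity
    simp only [zero_div, mul_zero, zero_add]
    nlinarith

lemma abs_lt_sqrt_of_posDef (ha : ∀ u v, a u v = a v u) (hpos : ∀ u, u ≠ 0 → 0 < a u u)
    {q : V} (hq : a q q < 1) (hy : y ≠ 0) : |a q y| < √(a y y) := by
  have hyy := hpos y hy
  apply Real.lt_sqrt_of_sq_lt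
  rw [sq_abs]
  have := (gram_nonneg_of_posDef ha hpos y q hy).1
  rw [ha y q] at this
  nlinarith

lemma randers_pos (ha : ∀ u v, a u v = a v u) (hpos : ∀ u, u ≠ 0 → 0 < a u u)
    {q : V} (hq : a q q < 1) (hy : y ≠ 0) : 0 < √(a y y) + a q y := by
  have := (abs_lt.1 (abs_lt_sqrt_of_posDef ha hpos hq hy)).1
  linarith

/-- The quotient defining the flag curvature, for a vector `w` in the kernels of `a y` and `b`. -/
lemma randersTensor_flag (hyy : 0 < a y y)
    (hF : 0 < √(a y y) + b y) {u w : V} (hw : a y w = 0) (hbw : b w = 0) :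
    randersTensor a b y w u / (randersTensor a b y y y * randersTensor a b y u u
      - randersTensor a b y y u ^ 2)
      = a w u / ((a y y * a u u - a y u ^ 2) * (1 + b y / √(a y y)) ^ 2) := by
  have hα := Real.sqrt_pos.2 hyy
  have hsq : a y y = √(a y y) ^ 2 := (Real.sq_sqrt hyy.le).symm
  -- With `F = α + b(y)`, the denominator scales by `(F/α)³` and the numerator by `F/α`.
  have hd : randersTensor a b y y y * randersTensor a b y u u - randersTensor a b y y u ^ 2
      = (√(a y y) + b y) ^ 3 / √(a y y) ^ 3 * (a y y * a u u - a y u ^ 2) := by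
    simp only [randersTensor_apply]
    generalize √(a y y) = α at *
    rw [hsq]
    field_simp
    ring
  have hn : randersTensor a b y w u = (√(a y y) + b y) / √(a y y) * a w u := by
    simp only [randersTensor_apply, hw, hbw]
    ring
  rw [hd, hn]
  generalize a y y * a u u - a y u ^ 2 = G
  generalize √(a y y) = α at *
  have : 1 + b y / α = (α + b y) / α := by field_simp
  rw [this, mul_comm G, ← div_div, ← div_div]
  congr 1
  field_simp

end RandersNorm

/-! ### The Levi-Civita connection of a metric on an open set of coordinate space. -/

section Koszul

variable {n : ℕ}

lemma coord_eq_sum (v : Coord n) : v = ∑ i, v i • EuclideanSpace.single i (1 : ℝ) := by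
  ext j
  simp [Finset.sum_apply, Pi.single_apply]

lemma contDiffOn_matrix_det {E : Type*} [NormedAddCommGroup E] [NormedSpace ℝ E] {T : Set E}
    {M : E → Matrix (Fin n) (Fin n) ℝ} (h : ∀ i j, ContDiffOn ℝ ∞ (fun x => M x i j) T) :
    ContDiffOn ℝ ∞ (fun x => (M x).det) T := by
  simp only [Matrix.det_apply]
  refine ContDiffOn.sum fun σ _ => ContDiffOn.const_smul _ ?_
  exact contDiffOn_prod fun i _ => h _ _

/-- Cramer's rule: the entries of the inverse are quotients of determinants in the entries of the
matrix. -/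
lemma contDiffOn_matrix_inv {E : Type*} [NormedAddCommGroup E] [NormedSpace ℝ E] {T : Set E}
    {M : E → Matrix (Fin n) (Fin n) ℝ} (h : ∀ i j, ContDiffOn ℝ ∞ (fun x => M x i j) T)
    (hdet : ∀ x ∈ T, (M x).det ≠ 0) (i j : Fin n) :
    ContDiffOn ℝ ∞ (fun x => (M x)⁻¹ i j) T := by
  simp only [Matrix.inv_def, Ring.inverse_eq_inv', Matrix.smul_apply, smul_eq_mul,
    Matrix.adjugate_apply]
  refine ((contDiffOn_matrix_det h).inv hdet).mul (contDiffOn_matrix_det fun k l => ?_)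
  by_cases hk : k = j
  · subst hk; simpa using contDiffOn_const
  · simpa [Matrix.updateRow_ne hk] using h k l

/-- The Gram matrix of a family of bilinear forms. -/
def gramMatrix (A : Coord n → Coord n →L[ℝ] Coord n →L[ℝ] ℝ) (x : Coord n) :
    Matrix (Fin n) (Fin n) ℝ :=
  Matrix.of fun i j => A x (EuclideanSpace.single i 1) (EuclideanSpace.single j 1)

/-- The right-hand side of the Koszul formula. -/
def koszul (A : Coord n → Coord n →L[ℝ] Coord n →L[ℝ] ℝ) (x u v w : Coord n) : ℝ :=
  (1 / 2) * (fderiv ℝ A x u w v - fderiv ℝ A x w v u + fderiv ℝ A x v u w)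

/-- The Christoffel symbols of `A` as a bilinear map. -/
def christoffelMap (A : Coord n → Coord n →L[ℝ] Coord n →L[ℝ] ℝ) (x : Coord n) :
    Coord n →L[ℝ] Coord n →L[ℝ] Coord n :=
  LinearMap.toContinuousLinearMap (LinearMap.toContinuousLinearMap.toLinearMap ∘ₗ
    LinearMap.mk₂ ℝ (fun u v => WithLp.toLp 2 fun i =>
      ∑ s, (gramMatrix A x)⁻¹ i s * koszul A x u v (EuclideanSpace.single s 1))
    (fun u u' v => by
      ext i; simp only [koszul, map_add, add_apply, PiLp.add_apply, ← Finset.sum_add_distrib]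
      exact Finset.sum_congr rfl fun s _ => by ring)
    (fun c u v => by
      ext i; simp only [koszul, map_smul, smul_apply, PiLp.smul_apply, smul_eq_mul, Finset.mul_sum]
      exact Finset.sum_congr rfl fun s _ => by ring)
    (fun u v v' => by
      ext i; simp only [koszul, map_add, add_apply, PiLp.add_apply, ← Finset.sum_add_distrib]
      exact Finset.sum_congr rfl fun s _ => by ring)
    (fun c u v => by
      ext i; simp only [koszul, map_smul, smul_apply, PiLp.smul_apply, smul_eq_mul, Finset.mul_sum]
      exact Finset.sum_congr rfl fun s _ => by ring))

lemma christoffelMap_apply (A : Coord n → Coord n →L[ℝ] Coord n →L[ℝ] ℝ) (x u v : Coord n)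
    (i : Fin n) : christoffelMap A x u v i
      = ∑ s, (gramMatrix A x)⁻¹ i s * koszul A x u v (EuclideanSpace.single s 1) := rfl

/-- A smooth family of inner products on an open set. -/
structure IsRiemannianFamily (T : Set (Coord n)) (A : Coord n → Coord n →L[ℝ] Coord n →L[ℝ] ℝ) :
    Prop where
  isOpen : IsOpen T
  smooth : ContDiffOn ℝ ∞ A T
  symm : ∀ x ∈ T, ∀ u v, A x u v = A x v u
  pos : ∀ x ∈ T, ∀ u, u ≠ 0 → 0 < A x u u

namespace IsRiemannianFamily

variable {T : Set (Coord n)} {A : Coord n → Coord n →L[ℝ] Coord n →L[ℝ] ℝ} {x : Coord n}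

lemma differentiableAt (h : IsRiemannianFamily T A) (hx : x ∈ T) : DifferentiableAt ℝ A x :=
  (h.smooth.contDiffAt (h.isOpen.mem_nhds hx)).differentiableAt (by simp)

lemma fderiv_apply (h : IsRiemannianFamily T A) (hx : x ∈ T) (u v w : Coord n) :
    fderiv ℝ (fun x => A x v w) x u = fderiv ℝ A x u v w := by
  have h1 : HasFDerivAt (fun x => A x v w) _ x :=
    ((h.differentiableAt hx).hasFDerivAt.clm_apply (hasFDerivAt_const v x)).clm_apply
      (hasFDerivAt_const w x)
  rw [h1.fderiv]; simp

lemma fderiv_symm (h : IsRiemannianFamily T A) (hx : x ∈ T) (u v w : Coord n) :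
    fderiv ℝ A x u v w = fderiv ℝ A x u w v := by
  rw [← h.fderiv_apply hx, ← h.fderiv_apply hx, Filter.EventuallyEq.fderiv_eq]
  filter_upwards [h.isOpen.mem_nhds hx] with x' hx' using h.symm x' hx' v w

lemma gramMatrix_mulVec (A : Coord n → Coord n →L[ℝ] Coord n →L[ℝ] ℝ) (x v : Coord n) (i : Fin n) :
    (gramMatrix A x).mulVec v i = A x (EuclideanSpace.single i 1) v := by
  conv_rhs => rw [coord_eq_sum v]
  simp [Matrix.mulVec, dotProduct, gramMatrix, mul_comm]

lemma det_ne_zero (h : IsRiemannianFamily T A) (hx : x ∈ T) : (gramMatrix A x).det ≠ 0 := by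
  intro h0
  obtain ⟨v, hv, hv0⟩ := Matrix.exists_mulVec_eq_zero_iff.2 h0
  have h1 : ∀ i, A x (EuclideanSpace.single i 1) (WithLp.toLp 2 v) = 0 := fun i => by
    rw [← gramMatrix_mulVec]; exact congrFun hv0 i
  have h2 : A x (WithLp.toLp 2 v) (WithLp.toLp 2 v) = 0 := by
    conv_lhs => rw [h.symm x hx]; rw [coord_eq_sum (WithLp.toLp 2 v)]
    rw [map_sum]
    conv_lhs => rw [← coord_eq_sum (WithLp.toLp 2 v)]
    refine Finset.sum_eq_zero fun i _ => ?_
    rw [map_smul, h.symm x hx, h1, smul_zero]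
  exact (h.pos x hx _ (by simpa using hv)).ne' h2

/-- On basis vectors the Gram matrix cancels its inverse in the definition; the general case follows
by linearity in `w`. -/
lemma inner_christoffelMap (h : IsRiemannianFamily T A) (hx : x ∈ T) (u v w : Coord n) :
    A x (christoffelMap A x u v) w = koszul A x u v w := by
  have h1 : ∀ s, A x (christoffelMap A x u v) (EuclideanSpace.single s 1)
      = koszul A x u v (EuclideanSpace.single s 1) := by
    intro s
    rw [h.symm x hx, ← gramMatrix_mulVec]
    have h2 : (christoffelMap A x u v).ofLp = (gramMatrix A x)⁻¹.mulVec
      fun s => koszul A x u v (EuclideanSpace.single s 1) := rfl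
    rw [h2, Matrix.mulVec_mulVec, Matrix.mul_nonsing_inv _ (h.det_ne_zero hx).isUnit,
      Matrix.one_mulVec]
  have h3 : koszul A x u v w = ∑ s, w s * koszul A x u v (EuclideanSpace.single s 1) := by
    conv_lhs => rw [coord_eq_sum w]
    simp only [koszul, map_sum, map_smul, sum_apply, smul_apply, smul_eq_mul,
      ← Finset.sum_sub_distrib, ← Finset.sum_add_distrib, Finset.mul_sum]
    exact Finset.sum_congr rfl fun s _ => by ring
  rw [h3]
  conv_lhs => rw [coord_eq_sum w]
  simp [h1]

lemma christoffelMap_symm (h : IsRiemannianFamily T A) (hx : x ∈ T) (u v : Coord n) :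
    christoffelMap A x u v = christoffelMap A x v u := by
  ext i
  rw [christoffelMap_apply, christoffelMap_apply]
  refine Finset.sum_congr rfl fun s _ => ?_
  simp only [koszul]
  rw [h.fderiv_symm hx u, h.fderiv_symm hx v, h.fderiv_symm hx _ v u]
  ring

/-- Metric compatibility: in the sum of the two Koszul expressions all other derivatives cancel. -/
lemma fderiv_eq (h : IsRiemannianFamily T A) (hx : x ∈ T) (u v w : Coord n) :
    fderiv ℝ A x u v w
      = A x (christoffelMap A x u v) w + A x v (christoffelMap A x u w) := by
  rw [h.symm x hx v, h.inner_christoffelMap hx, h.inner_christoffelMap hx, koszul, koszul,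
    h.fderiv_symm hx w, h.fderiv_symm hx u w v, h.fderiv_symm hx v w u]
  ring

lemma contDiffOn_koszul (h : IsRiemannianFamily T A) (u v w : Coord n) :
    ContDiffOn ℝ ∞ (fun x => koszul A x u v w) T := by
  have h2 : ∀ u v w, ContDiffOn ℝ ∞ (fun x => fderiv ℝ A x u v w) T := fun u v w =>
    ((((h.smooth.clm_apply contDiffOn_const).clm_apply contDiffOn_const).fderiv_of_isOpen h.isOpen
      (by simp)).clm_apply contDiffOn_const).congr fun x hx => (h.fderiv_apply hx u v w).symm
  exact contDiffOn_const.mul (((h2 _ _ _).sub (h2 _ _ _)).add (h2 _ _ _))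

lemma contDiffOn_gramMatrix (h : IsRiemannianFamily T A) (i j : Fin n) :
    ContDiffOn ℝ ∞ (fun x => gramMatrix A x i j) T :=
  (h.smooth.clm_apply contDiffOn_const).clm_apply contDiffOn_const

lemma contDiffOn_christoffelMap (h : IsRiemannianFamily T A) :
    ContDiffOn ℝ ∞ (christoffelMap A) T := by
  rw [contDiffOn_clm_apply]
  intro u
  rw [contDiffOn_clm_apply]
  intro v
  rw [contDiffOn_euclidean]
  intro i
  simp only [christoffelMap_apply]
  exact ContDiffOn.sum fun s _ => (contDiffOn_matrix_inv h.contDiffOn_gramMatrix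
    (fun x hx => h.det_ne_zero hx) i s).mul (h.contDiffOn_koszul _ _ _)

end IsRiemannianFamily

end Koszul

/-! ### Connection and curvature in an orthonormal frame with constant structure functions. -/

section Frame

variable {n : ℕ} {ι : Type*} [Fintype ι] [DecidableEq ι]

/-- The coefficients `⟨∇_a e_b, e_d⟩` of the Levi-Civita connection in an orthonormal frame with
structure constants `c`. -/
def connCoeff (c : ι → ι → ι → ℝ) (a b d : ι) : ℝ :=
  (1 / 2) * (c a b d - c b d a + c d a b)

/-- The coefficients `⟨R(e_a, e_b) e_c, e_f⟩` in an orthonormal frame with constant structure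
functions `k`. -/
def frameCurvature (k : ι → ι → ι → ℝ) (a b c f : ι) : ℝ :=
  ∑ e, (connCoeff k b c e * connCoeff k a e f - connCoeff k a c e * connCoeff k b e f
    - k a b e * connCoeff k e c f)

/-- The curvature `R(u, v) z` of the connection with Christoffel symbols `Γ`. -/
def curvatureMap (Γ : Coord n → Coord n →L[ℝ] Coord n →L[ℝ] Coord n) (x u v z : Coord n) :
    Coord n :=
  fderiv ℝ Γ x u v z - fderiv ℝ Γ x v u z + Γ x u (Γ x v z) - Γ x v (Γ x u z)

lemma fderiv_bilinear_apply {Γ : Coord n → Coord n →L[ℝ] Coord n →L[ℝ] Coord n} {x : Coord n}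
    (hΓ : DifferentiableAt ℝ Γ x) (u v w : Coord n) :
    fderiv ℝ (fun x => Γ x v w) x u = fderiv ℝ Γ x u v w := by
  have h1 : HasFDerivAt (fun x => Γ x v w) _ x :=
    (hΓ.hasFDerivAt.clm_apply (hasFDerivAt_const v x)).clm_apply (hasFDerivAt_const w x)
  rw [h1.fderiv]; simp

/-- The components of the curvature in terms of those of the Christoffel symbols. -/
lemma curvatureMap_apply {Γ : Coord n → Coord n →L[ℝ] Coord n →L[ℝ] Coord n} {x : Coord n}
    (hΓ : DifferentiableAt ℝ Γ x) (u v z : Coord n) (i : Fin n)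
    {G : Fin n → Fin n → Fin n → Coord n → ℝ}
    (hG : ∀ i j k x, G i j k x
      = Γ x (EuclideanSpace.single k 1) (EuclideanSpace.single j 1) i) :
    curvatureMap Γ x u v z i = ∑ j, ∑ k, ∑ l, (pd k (G i j l) x - pd l (G i j k) x
        + ∑ m, (G i m k x * G m j l x - G i m l x * G m j k x)) * z j * u k * v l := by
  have hpd : ∀ i j k l, pd k (G i j l) x = fderiv ℝ Γ x (EuclideanSpace.single k 1)
      (EuclideanSpace.single l 1) (EuclideanSpace.single j 1) i := by
    intro i j k l
    have h1 : G i j l = fun x => (EuclideanSpace.proj i : Coord n →L[ℝ] ℝ)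
        (Γ x (EuclideanSpace.single l 1) (EuclideanSpace.single j 1)) := by
      funext x; exact hG i j l x
    have hd : DifferentiableAt ℝ
        (fun x => Γ x (EuclideanSpace.single l 1) (EuclideanSpace.single j 1)) x :=
      (hΓ.clm_apply (differentiableAt_const _)).clm_apply (differentiableAt_const _)
    have h2 : HasFDerivAt (fun x => (EuclideanSpace.proj i : Coord n →L[ℝ] ℝ)
        (Γ x (EuclideanSpace.single l 1) (EuclideanSpace.single j 1))) _ x :=
      ((EuclideanSpace.proj i : Coord n →L[ℝ] ℝ).hasFDerivAt).comp x hd.hasFDerivAt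
    rw [h1, pd, ← fderiv_bilinear_apply hΓ, h2.fderiv]
    rfl
  have hmul : ∀ i j k l, ∑ m, G i m k x * G m j l x
      = Γ x (EuclideanSpace.single k 1)
        (Γ x (EuclideanSpace.single l 1) (EuclideanSpace.single j 1)) i := by
    intro i j k l
    rw [coord_eq_sum (Γ x (EuclideanSpace.single l 1) (EuclideanSpace.single j 1)), map_sum]
    simp only [WithLp.ofLp_sum, Finset.sum_apply, map_smul, PiLp.smul_apply, smul_eq_mul, hG]
    exact Finset.sum_congr rfl fun m _ => mul_comm _ _
  simp only [Finset.sum_sub_distrib, hpd, hmul]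
  -- Expansion of a trilinear form in the standard basis, with the sums in the order `z`, `u`, `v`
  -- of the curvature coefficients.
  have hlin : ∀ B : Coord n → Coord n → Coord n → ℝ,
      (∀ u u' v z, B (u + u') v z = B u v z + B u' v z) →
      (∀ (r : ℝ) u v z, B (r • u) v z = r * B u v z) →
      (∀ u v v' z, B u (v + v') z = B u v z + B u v' z) →
      (∀ (r : ℝ) u v z, B u (r • v) z = r * B u v z) →
      (∀ u v z z', B u v (z + z') = B u v z + B u v z') →
      (∀ (r : ℝ) u v z, B u v (r • z) = r * B u v z) →
      B u v z = ∑ j, ∑ k, ∑ l, B (EuclideanSpace.single k 1) (EuclideanSpace.single l 1)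
        (EuclideanSpace.single j 1) * z j * u k * v l := by
    intro B h1 h2 h3 h4 h5 h6
    have e1 : ∀ w : Coord n → ℝ, (∀ u u', w (u + u') = w u + w u') →
        (∀ (r : ℝ) u, w (r • u) = r * w u) → ∀ u : Coord n,
        w u = ∑ k, w (EuclideanSpace.single k 1) * u k := by
      intro w ha hs u
      let w' : Coord n →ₗ[ℝ] ℝ := ⟨⟨w, ha⟩, hs⟩
      have : w' u = ∑ k, w' (EuclideanSpace.single k 1) * u k := by
        conv_lhs => rw [coord_eq_sum u]
        simp [mul_comm]
      exact this
    rw [e1 (fun z => B u v z) (h5 u v) (fun r => h6 r u v) z]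
    refine Finset.sum_congr rfl fun j _ => ?_
    rw [e1 (fun u => B u v _) (fun u u' => h1 u u' v _) (fun r u => h2 r u v _) u, Finset.sum_mul]
    refine Finset.sum_congr rfl fun k _ => ?_
    rw [e1 (fun v => B _ v _) (fun v v' => h3 _ v v' _) (fun r v => h4 r _ v _) v, Finset.sum_mul,
      Finset.sum_mul]
    exact Finset.sum_congr rfl fun l _ => by ring
  rw [hlin (fun u v z => curvatureMap Γ x u v z i)]
  · refine Finset.sum_congr rfl fun j _ => Finset.sum_congr rfl fun k _ =>
      Finset.sum_congr rfl fun l _ => ?_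
    simp only [curvatureMap, PiLp.sub_apply, PiLp.add_apply]
    ring
  all_goals
    intros
    simp only [curvatureMap, map_add, map_smul, add_apply, smul_apply, PiLp.sub_apply,
      PiLp.add_apply, PiLp.smul_apply, smul_eq_mul]
    ring

/-- An orthonormal frame with constant structure functions `c`. -/
structure IsOrthonormalFrame (T : Set (Coord n)) (A : Coord n → Coord n →L[ℝ] Coord n →L[ℝ] ℝ)
    (E : ι → Coord n → Coord n) (c : ι → ι → ι → ℝ) : Prop where
  smooth : ∀ a, ContDiffOn ℝ ∞ (E a) T
  inner : ∀ x ∈ T, ∀ a b, A x (E a x) (E b x) = if a = b then 1 else 0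
  span : ∀ x ∈ T, ∀ v, v = ∑ a, A x (E a x) v • E a x
  bracket : ∀ x ∈ T, ∀ a b, fderiv ℝ (E b) x (E a x) - fderiv ℝ (E a) x (E b x)
    = ∑ d, c a b d • E d x

namespace IsOrthonormalFrame

variable {T : Set (Coord n)} {A : Coord n → Coord n →L[ℝ] Coord n →L[ℝ] ℝ}
  {E : ι → Coord n → Coord n} {c : ι → ι → ι → ℝ} {x : Coord n}

lemma differentiableAt (hE : IsOrthonormalFrame T A E c) (hA : IsRiemannianFamily T A) (hx : x ∈ T)
    (a : ι) : DifferentiableAt ℝ (E a) x :=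
  ((hE.smooth a).contDiffAt (hA.isOpen.mem_nhds hx)).differentiableAt (by simp)

lemma inner_sum (hE : IsOrthonormalFrame T A E c) (hx : x ∈ T) (r : ι → ℝ) (b : ι) :
    A x (∑ a, r a • E a x) (E b x) = r b := by
  simp [sum_apply, hE.inner x hx]

/-- The Levi-Civita connection in an orthonormal frame. -/
lemma nabla (hE : IsOrthonormalFrame T A E c) (hA : IsRiemannianFamily T A) (hx : x ∈ T)
    (a b : ι) : fderiv ℝ (E b) x (E a x) + christoffelMap A x (E a x) (E b x)
      = ∑ d, connCoeff c a b d • E d x := by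
  set N : ι → ι → Coord n := fun a b =>
    fderiv ℝ (E b) x (E a x) + christoffelMap A x (E a x) (E b x) with hN
  -- Metric compatibility, since the inner products of frame fields are constant near `x`.
  have hskew : ∀ a b d, A x (N a b) (E d x) + A x (N a d) (E b x) = 0 := by
    intro a b d
    have h1 : HasFDerivAt (fun x => A x (E b x) (E d x)) _ x :=
      ((hA.differentiableAt hx).hasFDerivAt.clm_apply
        (hE.differentiableAt hA hx b).hasFDerivAt).clm_apply
        (hE.differentiableAt hA hx d).hasFDerivAt
    have h2 : fderiv ℝ (fun x => A x (E b x) (E d x)) x = 0 := by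
      rw [Filter.EventuallyEq.fderiv_eq (f := fun _ => if b = d then (1 : ℝ) else 0)]
      · exact fderiv_const_apply _
      · filter_upwards [hA.isOpen.mem_nhds hx] with x' hx' using hE.inner x' hx' b d
    have h3 := congrArg (fun φ : Coord n →L[ℝ] ℝ => φ (E a x)) (h1.fderiv.symm.trans h2)
    simp only [add_apply, ContinuousLinearMap.comp_apply, ContinuousLinearMap.flip_apply,
      zero_apply] at h3
    rw [hA.fderiv_eq hx] at h3
    rw [hA.symm x hx (N a d)]
    simp only [hN, map_add, add_apply]
    linarith
  have htor : ∀ a b d, A x (N a b) (E d x) - A x (N b a) (E d x) = c a b d := by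
    intro a b d
    have h1 : N a b - N b a = ∑ d, c a b d • E d x := by
      rw [← hE.bracket x hx a b]
      simp only [hN]
      rw [hA.christoffelMap_symm hx (E b x)]
      abel
    rw [← hE.inner_sum hx (c a b) d, ← h1]
    simp
  change N a b = _
  rw [hE.span x hx (N a b)]
  refine Finset.sum_congr rfl fun d _ => ?_
  congr 1
  -- Koszul's argument: three torsion identities and three skewness identities determine the
  -- coefficient.
  rw [hA.symm x hx, connCoeff]
  linarith [htor a b d, htor b d a, htor d a b, hskew a b d, hskew b a d, hskew d a b]

/-- The Riemann curvature in an orthonormal frame. -/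
lemma curvature {k : ι → ι → ι → ℝ} (hE : IsOrthonormalFrame T A E k)
    (hA : IsRiemannianFamily T A) (hx : x ∈ T)
    (a b c : ι) : curvatureMap (christoffelMap A) x (E a x) (E b x) (E c x)
      = ∑ f, frameCurvature k a b c f • E f x := by
  have hΓ : DifferentiableAt ℝ (christoffelMap A) x :=
    (hA.contDiffOn_christoffelMap.contDiffAt (hA.isOpen.mem_nhds hx)).differentiableAt (by simp)
  have hd := fun a => hE.differentiableAt hA hx a
  have hC : ∀ c, ContDiffAt ℝ ∞ (E c) x := fun c =>
    (hE.smooth c).contDiffAt (hA.isOpen.mem_nhds hx)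
  have hd2 : ∀ c, DifferentiableAt ℝ (fderiv ℝ (E c)) x := fun c =>
    ((hC c).fderiv_right (m := 1) (by
      rw [one_add_one_eq_two]; exact ENat.LEInfty.out)).differentiableAt (by simp)
  set N : ι → ι → Coord n := fun a b =>
    fderiv ℝ (E b) x (E a x) + christoffelMap A x (E a x) (E b x) with hN
  have hN' : ∀ a b, N a b = ∑ d, connCoeff k a b d • E d x := fun a b => hE.nabla hA hx a b
  -- The frame formula for `∇_b E_c` holds on all of the open set `T`, so it may be differentiated
  -- along `E a`; the coefficients are constant and contribute nothing.
  have key : ∀ a b, fderiv ℝ (fderiv ℝ (E c)) x (E a x) (E b x)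
      + fderiv ℝ (E c) x (fderiv ℝ (E b) x (E a x))
      + (fderiv ℝ (christoffelMap A) x (E a x) (E b x) (E c x)
        + christoffelMap A x (fderiv ℝ (E b) x (E a x)) (E c x)
        + christoffelMap A x (E b x) (fderiv ℝ (E c) x (E a x)))
      = ∑ d, connCoeff k b c d • fderiv ℝ (E d) x (E a x) := by
    intro a b
    have h1 : HasFDerivAt (fun x => fderiv ℝ (E c) x (E b x)
        + christoffelMap A x (E b x) (E c x)) _ x :=
      ((hd2 c).hasFDerivAt.clm_apply (hd b).hasFDerivAt).add
        ((hΓ.hasFDerivAt.clm_apply (hd b).hasFDerivAt).clm_apply (hd c).hasFDerivAt)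
    have h2 : HasFDerivAt (fun x => ∑ d, connCoeff k b c d • E d x) _ x :=
      HasFDerivAt.fun_sum fun d _ => (hd d).hasFDerivAt.const_smul (connCoeff k b c d)
    have h3 : fderiv ℝ (fun x => fderiv ℝ (E c) x (E b x)
        + christoffelMap A x (E b x) (E c x)) x
        = fderiv ℝ (fun x => ∑ d, connCoeff k b c d • E d x) x := by
      apply Filter.EventuallyEq.fderiv_eq
      filter_upwards [hA.isOpen.mem_nhds hx] with x' hx' using hE.nabla hA hx' b c
    rw [h1.fderiv, h2.fderiv] at h3
    have h4 := congrArg (fun φ : Coord n →L[ℝ] Coord n => φ (E a x)) h3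
    simp only [add_apply, ContinuousLinearMap.comp_apply, ContinuousLinearMap.flip_apply,
      sum_apply, smul_apply] at h4
    rw [← h4]
    abel
  have hsymm : fderiv ℝ (fderiv ℝ (E c)) x (E a x) (E b x)
      = fderiv ℝ (fderiv ℝ (E c)) x (E b x) (E a x) :=
    ((hC c).isSymmSndFDerivAt (by
      rw [minSmoothness_of_isRCLikeNormedField]; exact ENat.LEInfty.out)) _ _
  -- This is `R(a,b) = ∇_a∇_b - ∇_b∇_a - ∇_[a,b]`; the second derivatives of `E c` drop out by
  -- symmetry.
  have hR : curvatureMap (christoffelMap A) x (E a x) (E b x) (E c x)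
      = ∑ d, connCoeff k b c d • N a d - ∑ d, connCoeff k a c d • N b d
        - ∑ e, k a b e • N e c := by
    have hs : ∀ a b, ∑ d, connCoeff k b c d • N a d
        = ∑ d, connCoeff k b c d • fderiv ℝ (E d) x (E a x)
          + christoffelMap A x (E a x) (N b c) := by
      intro a b
      rw [hN' b c, map_sum, ← Finset.sum_add_distrib]
      exact Finset.sum_congr rfl fun d _ => by rw [map_smul, ← smul_add]
    have hb : ∑ e, k a b e • N e c
        = fderiv ℝ (E c) x (fderiv ℝ (E b) x (E a x) - fderiv ℝ (E a) x (E b x))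
          + christoffelMap A x (fderiv ℝ (E b) x (E a x) - fderiv ℝ (E a) x (E b x)) (E c x) := by
      rw [hE.bracket x hx, map_sum, map_sum, sum_apply, ← Finset.sum_add_distrib]
      exact Finset.sum_congr rfl fun d _ => by simp [hN]
    rw [hs, hs, hb, ← key, ← key, hsymm, curvatureMap]
    simp only [hN, map_add, map_sub, sub_apply]
    abel
  have hswap : ∀ (w : ι → ℝ) (M : ι → ι → ℝ), ∑ d, w d • ∑ f, M d f • E f x
      = ∑ f, (∑ d, w d * M d f) • E f x := by
    intro w M
    simp only [Finset.smul_sum, Finset.sum_smul, smul_smul]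
    exact Finset.sum_comm
  rw [hR]
  simp only [hN', hswap, ← Finset.sum_sub_distrib, ← sub_smul, frameCurvature]

/-- A field with constant components in the frame is parallel if and only if the connection
coefficients annihilate it. -/
lemma parallel_iff (hE : IsOrthonormalFrame T A E c) (hA : IsRiemannianFamily T A) (hx : x ∈ T)
    (q : ι → ℝ) : (∀ u, fderiv ℝ (fun x => ∑ b, q b • E b x) x u
        + christoffelMap A x u (∑ b, q b • E b x) = 0) ↔
      ∀ a d, ∑ b, q b * connCoeff c a b d = 0 := by
  have h2 : HasFDerivAt (fun x => ∑ b, q b • E b x) _ x :=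
    HasFDerivAt.fun_sum fun d _ => (hE.differentiableAt hA hx d).hasFDerivAt.const_smul (q d)
  have h3 : ∀ a, fderiv ℝ (fun x => ∑ b, q b • E b x) x (E a x)
        + christoffelMap A x (E a x) (∑ b, q b • E b x)
      = ∑ d, (∑ b, q b * connCoeff c a b d) • E d x := by
    intro a
    rw [h2.fderiv, map_sum, sum_apply, ← Finset.sum_add_distrib]
    simp only [smul_apply, map_smul, ← smul_add, hE.nabla hA hx, Finset.smul_sum, Finset.sum_smul,
      smul_smul]
    exact Finset.sum_comm
  constructor
  · intro h a d
    rw [← hE.inner_sum hx (fun d => ∑ b, q b * connCoeff c a b d) d, ← h3, h]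
    simp
  · intro h u
    have h4 : ∀ a, fderiv ℝ (fun x => ∑ b, q b • E b x) x (E a x)
        + christoffelMap A x (E a x) (∑ b, q b • E b x) = 0 := fun a => by
      rw [h3]; simp [h]
    generalize fderiv ℝ (fun x => ∑ b, q b • E b x) x = D at h4 ⊢
    generalize ∑ b, q b • E b x = w at h4 ⊢
    rw [hE.span x hx u, map_sum, map_sum, sum_apply, ← Finset.sum_add_distrib]
    refine Finset.sum_eq_zero fun a _ => ?_
    rw [map_smul, map_smul, smul_apply, ← smul_add, h4, smul_zero]

end IsOrthonormalFrame

end Frame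

/-! ### Randers functions with a parallel field, in coordinates. -/

section RandersCoordinates

variable {n : ℕ} {T : Set (Coord n)} {A : Coord n → Coord n →L[ℝ] Coord n →L[ℝ] ℝ}
  {Q : Coord n → Coord n} {L : Coord n → Coord n → ℝ} {x y : Coord n}

lemma pdy_eq_deriv {f : Coord n → Coord n → ℝ} (hf : DifferentiableAt ℝ (fun y' => f x y') y)
    (k : Fin n) :
    pdy k f x y = deriv (fun t : ℝ => f x (y + t • EuclideanSpace.single k 1)) 0 :=
  hf.lineDeriv_eq_fderiv.symm

lemma sum_mul_pdy (f : Coord n → Coord n → ℝ) (x y v : Coord n) :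
    ∑ s, v s * pdy s f x y = fderiv ℝ (fun y' => f x y') y v := by
  conv_rhs => rw [coord_eq_sum v]
  simp [pdy]

/-- The Randers function of a smooth family of inner products and a parallel field of length less
than one, in coordinates. -/
structure IsParallelRanders (T : Set (Coord n)) (A : Coord n → Coord n →L[ℝ] Coord n →L[ℝ] ℝ)
    (Q : Coord n → Coord n) (L : Coord n → Coord n → ℝ) : Prop extends
    IsRiemannianFamily T A where
  smooth_field : ContDiffOn ℝ ∞ Q T
  parallel : ∀ x ∈ T, ∀ u, fderiv ℝ Q x u + christoffelMap A x u (Q x) = 0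
  small : ∀ x ∈ T, A x (Q x) (Q x) < 1
  eq : ∀ x ∈ T, ∀ y, L x y = √(A x y y) + A x (Q x) y

namespace IsParallelRanders

lemma smooth_sq (h : IsParallelRanders T A Q L) : SmoothOffZero T (fun x y => L x y ^ 2) := by
  have hfst : ContDiffOn ℝ ∞ (fun z : Coord n × Coord n => z.1) (T ×ˢ {0}ᶜ) := contDiff_fst.contDiffOn
  have hsnd : ContDiffOn ℝ ∞ (fun z : Coord n × Coord n => z.2) (T ×ˢ {0}ᶜ) := contDiff_snd.contDiffOn
  have hA : ContDiffOn ℝ ∞ (fun z : Coord n × Coord n => A z.1) (T ×ˢ {0}ᶜ) :=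
    h.smooth.comp hfst fun z hz => hz.1
  have hQ : ContDiffOn ℝ ∞ (fun z : Coord n × Coord n => Q z.1) (T ×ˢ {0}ᶜ) :=
    h.smooth_field.comp hfst fun z hz => hz.1
  have h1 : ContDiffOn ℝ ∞ (fun z : Coord n × Coord n =>
      (√(A z.1 z.2 z.2) + A z.1 (Q z.1) z.2) ^ 2) (T ×ˢ {0}ᶜ) :=
    ((((hA.clm_apply hsnd).clm_apply hsnd).sqrt fun z hz => (h.pos _ hz.1 _ hz.2).ne').add
      ((hA.clm_apply hQ).clm_apply hsnd)).pow 2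
  exact h1.congr fun z hz => by
    simp only [h.eq _ hz.1]

lemma fderiv_snd (h : IsParallelRanders T A Q L) (hx : x ∈ T) (hy : y ≠ 0) (v : Coord n) :
    fderiv ℝ (fun y' => L x y' ^ 2) y v
      = 2 * L x y * (A x y v / √(A x y y) + A x (Q x) v) := by
  have hd := h.smooth_sq.differentiableAt_snd h.isOpen hx hy
  have h1 : lineDeriv ℝ (fun y' => L x y' ^ 2) y v
      = fderiv ℝ (fun y' => L x y' ^ 2) y v := hd.lineDeriv_eq_fderiv
  rw [← h1, lineDeriv]
  simp only [h.eq x hx]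
  exact (hasDerivAt_randers_sq (h.symm x hx) y v (h.pos x hx y hy)).deriv

/-- Invariance of the energy under parallel transport. Metric compatibility handles `A(y,y)`; in the
derivative of `A(Q,y)` the terms with `∂Q` and `Γ Q` cancel because `Q` is parallel. -/
lemma fderiv_fst (h : IsParallelRanders T A Q L) (hx : x ∈ T) (hy : y ≠ 0) (u : Coord n) :
    fderiv ℝ (fun x' => L x' y ^ 2) x u
      = fderiv ℝ (fun y' => L x y' ^ 2) y (christoffelMap A x u y) := by
  have hA := h.toIsRiemannianFamily
  have hp := h.pos x hx y hy
  have hα := Real.sqrt_pos.2 hp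
  have hdA := hA.differentiableAt hx
  have hdQ : DifferentiableAt ℝ Q x :=
    (h.smooth_field.contDiffAt (h.isOpen.mem_nhds hx)).differentiableAt (by simp)
  have hyc := hasFDerivAt_const (𝕜 := ℝ) y x
  have h1 : HasFDerivAt (fun x' => (√(A x' y y) + A x' (Q x') y) ^ 2) _ x :=
    ((((hdA.hasFDerivAt.clm_apply hyc).clm_apply hyc).sqrt hp.ne').add
      ((hdA.hasFDerivAt.clm_apply hdQ.hasFDerivAt).clm_apply hyc)).pow 2
  have h2 : fderiv ℝ (fun x' => L x' y ^ 2) x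
      = fderiv ℝ (fun x' => (√(A x' y y) + A x' (Q x') y) ^ 2) x := by
    apply Filter.EventuallyEq.fderiv_eq
    filter_upwards [h.isOpen.mem_nhds hx] with x' hx' using by rw [h.eq x' hx']
  have h3 : fderiv ℝ Q x u = - christoffelMap A x u (Q x) :=
    eq_neg_of_add_eq_zero_left (h.parallel x hx u)
  rw [h2, h1.fderiv, h.fderiv_snd hx hy, h.eq x hx]
  simp only [add_apply, smul_apply, ContinuousLinearMap.comp_apply, ContinuousLinearMap.flip_apply,
    zero_apply, map_zero, smul_eq_mul, hA.fderiv_eq hx, h3, map_neg, neg_apply,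
    h.symm x hx (christoffelMap A x u y) y]
  simp
  field_simp
  ring

lemma gCoeff_eq (h : IsParallelRanders T A Q L) (hx : x ∈ T) (hy : y ≠ 0) (i j : Fin n) :
    gCoeff L i j x y = randersTensor (A x) (A x (Q x)) y (EuclideanSpace.single i 1)
      (EuclideanSpace.single j 1) := by
  have hs := h.smooth_sq
  rw [← deriv_deriv_randers_sq (h.symm x hx) _ _ (h.pos x hx y hy), gCoeff,
    pdy_eq_deriv ((hs.smooth_pdy h.isOpen j).differentiableAt_snd h.isOpen hx hy)]
  congr 1
  apply Filter.EventuallyEq.deriv_eq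
  have hc : ContinuousAt (fun s : ℝ => y + s • EuclideanSpace.single i (1 : ℝ)) 0 := by fun_prop
  -- The inner partial derivative is a line derivative only off the zero section, which `y + s eᵢ`
  -- avoids for small `s`.
  filter_upwards [hc.eventually_ne (y := 0) (by simpa using hy)] with s hsy
  rw [pdy_eq_deriv (hs.differentiableAt_snd h.isOpen hx hsy)]
  simp only [h.eq x hx]

/-- The Chern connection of `L` is the Levi-Civita connection. -/
theorem isBerwaldConnection (h : IsParallelRanders T A Q L) :
    IsBerwaldConnection T L fun i j k x =>
      christoffelMap A x (EuclideanSpace.single k 1) (EuclideanSpace.single j 1) i where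
  isOpen := h.isOpen
  smooth := h.smooth_sq
  euler x hx y hy := by
    rw [sum_mul_pdy (fun x y => L x y ^ 2), h.fderiv_snd hx hy, Real.div_sqrt, h.eq x hx]
    ring
  symm x hx i j k := by rw [h.toIsRiemannianFamily.christoffelMap_symm hx]
  parallel x hx y hy k := by
    have h1 := h.fderiv_fst hx hy (EuclideanSpace.single k 1)
    rw [← sum_mul_pdy (fun x y => L x y ^ 2)] at h1
    rw [pdx, h1]
    refine Finset.sum_congr rfl fun s _ => ?_
    rw [← Finset.sum_mul]
    congr 1
    conv_lhs => rw [coord_eq_sum y]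
    simp [mul_comm]
  nondeg x hx y hy := by
    -- A kernel vector of the matrix would be isotropic for the positive definite `randersTensor`.
    rw [isUnit_iff_ne_zero]
    intro h0
    obtain ⟨v, hv, hv0⟩ := Matrix.exists_mulVec_eq_zero_iff.2 h0
    set B := randersTensor (A x) (A x (Q x)) y with hB
    have hne : WithLp.toLp 2 v ≠ 0 := by simpa using hv
    have h1 : ∀ i, B (EuclideanSpace.single i 1) (WithLp.toLp 2 v) = 0 := by
      intro i
      refine Eq.trans ?_ (congrFun hv0 i)
      rw [coord_eq_sum (WithLp.toLp 2 v), map_sum]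
      simp only [Matrix.mulVec, dotProduct, Matrix.of_apply, h.gCoeff_eq hx hy, map_smul,
        smul_eq_mul]
      exact Finset.sum_congr rfl fun j _ => mul_comm _ _
    have h2 : B (WithLp.toLp 2 v) (WithLp.toLp 2 v) = 0 := by
      have : B (WithLp.toLp 2 v) = ∑ i, v i • B (EuclideanSpace.single i 1) := by
        conv_lhs => rw [coord_eq_sum (WithLp.toLp 2 v)]
        simp
      rw [this]
      simp [h1]
    exact (randersTensor_pos (h.symm x hx) (h.pos x hx) hy
      (randers_pos (h.symm x hx) (h.pos x hx) (h.small x hx) hy) hne).ne' h2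

end IsParallelRanders

end RandersCoordinates

/-! ### Tangent vectors and the metric read in charts. -/

section Charts

variable {n : ℕ} {M : Type*} [TopologicalSpace M] [ChartedSpace (Coord n) M]

lemma chartVec_add (p : M) (x u v : Coord n) :
    chartVec p x (u + v) = chartVec p x u + chartVec p x v := map_add _ _ _

lemma chartVec_smul (p : M) (x : Coord n) (c : ℝ) (u : Coord n) :
    chartVec p x (c • u) = c • chartVec p x u := map_smul _ _ _

variable [IsManifold (𝓡 n) 1 M]

lemma components_chartVec (p : M) {x : Coord n} (hx : x ∈ (extChartAt (𝓡 n) p).target)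
    (y : Coord n) : components p ((extChartAt (𝓡 n) p).symm x) (chartVec p x y) = y := by
  have h := mfderiv_extChartAt_comp_mfderivWithin_extChartAt_symm (I := 𝓡 n) hx
  simp only [ModelWithCorners.range_eq_univ, mfderivWithin_univ] at h
  exact congrArg (fun φ => φ y) h

lemma chartVec_components (p : M) {x : Coord n} (hx : x ∈ (extChartAt (𝓡 n) p).target)
    (v : TangentSpace (𝓡 n) ((extChartAt (𝓡 n) p).symm x)) :
    chartVec p x (components p ((extChartAt (𝓡 n) p).symm x) v) = v := by
  have h := mfderivWithin_extChartAt_symm_comp_mfderiv_extChartAt (I := 𝓡 n) hx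
  simp only [ModelWithCorners.range_eq_univ, mfderivWithin_univ] at h
  exact congrArg (fun φ => φ v) h

lemma inverse_mfderiv_symm (p : M) {x : Coord n} (hx : x ∈ (extChartAt (𝓡 n) p).target)
    (v : TangentSpace (𝓡 n) ((extChartAt (𝓡 n) p).symm x)) :
    (mfderiv (𝓡 n) (𝓡 n) (extChartAt (𝓡 n) p).symm x).inverse v
      = components p ((extChartAt (𝓡 n) p).symm x) v := by
  have h := mfderivWithin_extChartAt_symm_comp_mfderiv_extChartAt (I := 𝓡 n) hx
  have h' := mfderiv_extChartAt_comp_mfderivWithin_extChartAt_symm (I := 𝓡 n) hx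
  simp only [ModelWithCorners.range_eq_univ, mfderivWithin_univ] at h h'
  rw [ContinuousLinearMap.inverse_eq h h']
  rfl

/-- The tangent space at `p` is modelled through the preferred chart at `p`, whose derivative at `p`
is therefore the identity. -/
lemma components_self (p : M) (v : TangentSpace (𝓡 n) p) : components p p v = v :=
  congrArg (fun φ : Coord n →L[ℝ] Coord n => φ v) (mfderiv_extChartAt_self (I := 𝓡 n) (x := p))

lemma ofComponents_self (p : M) (w : Coord n) : ofComponents p w = w :=
  (congrArg (fun φ : Coord n →L[ℝ] Coord n => φ.inverse w)
    (mfderiv_extChartAt_self (I := 𝓡 n) (x := p))).trans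
    (congrArg (fun φ : Coord n →L[ℝ] Coord n => φ w) ContinuousLinearMap.inverse_id)

lemma components_ofComponents (p : M) (w : Coord n) :
    components p p (ofComponents p w) = w :=
  (components_self p _).trans (ofComponents_self p w)

/-- The metric in the chart at `p`. -/
def metricForm (g : RiemMetric n M) (p : M) (x : Coord n) : Coord n →L[ℝ] Coord n →L[ℝ] ℝ :=
  (LinearMap.mk₂ ℝ (fun u v => g.inner ((extChartAt (𝓡 n) p).symm x) (chartVec p x u)
    (chartVec p x v))
    (fun u u' v => by rw [chartVec_add, map_add]; rfl)
    (fun c u v => by rw [chartVec_smul, map_smul]; rfl)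
    (fun u v v' => by rw [chartVec_add, map_add])
    (fun c u v => by rw [chartVec_smul, map_smul])).toContinuousBilinearMap

lemma metricForm_apply (g : RiemMetric n M) (p : M) (x u v : Coord n) :
    metricForm g p x u v
      = g.inner ((extChartAt (𝓡 n) p).symm x) (chartVec p x u) (chartVec p x v) := rfl

lemma metricForm_components (g : RiemMetric n M) (p : M) {x : Coord n}
    (hx : x ∈ (extChartAt (𝓡 n) p).target)
    (u v : TangentSpace (𝓡 n) ((extChartAt (𝓡 n) p).symm x)) :
    metricForm g p x (components p _ u) (components p _ v)
      = g.inner ((extChartAt (𝓡 n) p).symm x) u v := by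
  rw [metricForm_apply, chartVec_components p hx, chartVec_components p hx]

lemma metricForm_components_self (g : RiemMetric n M) (p : M) (u v : TangentSpace (𝓡 n) p) :
    metricForm g p (extChartAt (𝓡 n) p p) (components p p u) (components p p v)
      = g.inner p u v := by
  -- Chart and inverse chart cancel only propositionally, and the tangent space depends on the
  -- point; a variable `q` allows the substitution.
  have h : ∀ q ∈ (extChartAt (𝓡 n) p).source, ∀ u v : TangentSpace (𝓡 n) q,
      metricForm g p (extChartAt (𝓡 n) p q) (components p q u) (components p q v)
        = g.inner q u v := by
    intro q hq u v
    obtain ⟨x, hx, rfl⟩ : ∃ x ∈ (extChartAt (𝓡 n) p).target, (extChartAt (𝓡 n) p).symm x = q :=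
      ⟨_, (extChartAt (𝓡 n) p).map_source hq, (extChartAt (𝓡 n) p).left_inv hq⟩
    rw [(extChartAt (𝓡 n) p).right_inv hx]
    exact metricForm_components g p hx u v
  exact h p (mem_extChartAt_source p) u v

lemma localExpr_randers (g : RiemMetric n M) (Q : ∀ p : M, TangentSpace (𝓡 n) p) (p : M)
    {x : Coord n} (hx : x ∈ (extChartAt (𝓡 n) p).target) (y : Coord n) :
    localExpr (randers g Q) p x y = √(metricForm g p x y y)
      + metricForm g p x (components p ((extChartAt (𝓡 n) p).symm x)
        (Q ((extChartAt (𝓡 n) p).symm x))) y := by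
  simp only [localExpr, randers, metricForm_apply]
  rw [chartVec_components p hx]

end Charts

/-! ### Smoothness of the coordinate expressions. -/

section SmoothCharts

variable {n : ℕ} {M : Type*} [TopologicalSpace M] [ChartedSpace (Coord n) M]
  [IsManifold (𝓡 n) ∞ M]

lemma contMDiffOn_chartVec (p : M) (u : Coord n) :
    ContMDiffOn 𝓘(ℝ, Coord n) (𝓡 n).tangent ∞
      (fun x : Coord n => (⟨(extChartAt (𝓡 n) p).symm x, chartVec p x u⟩ : TangentBundle (𝓡 n) M))
      (extChartAt (𝓡 n) p).target := by
  have hT := isOpen_extChartAt_target (I := 𝓡 n) p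
  have h1 := (contMDiffOn_extChartAt_symm (I := 𝓡 n) (n := ∞) p).contMDiffOn_tangentMapWithin
    (m := ∞) (by simp) hT.uniqueMDiffOn
  have h2 : ContMDiffOn 𝓘(ℝ, Coord n) (𝓘(ℝ, Coord n)).tangent ∞
      (fun x : Coord n => (⟨x, u⟩ : TangentBundle 𝓘(ℝ, Coord n) (Coord n)))
      (extChartAt (𝓡 n) p).target :=
    contMDiffOn_vectorSpace_iff_contDiffOn (V := fun _ => u).2 contDiffOn_const
  refine (h1.comp h2 fun x hx => hx).congr fun x hx => ?_
  simp only [Function.comp, tangentMapWithin, mfderivWithin_of_isOpen hT hx]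
  rfl

/-- Stated for fields along a map `b`, so that it serves both for inverse charts and for the
projection of the tangent bundle. -/
lemma contMDiff_inner {N : Type*} [TopologicalSpace N] {H' : Type*} [TopologicalSpace H']
    {E' : Type*} [NormedAddCommGroup E'] [NormedSpace ℝ E'] {J : ModelWithCorners ℝ E' H'}
    [ChartedSpace H' N] (g : RiemMetric n M) {b : N → M}
    {v w : ∀ z, TangentSpace (𝓡 n) (b z)} {s : Set N}
    (hv : ContMDiffOn J (𝓡 n).tangent ∞ (fun z => (⟨b z, v z⟩ : TangentBundle (𝓡 n) M)) s)
    (hw : ContMDiffOn J (𝓡 n).tangent ∞ (fun z => (⟨b z, w z⟩ : TangentBundle (𝓡 n) M)) s) :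
    ContMDiffOn J 𝓘(ℝ, ℝ) ∞ (fun z => g.inner (b z) (v z) (w z)) s := by
  intro z hz
  have hb : ContMDiffWithinAt J (𝓡 n) ∞ b s z :=
    (Bundle.contMDiffWithinAt_totalSpace.1 (hv z hz)).1
  have h : ContMDiffWithinAt J ((𝓡 n).prod 𝓘(ℝ, ℝ)) ∞
      (fun z => Bundle.TotalSpace.mk' ℝ (E := Bundle.Trivial M ℝ) (b z)
        (g.inner (b z) (v z) (w z))) s z := by
    apply ContMDiffWithinAt.clm_bundle_apply₂ (F₁ := Coord n) (F₂ := Coord n)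
    · exact ContMDiffAt.comp_contMDiffWithinAt z g.contMDiff.contMDiffAt hb
    · exact hv z hz
    · exact hw z hz
  exact (Bundle.contMDiffWithinAt_totalSpace.1 h).2

lemma contDiffOn_metricForm (g : RiemMetric n M) (p : M) :
    ContDiffOn ℝ ∞ (metricForm g p) (extChartAt (𝓡 n) p).target := by
  rw [contDiffOn_clm_apply]
  intro u
  rw [contDiffOn_clm_apply]
  intro v
  exact (contMDiff_inner g (contMDiffOn_chartVec p u) (contMDiffOn_chartVec p v)).contDiffOn

lemma isRiemannianFamily_metricForm (g : RiemMetric n M) (p : M) :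
    IsRiemannianFamily (extChartAt (𝓡 n) p).target (metricForm g p) where
  isOpen := isOpen_extChartAt_target p
  smooth := contDiffOn_metricForm g p
  symm x _ u v := g.symm _ _ _
  pos x hx u hu := by
    refine g.pos _ _ fun h => hu ?_
    rw [← components_chartVec p hx u, h]
    exact map_zero _

/-- The components of a smooth vector field are smooth. -/
lemma contDiffOn_components (p : M) {Q : ∀ q : M, TangentSpace (𝓡 n) q}
    (hQ : ContMDiff (𝓡 n) (𝓡 n).tangent ∞ (fun q => (⟨q, Q q⟩ : TangentBundle (𝓡 n) M))) :
    ContDiffOn ℝ ∞ (fun x => components p ((extChartAt (𝓡 n) p).symm x)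
      (Q ((extChartAt (𝓡 n) p).symm x))) (extChartAt (𝓡 n) p).target := by
  have h1 := (trivializationAt (Coord n) (TangentSpace (𝓡 n)) p).contMDiffOn (IB := 𝓡 n) (n := ∞)
  have h2 := hQ.comp_contMDiffOn (contMDiffOn_extChartAt_symm (I := 𝓡 n) (n := ∞) p)
  have hmem : ∀ x ∈ (extChartAt (𝓡 n) p).target,
      (extChartAt (𝓡 n) p).symm x ∈ (chartAt (Coord n) p).source := fun x hx => by
    simpa using (extChartAt (𝓡 n) p).map_target hx
  have h3 := (contMDiff_snd (I := 𝓡 n) (J := 𝓘(ℝ, Coord n)) (n := ∞)).comp_contMDiffOn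
    (h1.comp h2 fun x hx => hmem x hx)
  refine (contMDiffOn_iff_contDiffOn.1 h3).congr fun x hx => ?_
  -- Chart components are the fibre coordinate of the trivialization at `p`, which is smooth.
  have h4 := TangentBundle.continuousLinearMapAt_trivializationAt (I := 𝓡 n) (hmem x hx)
  have h5 : components p ((extChartAt (𝓡 n) p).symm x) (Q ((extChartAt (𝓡 n) p).symm x)) = _ :=
    congrArg (fun φ : TangentSpace (𝓡 n) ((extChartAt (𝓡 n) p).symm x) →L[ℝ] Coord n =>
      φ (Q ((extChartAt (𝓡 n) p).symm x))) h4.symm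
  refine h5.trans ?_
  rw [Bundle.Trivialization.continuousLinearMapAt_apply,
    Bundle.Trivialization.linearMapAt_apply, if_pos (by simpa using hmem x hx)]
  rfl

end SmoothCharts

/-! ### Randers metrics with a parallel field on a manifold. -/

section LeviCivita

variable {n : ℕ} {M : Type*} [TopologicalSpace M] [ChartedSpace (Coord n) M]
  [IsManifold (𝓡 n) ∞ M]

lemma christoffel_eq (g : RiemMetric n M) (p : M) {x : Coord n}
    (hx : x ∈ (extChartAt (𝓡 n) p).target) (i j k : Fin n) :
    christoffel g p i j k x = christoffelMap (metricForm g p) x (EuclideanSpace.single k 1)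
      (EuclideanSpace.single j 1) i := by
  have hA := isRiemannianFamily_metricForm g p
  have hpd : ∀ a b c, pd a (riemCoeff g p b c) x = fderiv ℝ (metricForm g p) x
      (EuclideanSpace.single a 1) (EuclideanSpace.single b 1) (EuclideanSpace.single c 1) :=
    fun a b c => hA.fderiv_apply hx _ _ _
  rw [christoffel, christoffelMap_apply, Finset.mul_sum]
  refine Finset.sum_congr rfl fun s _ => ?_
  rw [hpd, hpd, hpd, koszul, mul_left_comm]
  rfl

lemma riemCurvatureCoeff_eq (g : RiemMetric n M) (p : M) {x : Coord n}
    (hx : x ∈ (extChartAt (𝓡 n) p).target) (j i k l : Fin n) :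
    riemCurvatureCoeff g p j i k l x
      = pd k (fun x => christoffelMap (metricForm g p) x (EuclideanSpace.single l 1)
          (EuclideanSpace.single j 1) i) x
        - pd l (fun x => christoffelMap (metricForm g p) x (EuclideanSpace.single k 1)
          (EuclideanSpace.single j 1) i) x
        + ∑ m, (christoffelMap (metricForm g p) x (EuclideanSpace.single k 1)
            (EuclideanSpace.single m 1) i * christoffelMap (metricForm g p) x
            (EuclideanSpace.single l 1) (EuclideanSpace.single j 1) m
          - christoffelMap (metricForm g p) x (EuclideanSpace.single l 1)
            (EuclideanSpace.single m 1) i * christoffelMap (metricForm g p) x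
            (EuclideanSpace.single k 1) (EuclideanSpace.single j 1) m) := by
  have hpd : ∀ i j k l, pd k (christoffel g p i j l) x
      = pd k (fun x => christoffelMap (metricForm g p) x (EuclideanSpace.single l 1)
          (EuclideanSpace.single j 1) i) x := by
    intro i j k l
    rw [pd, pd, Filter.EventuallyEq.fderiv_eq]
    filter_upwards [(isOpen_extChartAt_target (I := 𝓡 n) p).mem_nhds hx] with x' hx'
      using christoffel_eq g p hx' i j l
  simp only [riemCurvatureCoeff, hpd, christoffel_eq g p hx]

lemma riemCurvature_eq (g : RiemMetric n M) (p : M) (u v w : TangentSpace (𝓡 n) p) :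
    riemCurvature g p u v w = ofComponents p (curvatureMap (christoffelMap (metricForm g p))
      (extChartAt (𝓡 n) p p) (components p p u) (components p p v) (components p p w)) := by
  have hx := mem_extChartAt_target (I := 𝓡 n) p
  have hA := isRiemannianFamily_metricForm g p
  have hΓ : DifferentiableAt ℝ (christoffelMap (metricForm g p)) (extChartAt (𝓡 n) p p) :=
    (hA.contDiffOn_christoffelMap.contDiffAt (hA.isOpen.mem_nhds hx)).differentiableAt (by simp)
  rw [riemCurvature]
  congr 1
  ext i
  rw [curvatureMap_apply hΓ _ _ _ i (G := fun i j k x => christoffelMap (metricForm g p) x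
    (EuclideanSpace.single k 1) (EuclideanSpace.single j 1) i) fun _ _ _ _ => rfl]
  simp only [riemCurvatureCoeff_eq g p hx]

/-- The components of a vector field in the chart at `p`. -/
def fieldComponents (Q : ∀ q : M, TangentSpace (𝓡 n) q) (p : M) (x : Coord n) : Coord n :=
  components p ((extChartAt (𝓡 n) p).symm x) (Q ((extChartAt (𝓡 n) p).symm x))

variable {g : RiemMetric n M} {Q : ∀ q : M, TangentSpace (𝓡 n) q}

lemma isParallel_iff
    (hQ : ContMDiff (𝓡 n) (𝓡 n).tangent ∞ (fun q => (⟨q, Q q⟩ : TangentBundle (𝓡 n) M))) :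
    IsParallel g Q ↔ ∀ p : M, ∀ x ∈ (extChartAt (𝓡 n) p).target, ∀ u,
      fderiv ℝ (fieldComponents Q p) x u
        + christoffelMap (metricForm g p) x u (fieldComponents Q p x) = 0 := by
  have key : ∀ (p : M), ∀ x ∈ (extChartAt (𝓡 n) p).target, ∀ i k,
      pd k (fun x' => components p ((extChartAt (𝓡 n) p).symm x')
        (Q ((extChartAt (𝓡 n) p).symm x')) i) x
      + ∑ j, christoffel g p i j k x *
        components p ((extChartAt (𝓡 n) p).symm x) (Q ((extChartAt (𝓡 n) p).symm x)) j
      = (fderiv ℝ (fieldComponents Q p) x (EuclideanSpace.single k 1)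
        + christoffelMap (metricForm g p) x (EuclideanSpace.single k 1)
          (fieldComponents Q p x)) i := by
    intro p x hx i k
    have hd : DifferentiableAt ℝ (fieldComponents Q p) x :=
      ((contDiffOn_components p hQ).contDiffAt
        ((isOpen_extChartAt_target (I := 𝓡 n) p).mem_nhds hx)).differentiableAt (by simp)
    have h2 : HasFDerivAt (fun x => (EuclideanSpace.proj i : Coord n →L[ℝ] ℝ)
        (fieldComponents Q p x)) _ x :=
      ((EuclideanSpace.proj i : Coord n →L[ℝ] ℝ).hasFDerivAt).comp x hd.hasFDerivAt
    have h3 : pd k (fun x' => components p ((extChartAt (𝓡 n) p).symm x')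
        (Q ((extChartAt (𝓡 n) p).symm x')) i) x
        = fderiv ℝ (fieldComponents Q p) x (EuclideanSpace.single k 1) i :=
      congrArg (fun φ : Coord n →L[ℝ] ℝ => φ (EuclideanSpace.single k 1)) h2.fderiv
    rw [h3, PiLp.add_apply]
    congr 1
    conv_rhs => rw [coord_eq_sum (fieldComponents Q p x)]
    simp only [map_sum, map_smul, WithLp.ofLp_sum, Finset.sum_apply, PiLp.smul_apply, smul_eq_mul]
    refine Finset.sum_congr rfl fun j _ => ?_
    rw [christoffel_eq g p hx, mul_comm]
    rfl
  constructor
  · intro h p x hx u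
    have h1 : ∀ k, fderiv ℝ (fieldComponents Q p) x (EuclideanSpace.single k 1)
        + christoffelMap (metricForm g p) x (EuclideanSpace.single k 1)
          (fieldComponents Q p x) = 0 := by
      intro k
      ext i
      rw [← key p x hx i k]
      exact h p x hx i k
    generalize fieldComponents Q p x = w at h1 ⊢
    rw [coord_eq_sum u, map_sum, map_sum, sum_apply, ← Finset.sum_add_distrib]
    refine Finset.sum_eq_zero fun k _ => ?_
    rw [map_smul, map_smul, smul_apply, ← smul_add, h1, smul_zero]
  · intro h p x hx i k
    rw [key p x hx, h p x hx]
    rfl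

lemma isParallelRanders
    (hQ : ContMDiff (𝓡 n) (𝓡 n).tangent ∞ (fun q => (⟨q, Q q⟩ : TangentBundle (𝓡 n) M)))
    (hp : IsParallel g Q) (hs : ∀ p, g.inner p (Q p) (Q p) < 1) (p : M) :
    IsParallelRanders (extChartAt (𝓡 n) p).target (metricForm g p) (fieldComponents Q p)
      (localExpr (randers g Q) p) where
  toIsRiemannianFamily := isRiemannianFamily_metricForm g p
  smooth_field := contDiffOn_components p hQ
  parallel := (isParallel_iff hQ).1 hp p
  small x hx := by
    rw [fieldComponents, metricForm_components g p hx]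
    exact hs _
  eq x hx y := localExpr_randers g Q p hx y

theorem isBerwald_randers
    (hQ : ContMDiff (𝓡 n) (𝓡 n).tangent ∞ (fun q => (⟨q, Q q⟩ : TangentBundle (𝓡 n) M)))
    (hp : IsParallel g Q) (hs : ∀ p, g.inner p (Q p) (Q p) < 1) : IsBerwald (randers g Q) := by
  intro p x hx y y' hy hy' i j k
  have h := (isParallelRanders hQ hp hs p).isBerwaldConnection
  rw [h.chernCoeff_eq hx hy, h.chernCoeff_eq hx hy']

/-- Both curvatures are the same expression in the connection coefficients, and these agree near the
point. -/
theorem chernCurvature_randers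
    (hQ : ContMDiff (𝓡 n) (𝓡 n).tangent ∞ (fun q => (⟨q, Q q⟩ : TangentBundle (𝓡 n) M)))
    (hp : IsParallel g Q) (hs : ∀ p, g.inner p (Q p) (Q p) < 1) (p : M)
    {y : TangentSpace (𝓡 n) p} (hy : y ≠ 0) (u v w : TangentSpace (𝓡 n) p) :
    chernCurvature (randers g Q) p y u v w = riemCurvature g p u v w := by
  have h := (isParallelRanders hQ hp hs p).isBerwaldConnection
  have hx := mem_extChartAt_target (I := 𝓡 n) p
  have hy' : components p p y ≠ 0 := fun h0 => hy ((components_self p y).symm.trans h0)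
  simp only [chernCurvature, riemCurvature, h.chernCurvatureCoeff_eq hx hy',
    riemCurvatureCoeff_eq g p hx]

lemma fundamentalTensor_randers (g : RiemMetric n M) (Q : ∀ q : M, TangentSpace (𝓡 n) q) (p : M)
    {y : TangentSpace (𝓡 n) p} (hy : y ≠ 0) (u v : TangentSpace (𝓡 n) p) :
    fundamentalTensor (randers g Q) p y u v
      = randersTensor (g.inner p) (g.inner p (Q p)) y u v := by
  rw [← deriv_deriv_randers_sq (g.symm p) u v (g.pos p y hy)]
  simp only [fundamentalTensor, randers]

theorem isFinslerMetric_randers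
    (hQ : ContMDiff (𝓡 n) (𝓡 n).tangent ∞ (fun q => (⟨q, Q q⟩ : TangentBundle (𝓡 n) M)))
    (hs : ∀ p, g.inner p (Q p) (Q p) < 1) : IsFinslerMetric (randers g Q) where
  nonneg v := by
    by_cases hv : v.2 = 0
    · simp only [randers, hv, map_zero, Real.sqrt_zero, add_zero, le_refl]
    · exact (randers_pos (g.symm v.1) (g.pos v.1) (hs v.1) hv).le
  smooth := by
    -- The identity of the tangent bundle is the tautological field along the projection, so
    -- `contMDiff_inner` yields smoothness of `v ↦ g(v,v)`.
    have hid : ContMDiffOn (𝓡 n).tangent (𝓡 n).tangent ∞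
        (fun v : TangentBundle (𝓡 n) M => (⟨v.1, v.2⟩ : TangentBundle (𝓡 n) M)) {v | v.2 ≠ 0} :=
      contMDiffOn_id
    have hQ' : ContMDiffOn (𝓡 n).tangent (𝓡 n).tangent ∞
        (fun v : TangentBundle (𝓡 n) M => (⟨v.1, Q v.1⟩ : TangentBundle (𝓡 n) M)) {v | v.2 ≠ 0} :=
      (hQ.comp (Bundle.contMDiff_proj (TangentSpace (𝓡 n)))).contMDiffOn
    have h1 := contMDiff_inner g hid hid
    have h2 := contMDiff_inner g hQ' hid
    have h3 : ContMDiffOn (𝓡 n).tangent 𝓘(ℝ, ℝ) ∞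
        (fun v : TangentBundle (𝓡 n) M => √(g.inner v.1 v.2 v.2)) {v | v.2 ≠ 0} := fun v hv =>
      (Real.contDiffAt_sqrt (g.pos v.1 v.2 hv).ne').contMDiffAt.comp_contMDiffWithinAt v (h1 v hv)
    exact h3.add h2
  homogeneous p y c hc := by
    simp only [randers, map_smul, smul_apply, smul_eq_mul]
    rw [← mul_assoc, Real.sqrt_mul (mul_self_nonneg c), Real.sqrt_mul_self hc.le]
    ring
  posDef p y hy u hu := by
    rw [fundamentalTensor_randers g Q p hy]
    exact randersTensor_pos (g.symm p) (g.pos p) hy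
      (randers_pos (g.symm p) (g.pos p) (hs p) hy) hu

/-- The two orthogonality hypotheses stand for the skewness of `R(u,y)` and for `R(u,y)Q = 0`; for
left-invariant data `flagCurvature_leftInv` verifies them. -/
theorem flagCurvature_randers
    (hQ : ContMDiff (𝓡 n) (𝓡 n).tangent ∞ (fun q => (⟨q, Q q⟩ : TangentBundle (𝓡 n) M)))
    (hp : IsParallel g Q) (hs : ∀ p, g.inner p (Q p) (Q p) < 1) (p : M)
    {y u : TangentSpace (𝓡 n) p} (hy : y ≠ 0)
    (h1 : g.inner p y (riemCurvature g p u y y) = 0)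
    (h2 : g.inner p (Q p) (riemCurvature g p u y y) = 0) :
    flagCurvature (randers g Q) p y u = g.inner p (riemCurvature g p u y y) u /
      (gram g p y u * (1 + g.inner p (Q p) y / gNorm g p y) ^ 2) := by
  rw [flagCurvature, chernCurvature_randers hQ hp hs p hy]
  simp only [fundamentalTensor_randers g Q p hy]
  exact randersTensor_flag (g.pos p y hy) (randers_pos (g.symm p) (g.pos p) (hs p) hy) h1 h2

end LeviCivita

/-! ### Left-invariant fields and metrics on a Lie group. -/

section LeftInvariant

variable {n : ℕ} {G : Type*} [TopologicalSpace G] [ChartedSpace (Coord n) G] [Group G]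

lemma leftInv_add (u v : GroupLieAlgebra (𝓡 n) G) (a : G) :
    leftInv (u + v) a = leftInv u a + leftInv v a :=
  congrFun (mulInvariantVectorField_add u v) a

lemma leftInv_smul (c : ℝ) (u : GroupLieAlgebra (𝓡 n) G) (a : G) :
    leftInv (c • u) a = c • leftInv u a :=
  congrFun (mulInvariantVectorField_smul c u) a

/-- Left translation of the Lie algebra as a linear map. -/
def leftInvLinear (a : G) : GroupLieAlgebra (𝓡 n) G →ₗ[ℝ] TangentSpace (𝓡 n) a where
  toFun u := leftInv u a
  map_add' u v := leftInv_add u v a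
  map_smul' c u := leftInv_smul c u a

lemma leftInv_sum {ι : Type*} [Fintype ι] (r : ι → ℝ) (v : ι → GroupLieAlgebra (𝓡 n) G) (a : G) :
    leftInv (∑ i, r i • v i) a = ∑ i, r i • leftInv (v i) a := by
  have := map_sum (leftInvLinear a) (fun i => r i • v i) Finset.univ
  simp only [map_smul] at this
  exact this

variable [LieGroup (𝓡 n) ∞ G]

lemma lieGroup_three : LieGroup (𝓡 n) (minSmoothness ℝ 3) G :=
  LieGroup.of_le (n := ∞) (by rw [minSmoothness_of_isRCLikeNormedField]; exact ENat.LEInfty.out)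

/-- Left-invariant vector fields on a smooth Lie group are smooth. -/
theorem contMDiff_leftInv (v : GroupLieAlgebra (𝓡 n) G) :
    ContMDiff (𝓡 n) (𝓡 n).tangent ∞ (fun a => (⟨a, leftInv v a⟩ : TangentBundle (𝓡 n) G)) := by
  -- The field is `a ↦ Tμ(0_a, v)`, where `μ` is the multiplication of `G` and `v` is tangent at the
  -- identity: a composite of smooth maps.
  let fg : G → TangentBundle (𝓡 n) G := fun a => Bundle.TotalSpace.mk' (Coord n) a 0
  have sfg : ContMDiff (𝓡 n) (𝓡 n).tangent ∞ fg := Bundle.contMDiff_zeroSection _ _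
  let fv : G → TangentBundle (𝓡 n) G := fun _ => Bundle.TotalSpace.mk' (Coord n) 1 v
  have sfv : ContMDiff (𝓡 n) (𝓡 n).tangent ∞ fv := contMDiff_const
  let F₁ : G → (TangentBundle (𝓡 n) G × TangentBundle (𝓡 n) G) := fun a => (fg a, fv a)
  have S₁ : ContMDiff (𝓡 n) ((𝓡 n).tangent.prod (𝓡 n).tangent) ∞ F₁ := sfg.prodMk sfv
  let F₂ : (TangentBundle (𝓡 n) G × TangentBundle (𝓡 n) G) →
      TangentBundle ((𝓡 n).prod (𝓡 n)) (G × G) := (equivTangentBundleProd (𝓡 n) G (𝓡 n) G).symm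
  have S₂ : ContMDiff ((𝓡 n).tangent.prod (𝓡 n).tangent) ((𝓡 n).prod (𝓡 n)).tangent ∞ F₂ :=
    contMDiff_equivTangentBundleProd_symm
  let F₃ : TangentBundle ((𝓡 n).prod (𝓡 n)) (G × G) → TangentBundle (𝓡 n) G :=
    tangentMap ((𝓡 n).prod (𝓡 n)) (𝓡 n) (fun p : G × G => p.1 * p.2)
  have S₃ : ContMDiff ((𝓡 n).prod (𝓡 n)).tangent (𝓡 n).tangent ∞ F₃ :=
    (contMDiff_mul (𝓡 n) ∞).contMDiff_tangentMap (m := ∞) (by simp)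
  convert! (S₃.comp S₂).comp S₁ with a
  · simp [F₁, F₂, F₃, fg, fv]
  · simp only [Function.comp_apply, tangentMap, F₃, F₂, F₁, fg, fv]
    rw [mfderiv_prod_eq_add_apply ((contMDiff_mul (𝓡 n) ∞).mdifferentiableAt (by simp))]
    exact ((congrArg₂ (· + ·) (map_zero _) rfl).trans (zero_add _)).symm

lemma leftInv_bracket (u v : GroupLieAlgebra (𝓡 n) G) :
    VectorField.mlieBracket (𝓡 n) (leftInv u) (leftInv v) = leftInv ⁅u, v⁆ := by
  have : LieGroup (𝓡 n) (minSmoothness ℝ 3) G := lieGroup_three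
  exact (mulInvariantVector_mlieBracket u v).symm

variable {g : RiemMetric n G}

lemma inner_leftInv (hg : IsLeftInvariantMetric g) (a : G) (u v : GroupLieAlgebra (𝓡 n) G) :
    g.inner a (leftInv u a) (leftInv v a) = g.inner 1 u v := by
  have h : ∀ b : G, a * 1 = b →
      g.inner b (mfderiv (𝓡 n) (𝓡 n) (a * ·) 1 u : Coord n)
        (mfderiv (𝓡 n) (𝓡 n) (a * ·) 1 v : Coord n) = g.inner 1 u v := by
    rintro b rfl
    exact hg a 1 u v
  exact h a (mul_one a)

lemma leftInv_injective (hg : IsLeftInvariantMetric g) (a : G) :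
    Function.Injective (leftInvLinear (n := n) a) := by
  rw [injective_iff_map_eq_zero]
  intro u hu
  by_contra h
  have h1 := inner_leftInv hg a u u
  rw [show leftInv u a = 0 from hu, map_zero] at h1
  exact (g.pos 1 u h).ne h1

lemma leftInv_surjective (hg : IsLeftInvariantMetric g) (a : G) (v : TangentSpace (𝓡 n) a) :
    ∃ u : GroupLieAlgebra (𝓡 n) G, leftInv u a = v := by
  let φ : Coord n →ₗ[ℝ] Coord n := leftInvLinear (n := n) a
  have hφ : Function.Injective φ := leftInv_injective hg a
  exact LinearMap.surjective_of_injective hφ v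

/-- The chain rule for `L_a ∘ L_b = L_ab` at the identity. -/
lemma mfderiv_mul_left_leftInv (a b : G) (u : GroupLieAlgebra (𝓡 n) G) :
    mfderiv (𝓡 n) (𝓡 n) (a * ·) b (leftInv u b) = (leftInv u (a * b) : TangentSpace (𝓡 n) (a * b))
    := by
  have h1 : ∀ c : G, MDifferentiableAt (𝓡 n) (𝓡 n) (a * ·) c := fun c =>
    (contMDiff_mul_left (I := 𝓡 n) (n := ∞)).mdifferentiableAt (by simp)
  have h2 : MDifferentiableAt (𝓡 n) (𝓡 n) (b * ·) 1 :=
    (contMDiff_mul_left (I := 𝓡 n) (n := ∞)).mdifferentiableAt (by simp)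
  have h3 := mfderiv_comp (I' := 𝓡 n) (1 : G) (h1 (b * 1)) h2
  have h4 : ((a * ·) ∘ (b * ·) : G → G) = (a * b * ·) := by
    ext c; simp [mul_assoc]
  have h5 : ∀ c : G, b * 1 = c → mfderiv (𝓡 n) (𝓡 n) (a * ·) c (leftInv u b : Coord n)
      = (mfderiv (𝓡 n) (𝓡 n) (a * b * ·) 1 u : Coord n) := by
    rintro c rfl
    rw [← h4, h3]
    rfl
  exact h5 b (mul_one b)

lemma isLeftInvariantFinsler_randers (hg : IsLeftInvariantMetric g)
    (q : GroupLieAlgebra (𝓡 n) G) : IsLeftInvariantFinsler (randers g (leftInv q)) := by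
  intro a b y
  simp only [randers]
  rw [← mfderiv_mul_left_leftInv, hg, hg]

end LeftInvariant

/-! ### Left-invariant orthonormal frames in charts. -/

section InvariantFrame

variable {n : ℕ} {G : Type*} [TopologicalSpace G] [ChartedSpace (Coord n) G] [Group G]
  {ι : Type*} [Fintype ι]

/-- The structure constants of the Lie algebra in a basis. -/
def structureConst (e : Module.Basis ι ℝ (GroupLieAlgebra (𝓡 n) G)) (a b d : ι) : ℝ :=
  e.repr ⁅e a, e b⁆ d

lemma fieldComponents_sum [IsManifold (𝓡 n) 1 G] (r : ι → ℝ)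
    (v : ι → GroupLieAlgebra (𝓡 n) G) (p : G) (x : Coord n) :
    fieldComponents (leftInv (∑ i, r i • v i)) p x = ∑ i, r i • fieldComponents (leftInv (v i)) p x
    := by
  simp only [fieldComponents, leftInv_sum]
  have := map_sum (mfderiv (𝓡 n) (𝓡 n) (extChartAt (𝓡 n) p) ((extChartAt (𝓡 n) p).symm x))
    (fun i => r i • leftInv (v i) ((extChartAt (𝓡 n) p).symm x)) Finset.univ
  simp only [map_smul] at this
  exact this

variable [LieGroup (𝓡 n) ∞ G] {g : RiemMetric n G}
  {e : Module.Basis ι ℝ (GroupLieAlgebra (𝓡 n) G)}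

/-- The component field is the pullback under the inverse chart, and pullback commutes with Lie
brackets. -/
lemma lieBracket_fieldComponents (p : G) {x : Coord n} (hx : x ∈ (extChartAt (𝓡 n) p).target)
    (u v : GroupLieAlgebra (𝓡 n) G) :
    VectorField.lieBracket ℝ (fieldComponents (leftInv u) p) (fieldComponents (leftInv v) p) x
      = fieldComponents (leftInv ⁅u, v⁆) p x := by
  have hT := (isOpen_extChartAt_target (I := 𝓡 n) p).mem_nhds hx
  have hmd : ∀ w : GroupLieAlgebra (𝓡 n) G, MDifferentiableAt (𝓡 n) (𝓡 n).tangent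
      (fun a => (⟨a, leftInv w a⟩ : TangentBundle (𝓡 n) G)) ((extChartAt (𝓡 n) p).symm x) :=
    fun w => (contMDiff_leftInv w).mdifferentiableAt (by simp)
  have hf : ContMDiffAt 𝓘(ℝ, Coord n) (𝓡 n) ∞ (extChartAt (𝓡 n) p).symm x :=
    (contMDiffOn_extChartAt_symm (I := 𝓡 n) (n := ∞) p).contMDiffAt hT
  have : IsManifold (𝓡 n) (minSmoothness ℝ 2) G := IsManifold.of_le (n := ∞)
    (by rw [minSmoothness_of_isRCLikeNormedField]; exact ENat.LEInfty.out)
  have h1 := VectorField.mpullback_mlieBracket (hmd u) (hmd v) hf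
    (by rw [minSmoothness_of_isRCLikeNormedField]; exact ENat.LEInfty.out)
  have h2 : ∀ w : GroupLieAlgebra (𝓡 n) G,
      (VectorField.mpullback 𝓘(ℝ, Coord n) (𝓡 n) (extChartAt (𝓡 n) p).symm (leftInv w)
        : Coord n → Coord n) =ᶠ[nhds x] fieldComponents (leftInv w) p := by
    intro w
    filter_upwards [hT] with x' hx'
    exact inverse_mfderiv_symm p hx' _
  rw [leftInv_bracket, ← VectorField.mlieBracketWithin_univ,
    VectorField.mlieBracketWithin_eq_lieBracketWithin] at h1
  rw [← (h2 _).eq_of_nhds]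
  refine Eq.trans ?_ (h1.trans (congrFun VectorField.lieBracketWithin_univ x)).symm
  exact (Filter.EventuallyEq.lieBracket_vectorField_eq (h2 u) (h2 v)).symm

/-- An orthonormal basis of the Lie algebra induces orthonormal frames in the charts. -/
lemma isOrthonormalFrame [DecidableEq ι] (hg : IsLeftInvariantMetric g)
    (he : ∀ i j, g.inner 1 (e i) (e j) = if i = j then 1 else 0) (p : G) :
    IsOrthonormalFrame (extChartAt (𝓡 n) p).target (metricForm g p)
      (fun a => fieldComponents (leftInv (e a)) p) (structureConst e) where
  smooth a := contDiffOn_components p (contMDiff_leftInv (e a))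
  inner x hx a b := by
    simp only [fieldComponents]
    rw [metricForm_components g p hx, inner_leftInv hg, he]
  span x hx v := by
    obtain ⟨w, hw⟩ := leftInv_surjective hg ((extChartAt (𝓡 n) p).symm x) (chartVec p x v)
    have hv : v = fieldComponents (leftInv w) p x := by
      rw [fieldComponents, hw, components_chartVec p hx]
    have hin : ∀ a, metricForm g p x (fieldComponents (leftInv (e a)) p x) v = e.repr w a := by
      intro a
      rw [hv, fieldComponents, fieldComponents, metricForm_components g p hx, inner_leftInv hg]
      conv_lhs => rw [← e.sum_repr w]
      rw [map_sum]
      simp only [map_smul, he, smul_eq_mul]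
      simp
    simp only [hin]
    rw [← fieldComponents_sum, e.sum_repr]
    exact hv
  bracket x hx a b := by
    have h := lieBracket_fieldComponents p hx (e a) (e b)
    rw [← e.sum_repr ⁅e a, e b⁆, fieldComponents_sum] at h
    exact h

end InvariantFrame

/-! ### Curvature of a left-invariant metric from the structure constants. -/

section InvariantCurvature

variable {n : ℕ}

lemma isLinearMap_sum {V W ι : Type*} [AddCommGroup V] [Module ℝ V] [AddCommGroup W] [Module ℝ W]
    [Fintype ι] {f : V → W} (hf : IsLinearMap ℝ f) (r : ι → ℝ) (v : ι → V) :
    f (∑ a, r a • v a) = ∑ a, r a • f (v a) := by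
  have := map_sum hf.mk' (fun a => r a • v a) Finset.univ
  simp only [map_smul] at this
  exact this

lemma curvatureMap_sum {ι : Type*} [Fintype ι]
    (Γ : Coord n → Coord n →L[ℝ] Coord n →L[ℝ] Coord n) (x : Coord n) (E : ι → Coord n)
    (r s t : ι → ℝ) :
    curvatureMap Γ x (∑ a, r a • E a) (∑ a, s a • E a) (∑ a, t a • E a)
      = ∑ a, r a • ∑ b, s b • ∑ c, t c • curvatureMap Γ x (E a) (E b) (E c) := by
  have h1 : ∀ v z, IsLinearMap ℝ fun u => curvatureMap Γ x u v z := fun v z =>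
    ⟨fun u u' => by simp only [curvatureMap, map_add, add_apply]; abel,
      fun c u => by simp only [curvatureMap, map_smul, smul_apply, smul_sub, smul_add]⟩
  have h2 : ∀ u z, IsLinearMap ℝ fun v => curvatureMap Γ x u v z := fun u z =>
    ⟨fun v v' => by simp only [curvatureMap, map_add, add_apply]; abel,
      fun c v => by simp only [curvatureMap, map_smul, smul_apply, smul_sub, smul_add]⟩
  have h3 : ∀ u v, IsLinearMap ℝ fun z => curvatureMap Γ x u v z := fun u v =>
    ⟨fun z z' => by simp only [curvatureMap, map_add]; abel,
      fun c z => by simp only [curvatureMap, map_smul, smul_sub, smul_add]⟩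
  rw [isLinearMap_sum (h1 _ _)]
  simp only [isLinearMap_sum (h2 _ _), isLinearMap_sum (h3 _ _)]

lemma connCoeff_skew {ι : Type*} {k : ι → ι → ι → ℝ} (hk : ∀ a b d, k a b d = -k b a d) (a b d : ι) :
    connCoeff k a b d = -connCoeff k a d b := by
  rw [connCoeff, connCoeff, hk a d b, hk d b a, hk b a d]
  ring

section Algebra

variable {ι : Type*} [Fintype ι]

/-- The bilinear operation with coefficients `c`. -/
def bilinearOp (c : ι → ι → ι → ℝ) (r s : ι → ℝ) (d : ι) : ℝ := ∑ a, ∑ b, r a * s b * c a b d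

/-- The curvature `R(r, s) t = ∇ᵣ∇ₛt - ∇ₛ∇ᵣt - ∇_[r,s] t` of the Lie algebra with structure constants
`k` and the inner product in which the basis is orthonormal. -/
def algebraCurvature (k : ι → ι → ι → ℝ) (r s t : ι → ℝ) (f : ι) : ℝ :=
  bilinearOp (connCoeff k) r (bilinearOp (connCoeff k) s t) f
    - bilinearOp (connCoeff k) s (bilinearOp (connCoeff k) r t) f
    - bilinearOp (connCoeff k) (bilinearOp k r s) t f

lemma sum_rotate {F : ι → ι → ι → ℝ} : ∑ b, ∑ c, ∑ e, F b c e = ∑ e, ∑ b, ∑ c, F b c e := by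
  rw [Finset.sum_comm]
  conv_rhs => rw [Finset.sum_comm]; enter [2, b]; rw [Finset.sum_comm]
  rw [Finset.sum_comm]

/-- Regrouping the sums into iterated bilinear operations lets the curvature be evaluated from a
closed formula for `∇` and the bracket. -/
lemma sum_frameCurvature (k : ι → ι → ι → ℝ) (r s t : ι → ℝ) (f : ι) :
    ∑ a, r a * ∑ b, s b * ∑ c, t c * frameCurvature k a b c f = algebraCurvature k r s t f := by
  have e1 : bilinearOp (connCoeff k) r (bilinearOp (connCoeff k) s t) f
      = ∑ a, ∑ b, ∑ c, ∑ e, r a * s b * t c * (connCoeff k b c e * connCoeff k a e f) := by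
    simp only [bilinearOp, Finset.mul_sum, Finset.sum_mul]
    refine Finset.sum_congr rfl fun a _ => Eq.trans ?_ sum_rotate.symm
    exact Finset.sum_congr rfl fun e _ => Finset.sum_congr rfl fun b _ =>
      Finset.sum_congr rfl fun c _ => by ring
  have e2 : bilinearOp (connCoeff k) s (bilinearOp (connCoeff k) r t) f
      = ∑ a, ∑ b, ∑ c, ∑ e, r a * s b * t c * (connCoeff k a c e * connCoeff k b e f) := by
    simp only [bilinearOp, Finset.mul_sum, Finset.sum_mul]
    conv_rhs => rw [Finset.sum_comm]
    refine Finset.sum_congr rfl fun a _ => Eq.trans ?_ sum_rotate.symm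
    exact Finset.sum_congr rfl fun e _ => Finset.sum_congr rfl fun b _ =>
      Finset.sum_congr rfl fun c _ => by ring
  have e3 : bilinearOp (connCoeff k) (bilinearOp k r s) t f
      = ∑ a, ∑ b, ∑ c, ∑ e, r a * s b * t c * (k a b e * connCoeff k e c f) := by
    simp only [bilinearOp, Finset.sum_mul]
    have : ∀ a b, ∑ c, ∑ e, r a * s b * t c * (k a b e * connCoeff k e c f)
        = ∑ e, ∑ c, r a * s b * t c * (k a b e * connCoeff k e c f) :=
      fun a b => Finset.sum_comm
    simp only [this]
    rw [sum_rotate]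
    refine Finset.sum_congr rfl fun e _ => ?_
    rw [sum_rotate]
    exact Finset.sum_congr rfl fun b _ => Finset.sum_congr rfl fun c _ =>
      Finset.sum_congr rfl fun a _ => by ring
  rw [algebraCurvature, e1, e2, e3]
  simp only [← Finset.sum_sub_distrib, frameCurvature, Finset.mul_sum]
  exact Finset.sum_congr rfl fun a _ => Finset.sum_congr rfl fun b _ =>
    Finset.sum_congr rfl fun c _ => Finset.sum_congr rfl fun e _ => by ring

/-- `⟨R(r, s) t, z⟩ = -⟨t, R(r, s) z⟩`. -/
lemma algebraCurvature_skew {k : ι → ι → ι → ℝ} (hk : ∀ a b d, k a b d = -k b a d)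
    (r s t z : ι → ℝ) : ∑ f, algebraCurvature k r s t f * z f
      = -∑ f, algebraCurvature k r s z f * t f := by
  -- Each `∇_v` is a skew operator; commutators and linear combinations of such operators are again
  -- skew.
  have h1 : ∀ (v t z : ι → ℝ), ∑ f, bilinearOp (connCoeff k) v t f * z f
      = -∑ f, bilinearOp (connCoeff k) v z f * t f := by
    intro v t z
    simp only [bilinearOp, Finset.sum_mul]
    rw [sum_rotate.symm, sum_rotate.symm, ← Finset.sum_neg_distrib]
    refine Finset.sum_congr rfl fun a _ => ?_
    rw [Finset.sum_comm, ← Finset.sum_neg_distrib]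
    refine Finset.sum_congr rfl fun b _ => ?_
    rw [← Finset.sum_neg_distrib]
    refine Finset.sum_congr rfl fun c _ => ?_
    rw [connCoeff_skew hk]
    ring
  simp only [algebraCurvature, sub_mul, Finset.sum_sub_distrib]
  rw [h1 r _ z, h1 s _ z, h1 _ t z]
  have h2 : ∀ v w : ι → ℝ, ∑ f, v f * w f = ∑ f, w f * v f := fun v w =>
    Finset.sum_congr rfl fun f _ => mul_comm _ _
  rw [h2 (bilinearOp (connCoeff k) r z), h2 (bilinearOp (connCoeff k) s z), h1 s t, h1 r t]
  ring

lemma algebraCurvature_parallel {k : ι → ι → ι → ℝ} {q : ι → ℝ}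
    (hq : ∀ a d, ∑ b, q b * connCoeff k a b d = 0) (r s : ι → ℝ) (f : ι) :
    algebraCurvature k r s q f = 0 := by
  have h1 : ∀ v, bilinearOp (connCoeff k) v q = 0 := by
    intro v
    funext d
    simp only [bilinearOp, mul_assoc, ← Finset.mul_sum, hq, mul_zero, Finset.sum_const_zero]
    rfl
  have h2 : ∀ v, bilinearOp (connCoeff k) v 0 = 0 := fun v => by
    funext d
    simp [bilinearOp]
  simp [algebraCurvature, h1, h2]

end Algebra

variable {G : Type*} [TopologicalSpace G] [ChartedSpace (Coord n) G] [Group G]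

lemma fieldComponents_self [IsManifold (𝓡 n) 1 G] (u : GroupLieAlgebra (𝓡 n) G) (p : G) :
    fieldComponents (leftInv u) p (extChartAt (𝓡 n) p p) = components p p (leftInv u p) :=
  congrArg (fun q => components p q (leftInv u q)) (extChartAt_to_inv p)

variable [LieGroup (𝓡 n) ∞ G]

lemma structureConst_antisymm {ι : Type*} {e : Module.Basis ι ℝ (GroupLieAlgebra (𝓡 n) G)}
    (a b d : ι) : structureConst e a b d = -structureConst e b a d := by
  have : LieGroup (𝓡 n) (minSmoothness ℝ 3) G := lieGroup_three
  rw [structureConst, structureConst, ← lie_skew, map_neg]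
  rfl

variable {ι : Type*} [Fintype ι] {g : RiemMetric n G}
  {e : Module.Basis ι ℝ (GroupLieAlgebra (𝓡 n) G)}

lemma fieldComponents_eq_sum (u : GroupLieAlgebra (𝓡 n) G) (p : G) :
    fieldComponents (leftInv u) p
      = fun x => ∑ a, e.repr u a • fieldComponents (leftInv (e a)) p x := by
  funext x
  rw [← fieldComponents_sum, e.sum_repr]

variable [DecidableEq ι]

/-- The condition on the right does not involve the point, so a single point suffices for one
direction, while the other holds in every chart. -/
lemma isParallel_leftInv_iff (hg : IsLeftInvariantMetric g)
    (he : ∀ i j, g.inner 1 (e i) (e j) = if i = j then 1 else 0) (q : GroupLieAlgebra (𝓡 n) G) :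
    IsParallel g (leftInv q) ↔
      ∀ a d, ∑ b, e.repr q b * connCoeff (structureConst e) a b d = 0 := by
  rw [isParallel_iff (contMDiff_leftInv q)]
  simp only [fieldComponents_eq_sum (e := e) q]
  constructor
  · intro h
    have hx := mem_extChartAt_target (I := 𝓡 n) (1 : G)
    exact ((isOrthonormalFrame hg he 1).parallel_iff (isRiemannianFamily_metricForm g 1) hx
      (e.repr q)).1 (h 1 _ hx)
  · intro h p x hx
    exact ((isOrthonormalFrame hg he p).parallel_iff (isRiemannianFamily_metricForm g p) hx
      (e.repr q)).2 h

lemma inner_riemCurvature (hg : IsLeftInvariantMetric g)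
    (he : ∀ i j, g.inner 1 (e i) (e j) = if i = j then 1 else 0) (p : G)
    (u v w z : GroupLieAlgebra (𝓡 n) G) :
    g.inner p (riemCurvature g p (leftInv u p) (leftInv v p) (leftInv w p)) (leftInv z p)
      = ∑ f, algebraCurvature (structureConst e) (e.repr u) (e.repr v) (e.repr w) f
        * e.repr z f := by
  have hE := isOrthonormalFrame hg he p
  have hA := isRiemannianFamily_metricForm g p
  have hx := mem_extChartAt_target (I := 𝓡 n) p
  rw [← metricForm_components_self, riemCurvature_eq, components_ofComponents]
  have hc : ∀ u : GroupLieAlgebra (𝓡 n) G, components p p (leftInv u p) = ∑ a, e.repr u a •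
      fieldComponents (leftInv (e a)) p (extChartAt (𝓡 n) p p) := fun u => by
    rw [← fieldComponents_self]
    exact congrFun (fieldComponents_eq_sum u p) _
  simp only [hc]
  rw [curvatureMap_sum]
  simp only [hE.curvature hA hx]
  rw [map_sum]
  refine Finset.sum_congr rfl fun f _ => ?_
  rw [map_smul, smul_eq_mul, mul_comm]
  congr 1
  have h : ∀ (r : ι → ℝ) (c : ι → ι → ℝ), ∑ a, r a • ∑ f, c a f •
      fieldComponents (leftInv (e f)) p (extChartAt (𝓡 n) p p) = ∑ f, (∑ a, r a * c a f) •
      fieldComponents (leftInv (e f)) p (extChartAt (𝓡 n) p p) := by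
    intro r c
    simp only [Finset.smul_sum, Finset.sum_smul, smul_smul]
    exact Finset.sum_comm
  simp only [h]
  rw [hE.inner_sum hx, sum_frameCurvature]

/-- The flag curvature of a Randers metric with parallel left-invariant field. -/
theorem flagCurvature_leftInv (hg : IsLeftInvariantMetric g)
    (he : ∀ i j, g.inner 1 (e i) (e j) = if i = j then 1 else 0) {q : GroupLieAlgebra (𝓡 n) G}
    (hq : IsParallel g (leftInv q)) (hs : g.inner 1 q q < 1) (p : G)
    {y u : TangentSpace (𝓡 n) p} (hy : y ≠ 0) :
    flagCurvature (randers g (leftInv q)) p y u = g.inner p (riemCurvature g p u y y) u /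
      (gram g p y u * (1 + g.inner p (leftInv q p) y / gNorm g p y) ^ 2) := by
  obtain ⟨y, rfl⟩ := leftInv_surjective hg p y
  obtain ⟨u, rfl⟩ := leftInv_surjective hg p u
  refine flagCurvature_randers (contMDiff_leftInv q) hq
    (fun p => by rw [inner_leftInv hg]; exact hs) p hy ?_ ?_
  -- Skewness with both arguments equal to `y` shows that the pairing is its own negative.
  · rw [g.symm, inner_riemCurvature hg he]
    have := algebraCurvature_skew (structureConst_antisymm (e := e)) (e.repr u) (e.repr y)
      (e.repr y) (e.repr y)
    linarith
  -- Skewness moves `R(u,y)` onto `q`, where it vanishes.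
  · rw [g.symm, inner_riemCurvature hg he, algebraCurvature_skew structureConst_antisymm]
    simp [algebraCurvature_parallel ((isParallel_leftInv_iff hg he q).1 hq)]

end InvariantCurvature

/-! ### Explicit connections, parallel vectors and curvatures in dimension four. -/

section DimensionFour

/-- Structure constants, from the coordinates of the six brackets of basis vectors. -/
def bracketTable (b01 b02 b03 b12 b13 b23 : Fin 4 → ℝ) : Fin 4 → Fin 4 → Fin 4 → ℝ :=
  ![![0, b01, b02, b03], ![-b01, 0, b12, b13], ![-b02, -b12, 0, b23], ![-b03, -b13, -b23, 0]]

/-- The numerator of the sectional curvature of the plane spanned by `y` and `u`. -/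
def sectionalNumerator (k : Fin 4 → Fin 4 → Fin 4 → ℝ) (y u : Fin 4 → ℝ) : ℝ :=
  ∑ f, algebraCurvature k u y y f * u f

/-- Parallelism in the form `∇_r q = 0` for every `r`, to which the closed formulas for `∇` apply; a
few basis vectors `r` then extract all the equations on `q`. -/
lemma forall_sum_connCoeff_iff (k : Fin 4 → Fin 4 → Fin 4 → ℝ) (q : Fin 4 → ℝ) :
    (∀ a d, ∑ b, q b * connCoeff k a b d = 0) ↔ ∀ r, bilinearOp (connCoeff k) r q = 0 := by
  constructor
  · intro h r
    funext d
    simp only [bilinearOp, mul_assoc, ← Finset.mul_sum, h, mul_zero, Finset.sum_const_zero]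
    rfl
  · intro h a d
    have := congrFun (h (Pi.single a 1)) d
    simpa [bilinearOp, Pi.single_apply, mul_assoc, ← Finset.mul_sum] using this

/-! The Levi-Civita connections and the curvatures of the five algebras. -/

/-- `[X,Y] = Y`, `[X,W] = W`. -/
def table1 : Fin 4 → Fin 4 → Fin 4 → ℝ := bracketTable ![0, 1, 0, 0] 0 ![0, 0, 0, 1] 0 0 0

/-- `[X,Y] = Z`. -/
def table2 : Fin 4 → Fin 4 → Fin 4 → ℝ := bracketTable ![0, 0, 1, 0] 0 0 0 0 0

/-- `[X,Y] = X`. -/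
def table3 : Fin 4 → Fin 4 → Fin 4 → ℝ := bracketTable ![1, 0, 0, 0] 0 0 0 0 0

/-- `[X,Z] = X`, `[X,W] = Y`, `[Y,Z] = Y`, `[Y,W] = αX + βY`. -/
def table4 (α β : ℝ) : Fin 4 → Fin 4 → Fin 4 → ℝ :=
  bracketTable 0 ![1, 0, 0, 0] ![0, 1, 0, 0] ![0, 1, 0, 0] ![α, β, 0, 0] 0

/-- `[X,Y] = W`, `[X,W] = -Y`, `[Y,W] = -X`. -/
def table6 : Fin 4 → Fin 4 → Fin 4 → ℝ :=
  bracketTable ![0, 0, 0, 1] 0 ![0, -1, 0, 0] 0 ![-1, 0, 0, 0] 0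

lemma nabla_table1 (r s : Fin 4 → ℝ) : bilinearOp (connCoeff table1) r s
    = ![r 1 * s 1 + r 3 * s 3, -(r 1 * s 0), 0, -(r 3 * s 0)] := by
  funext d
  fin_cases d <;> simp [bilinearOp, connCoeff, table1, bracketTable, Fin.sum_univ_four] <;> ring

lemma bracket_table1 (r s : Fin 4 → ℝ) : bilinearOp table1 r s
    = ![0, r 0 * s 1 - r 1 * s 0, 0, r 0 * s 3 - r 3 * s 0] := by
  funext d
  fin_cases d <;> simp [bilinearOp, table1, bracketTable, Fin.sum_univ_four] <;> ring

lemma sectionalNumerator_table1 (a b : Fin 4 → ℝ) : sectionalNumerator table1 a b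
    = -((a 0 * b 1 - a 1 * b 0) ^ 2 + (a 0 * b 3 - a 3 * b 0) ^ 2
      + (a 1 * b 3 - a 3 * b 1) ^ 2) := by
  simp [sectionalNumerator, algebraCurvature, nabla_table1, bracket_table1, Fin.sum_univ_four]
  ring

lemma parallel_table1 (q : Fin 4 → ℝ) : (∀ a d, ∑ b, q b * connCoeff table1 a b d = 0) ↔
    q 0 = 0 ∧ q 1 = 0 ∧ q 3 = 0 := by
  rw [forall_sum_connCoeff_iff]
  simp only [nabla_table1]
  constructor
  · intro h
    have h1 := h ![0, 1, 0, 0]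
    have h3 := h ![0, 0, 0, 1]
    have e0 := congrFun h1 0
    have e1 := congrFun h1 1
    have e3 := congrFun h3 0
    simp at e0 e1 e3
    exact ⟨e1, e0, e3⟩
  · rintro ⟨h0, h1, h3⟩ r
    funext d
    fin_cases d <;> simp [h0, h1, h3]

lemma nabla_table2 (r s : Fin 4 → ℝ) : bilinearOp (connCoeff table2) r s
    = ![(r 1 * s 2 + r 2 * s 1) / 2, -(r 0 * s 2 + r 2 * s 0) / 2,
      (r 0 * s 1 - r 1 * s 0) / 2, 0] := by
  funext d
  fin_cases d <;> simp [bilinearOp, connCoeff, table2, bracketTable, Fin.sum_univ_four] <;> ring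

lemma bracket_table2 (r s : Fin 4 → ℝ) : bilinearOp table2 r s
    = ![0, 0, r 0 * s 1 - r 1 * s 0, 0] := by
  funext d
  fin_cases d <;> simp [bilinearOp, table2, bracketTable, Fin.sum_univ_four] <;> ring

lemma sectionalNumerator_table2 (a b : Fin 4 → ℝ) : sectionalNumerator table2 a b
    = ((a 0 * b 2 - a 2 * b 0) ^ 2 + (a 1 * b 2 - a 2 * b 1) ^ 2
      - 3 * (a 0 * b 1 - a 1 * b 0) ^ 2) / 4 := by
  simp [sectionalNumerator, algebraCurvature, nabla_table2, bracket_table2, Fin.sum_univ_four]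
  ring

lemma parallel_table2 (q : Fin 4 → ℝ) : (∀ a d, ∑ b, q b * connCoeff table2 a b d = 0) ↔
    q 0 = 0 ∧ q 1 = 0 ∧ q 2 = 0 := by
  rw [forall_sum_connCoeff_iff]
  simp only [nabla_table2]
  constructor
  · intro h
    have h1 := h ![1, 0, 0, 0]
    have h3 := h ![0, 1, 0, 0]
    have e0 := congrFun h1 1
    have e1 := congrFun h1 2
    have e3 := congrFun h3 2
    simp at e0 e1 e3
    exact ⟨e3, e1, e0⟩
  · rintro ⟨h0, h1, h3⟩ r
    funext d
    fin_cases d <;> simp [h0, h1, h3]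

lemma nabla_table3 (r s : Fin 4 → ℝ) : bilinearOp (connCoeff table3) r s
    = ![r 0 * s 1, -(r 0 * s 0), 0, 0] := by
  funext d
  fin_cases d <;> simp [bilinearOp, connCoeff, table3, bracketTable, Fin.sum_univ_four] <;> ring

lemma bracket_table3 (r s : Fin 4 → ℝ) : bilinearOp table3 r s
    = ![r 0 * s 1 - r 1 * s 0, 0, 0, 0] := by
  funext d
  fin_cases d <;> simp [bilinearOp, table3, bracketTable, Fin.sum_univ_four] <;> ring

lemma sectionalNumerator_table3 (a b : Fin 4 → ℝ) : sectionalNumerator table3 a b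
    = -(a 0 * b 1 - a 1 * b 0) ^ 2 := by
  simp [sectionalNumerator, algebraCurvature, nabla_table3, bracket_table3, Fin.sum_univ_four]
  ring

lemma parallel_table3 (q : Fin 4 → ℝ) : (∀ a d, ∑ b, q b * connCoeff table3 a b d = 0) ↔
    q 0 = 0 ∧ q 1 = 0 := by
  rw [forall_sum_connCoeff_iff]
  simp only [nabla_table3]
  constructor
  · intro h
    have h1 := h ![1, 0, 0, 0]
    have e0 := congrFun h1 0
    have e1 := congrFun h1 1
    simp at e0 e1
    exact ⟨e1, e0⟩
  · rintro ⟨h0, h1⟩ r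
    funext d
    fin_cases d <;> simp [h0, h1]

lemma nabla_table4 (α β : ℝ) (r s : Fin 4 → ℝ) : bilinearOp (connCoeff (table4 α β)) r s
    = ![r 0 * s 2 + (1 + α) / 2 * r 1 * s 3 + (1 - α) / 2 * r 3 * s 1,
      r 1 * s 2 + (1 + α) / 2 * r 0 * s 3 + β * r 1 * s 3 - (1 - α) / 2 * r 3 * s 0,
      -(r 0 * s 0) - r 1 * s 1,
      -((1 + α) / 2 * (r 0 * s 1 + r 1 * s 0)) - β * r 1 * s 1] := by
  funext d
  fin_cases d <;> simp [bilinearOp, connCoeff, table4, bracketTable, Fin.sum_univ_four] <;> ring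

lemma bracket_table4 (α β : ℝ) (r s : Fin 4 → ℝ) : bilinearOp (table4 α β) r s
    = ![r 0 * s 2 - r 2 * s 0 + α * (r 1 * s 3 - r 3 * s 1),
      r 0 * s 3 - r 3 * s 0 + (r 1 * s 2 - r 2 * s 1) + β * (r 1 * s 3 - r 3 * s 1), 0, 0] := by
  funext d
  fin_cases d <;> simp [bilinearOp, table4, bracketTable, Fin.sum_univ_four] <;> ring

lemma sectionalNumerator_table4 (a b : Fin 4 → ℝ) : sectionalNumerator (table4 (-1) 0) a b
    = -((a 0 * b 1 - a 1 * b 0) ^ 2 + (a 0 * b 2 - a 2 * b 0) ^ 2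
      + (a 1 * b 2 - a 2 * b 1) ^ 2) := by
  simp [sectionalNumerator, algebraCurvature, nabla_table4, bracket_table4, Fin.sum_univ_four]
  ring

lemma parallel_table4 (α β : ℝ) (q : Fin 4 → ℝ) :
    (∀ a d, ∑ b, q b * connCoeff (table4 α β) a b d = 0) ↔
      q 0 = 0 ∧ q 1 = 0 ∧ q 2 = 0 ∧ (1 + α) * q 3 = 0 ∧ β * q 3 = 0 := by
  rw [forall_sum_connCoeff_iff]
  simp only [nabla_table4]
  constructor
  · intro h
    -- The derivatives along `X` and `Y` suffice. Along `X` they give `q 0`, `q 2` and `(1 + α) q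
    -- 3`; along `Y` they give `q 1` and `q 2 + β q 3`.
    have h1 := h ![1, 0, 0, 0]
    have h3 := h ![0, 1, 0, 0]
    have e0 := congrFun h1 2
    have e1 := congrFun h3 2
    have e2 := congrFun h1 0
    have e3 := congrFun h1 1
    have e4 := congrFun h3 1
    simp only [Matrix.cons_val, Pi.zero_apply] at e0 e1 e2 e3 e4
    refine ⟨by linarith, by linarith, by linarith, by linarith, by linarith⟩
  · rintro ⟨h0, h1, h2, h3, h4⟩ r
    funext d
    fin_cases d
    · show r 0 * q 2 + (1 + α) / 2 * r 1 * q 3 + (1 - α) / 2 * r 3 * q 1 = 0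
      linear_combination r 0 * h2 + (r 1 / 2) * h3 + (1 - α) / 2 * r 3 * h1
    · show r 1 * q 2 + (1 + α) / 2 * r 0 * q 3 + β * r 1 * q 3 - (1 - α) / 2 * r 3 * q 0 = 0
      linear_combination r 1 * h2 + (r 0 / 2) * h3 + r 1 * h4 - (1 - α) / 2 * r 3 * h0
    · simp [h0, h1]
    · simp [h0, h1]

lemma nabla_table6 (r s : Fin 4 → ℝ) : bilinearOp (connCoeff table6) r s
    = ![(r 3 * s 1 - r 1 * s 3) / 2, -(3 * r 0 * s 3 + r 3 * s 0) / 2, 0,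
      (3 * r 0 * s 1 + r 1 * s 0) / 2] := by
  funext d
  fin_cases d <;> simp [bilinearOp, connCoeff, table6, bracketTable, Fin.sum_univ_four] <;> ring

lemma bracket_table6 (r s : Fin 4 → ℝ) : bilinearOp table6 r s
    = ![-(r 1 * s 3 - r 3 * s 1), -(r 0 * s 3 - r 3 * s 0), 0, r 0 * s 1 - r 1 * s 0] := by
  funext d
  fin_cases d <;> simp [bilinearOp, table6, bracketTable, Fin.sum_univ_four] <;> ring

lemma sectionalNumerator_table6 (a b : Fin 4 → ℝ) : sectionalNumerator table6 a b
    = ((a 0 * b 1 - a 1 * b 0) ^ 2 + (a 0 * b 3 - a 3 * b 0) ^ 2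
      - 7 * (a 1 * b 3 - a 3 * b 1) ^ 2) / 4 := by
  simp [sectionalNumerator, algebraCurvature, nabla_table6, bracket_table6, Fin.sum_univ_four]
  ring

lemma parallel_table6 (q : Fin 4 → ℝ) : (∀ a d, ∑ b, q b * connCoeff table6 a b d = 0) ↔
    q 0 = 0 ∧ q 1 = 0 ∧ q 3 = 0 := by
  rw [forall_sum_connCoeff_iff]
  simp only [nabla_table6]
  constructor
  · intro h
    have h1 := h ![1, 0, 0, 0]
    have h3 := h ![0, 1, 0, 0]
    have e0 := congrFun h1 1
    have e1 := congrFun h1 3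
    have e3 := congrFun h3 3
    simp at e0 e1 e3
    exact ⟨e3, e1, e0⟩
  · rintro ⟨h0, h1, h3⟩ r
    funext d
    fin_cases d <;> simp [h0, h1, h3]

end DimensionFour

/-! ### Coordinates of Lie algebra elements in the basis. -/

section Coordinates

variable {G : Type*} [TopologicalSpace G] [ChartedSpace (Coord 4) G] [Group G]
  {e : Module.Basis (Fin 4) ℝ (GroupLieAlgebra (𝓡 4) G)}

lemma coe_repr_zero : ⇑(e.repr 0) = 0 := by rw [map_zero]; rfl

lemma coe_repr_neg (v : GroupLieAlgebra (𝓡 4) G) : ⇑(e.repr (-v)) = -⇑(e.repr v) := by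
  rw [map_neg]; rfl

lemma coe_repr_add (v w : GroupLieAlgebra (𝓡 4) G) :
    ⇑(e.repr (v + w)) = ⇑(e.repr v) + ⇑(e.repr w) := by
  rw [map_add]; rfl

lemma coe_repr_smul (c : ℝ) (v : GroupLieAlgebra (𝓡 4) G) :
    ⇑(e.repr (c • v)) = c • ⇑(e.repr v) := by
  rw [map_smul]; rfl

lemma coe_repr_self (i : Fin 4) : ⇑(e.repr (e i)) = Pi.single i 1 := by
  rw [e.repr_self, Finsupp.single_eq_pi_single]

lemma single_zero_one : (Pi.single 0 1 : Fin 4 → ℝ) = ![1, 0, 0, 0] := by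
  funext d; fin_cases d <;> rfl

lemma single_one_one : (Pi.single 1 1 : Fin 4 → ℝ) = ![0, 1, 0, 0] := by
  funext d; fin_cases d <;> rfl

lemma single_two_one : (Pi.single 2 1 : Fin 4 → ℝ) = ![0, 0, 1, 0] := by
  funext d; fin_cases d <;> rfl

lemma single_three_one : (Pi.single 3 1 : Fin 4 → ℝ) = ![0, 0, 0, 1] := by
  funext d; fin_cases d <;> rfl

lemma linearIndependent_basis_pair {i j : Fin 4} (hij : i ≠ j) :
    LinearIndependent ℝ ![e i, e j] := by
  have := e.linearIndependent.comp ![i, j] (by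
    intro a b hab
    fin_cases a <;> fin_cases b <;> simp_all)
  convert this using 1
  funext a
  fin_cases a <;> rfl

lemma eq_smul_iff (i : Fin 4) (q : GroupLieAlgebra (𝓡 4) G) :
    (∃ t : ℝ, q = t • e i) ↔ ∀ j, j ≠ i → e.repr q j = 0 := by
  constructor
  · rintro ⟨t, rfl⟩ j hj
    simp [hj]
  · intro h
    refine ⟨e.repr q i, e.ext_elem fun j => ?_⟩
    rw [coe_repr_smul, coe_repr_self, Pi.smul_apply, smul_eq_mul]
    by_cases hj : j = i
    · subst hj; simp
    · simp [h j hj, hj]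

end Coordinates

/-! ### From the tables to the Lie group. -/

section Cases

variable {G : Type*} [TopologicalSpace G] [ChartedSpace (Coord 4) G] [Group G]
  [LieGroup (𝓡 4) ∞ G] {g : RiemMetric 4 G}
  {e : Module.Basis (Fin 4) ℝ (GroupLieAlgebra (𝓡 4) G)}

/-- The six listed brackets determine all structure constants by antisymmetry. -/
lemma HasBrackets.structureConst_eq {b01 b02 b03 b12 b13 b23 : GroupLieAlgebra (𝓡 4) G}
    (h : HasBrackets e b01 b02 b03 b12 b13 b23) :
    structureConst e = bracketTable (e.repr b01) (e.repr b02) (e.repr b03) (e.repr b12)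
      (e.repr b13) (e.repr b23) := by
  have hs : ∀ a d, structureConst e a a d = 0 := fun a d => by
    have := structureConst_antisymm (e := e) a a d
    linarith
  have h01 : ∀ d, structureConst e 0 1 d = e.repr b01 d := fun d => by rw [structureConst, h.XY]
  have h02 : ∀ d, structureConst e 0 2 d = e.repr b02 d := fun d => by rw [structureConst, h.XZ]
  have h03 : ∀ d, structureConst e 0 3 d = e.repr b03 d := fun d => by rw [structureConst, h.XW]
  have h12 : ∀ d, structureConst e 1 2 d = e.repr b12 d := fun d => by rw [structureConst, h.YZ]
  have h13 : ∀ d, structureConst e 1 3 d = e.repr b13 d := fun d => by rw [structureConst, h.YW]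
  have h23 : ∀ d, structureConst e 2 3 d = e.repr b23 d := fun d => by rw [structureConst, h.ZW]
  funext a b d
  fin_cases a <;> fin_cases b
  · exact hs 0 d
  · exact h01 d
  · exact h02 d
  · exact h03 d
  · exact (structureConst_antisymm 1 0 d).trans (congrArg Neg.neg (h01 d))
  · exact hs 1 d
  · exact h12 d
  · exact h13 d
  · exact (structureConst_antisymm 2 0 d).trans (congrArg Neg.neg (h02 d))
  · exact (structureConst_antisymm 2 1 d).trans (congrArg Neg.neg (h12 d))
  · exact hs 2 d
  · exact h23 d
  · exact (structureConst_antisymm 3 0 d).trans (congrArg Neg.neg (h03 d))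
  · exact (structureConst_antisymm 3 1 d).trans (congrArg Neg.neg (h13 d))
  · exact (structureConst_antisymm 3 2 d).trans (congrArg Neg.neg (h23 d))
  · exact hs 3 d

lemma IsAlgebra1.structureConst_eq (h : IsAlgebra1 e) : structureConst e = table1 := by
  rw [HasBrackets.structureConst_eq h]
  simp only [coe_repr_zero, coe_repr_self, single_one_one, single_three_one, table1]

lemma IsAlgebra2.structureConst_eq (h : IsAlgebra2 e) : structureConst e = table2 := by
  rw [HasBrackets.structureConst_eq h]
  simp only [coe_repr_zero, coe_repr_self, single_two_one, table2]

lemma IsAlgebra3.structureConst_eq (h : IsAlgebra3 e) : structureConst e = table3 := by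
  rw [HasBrackets.structureConst_eq h]
  simp only [coe_repr_zero, coe_repr_self, single_zero_one, table3]

lemma IsAlgebra4.structureConst_eq {α β : ℝ} (h : IsAlgebra4 e α β) :
    structureConst e = table4 α β := by
  rw [HasBrackets.structureConst_eq h]
  simp only [coe_repr_zero, coe_repr_self, coe_repr_add, coe_repr_smul, single_zero_one,
    single_one_one, table4]
  simp

lemma IsAlgebra6.structureConst_eq (h : IsAlgebra6 e) : structureConst e = table6 := by
  rw [HasBrackets.structureConst_eq h]
  simp only [coe_repr_zero, coe_repr_self, coe_repr_neg, single_zero_one, single_one_one,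
    single_three_one, table6]
  simp

lemma isLeftInvariantBerwaldRanders (hg : IsLeftInvariantMetric g)
    {q : GroupLieAlgebra (𝓡 4) G} (hq : IsParallel g (leftInv q)) (hs : g.inner 1 q q < 1) :
    IsLeftInvariantBerwaldRanders g q := by
  have hs' : ∀ p, g.inner p (leftInv q p) (leftInv q p) < 1 := fun p => by
    rw [inner_leftInv hg]; exact hs
  exact ⟨isFinslerMetric_randers (contMDiff_leftInv q) hs', isLeftInvariantFinsler_randers hg q,
    isBerwald_randers (contMDiff_leftInv q) hq hs'⟩

lemma gram_leftInv (hg : IsLeftInvariantMetric g) (a : G) (u v : GroupLieAlgebra (𝓡 4) G) :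
    gram g a (leftInv u a) (leftInv v a) = gram g 1 u v := by
  simp only [gram, inner_leftInv hg]

lemma gNorm_leftInv (hg : IsLeftInvariantMetric g) (a : G) (u : GroupLieAlgebra (𝓡 4) G) :
    gNorm g a (leftInv u a) = gNorm g 1 u := by
  simp only [gNorm, inner_leftInv hg]

lemma flagCurvature_leftInv_leftInv (hg : IsLeftInvariantMetric g)
    (he : ∀ i j, g.inner 1 (e i) (e j) = if i = j then 1 else 0) {q : GroupLieAlgebra (𝓡 4) G}
    (hq : IsParallel g (leftInv q)) (hs : g.inner 1 q q < 1) (a : G)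
    (u v : GroupLieAlgebra (𝓡 4) G) (hu : u ≠ 0) :
    flagCurvature (randers g (leftInv q)) a (leftInv u a) (leftInv v a)
      = sectionalNumerator (structureConst e) (e.equivFun u) (e.equivFun v) /
        (gram g 1 u v * (1 + g.inner 1 q u / gNorm g 1 u) ^ 2) := by
  have hu' : leftInv u a ≠ 0 := fun h =>
    hu (leftInv_injective hg a (h.trans (map_zero (leftInvLinear a)).symm))
  rw [flagCurvature_leftInv hg he hq hs a hu', inner_riemCurvature hg he, gram_leftInv hg,
    gNorm_leftInv hg, inner_leftInv hg]
  rfl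

lemma flagCurvatureFormula (hg : IsLeftInvariantMetric g)
    (he : ∀ i j, g.inner 1 (e i) (e j) = if i = j then 1 else 0) {q : GroupLieAlgebra (𝓡 4) G}
    (hq : IsParallel g (leftInv q)) (hs : g.inner 1 q q < 1) :
    FlagCurvatureFormula g e q (sectionalNumerator (structureConst e)) := by
  constructor
  · intro a u v hu hv huv
    have hu0 : u ≠ 0 := by
      rintro rfl
      rw [map_zero] at hu
      exact zero_ne_one hu
    rw [flagCurvature_leftInv_leftInv hg he hq hs a u v hu0]
    simp [gram, gNorm, hu, hv, huv]
  · intro a u v huv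
    exact flagCurvature_leftInv_leftInv hg he hq hs a u v (huv.ne_zero 0)

lemma nonposFlagCurvature (hg : IsLeftInvariantMetric g)
    (he : ∀ i j, g.inner 1 (e i) (e j) = if i = j then 1 else 0) {q : GroupLieAlgebra (𝓡 4) G}
    (hq : IsParallel g (leftInv q)) (hs : g.inner 1 q q < 1)
    (hN : ∀ a b, sectionalNumerator (structureConst e) a b ≤ 0) :
    NonposFlagCurvature (randers g (leftInv q)) := by
  intro p y u hyu
  have hy : y ≠ 0 := hyu.ne_zero 0
  rw [flagCurvature_leftInv hg he hq hs p hy]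
  refine div_nonpos_of_nonpos_of_nonneg ?_ (mul_nonneg ?_ (sq_nonneg _))
  · obtain ⟨y, rfl⟩ := leftInv_surjective hg p y
    obtain ⟨u, rfl⟩ := leftInv_surjective hg p u
    rw [inner_riemCurvature hg he]
    exact hN _ _
  · exact (gram_nonneg_of_posDef (a := g.inner p) (g.symm p) (g.pos p) y u hy).1

lemma inner_smul_basis (he : ∀ i j, g.inner 1 (e i) (e j) = if i = j then 1 else 0) (t : ℝ)
    (i : Fin 4) : g.inner 1 (t • e i) (t • e i) = t ^ 2 := by
  simp only [map_smul]
  rw [smul_apply, he]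
  simp [pow_two]

lemma inner_smul_basis_lt (he : ∀ i j, g.inner 1 (e i) (e j) = if i = j then 1 else 0) {t : ℝ}
    (ht : |t| < 1) (i : Fin 4) : g.inner 1 (t • e i) (t • e i) < 1 := by
  rw [inner_smul_basis he]
  exact (sq_lt_one_iff_abs_lt_one t).2 ht

lemma parallel_algebra1 (hg : IsLeftInvariantMetric g)
    (he : ∀ i j, g.inner 1 (e i) (e j) = if i = j then 1 else 0) (h : IsAlgebra1 e)
    (q : GroupLieAlgebra (𝓡 4) G) : IsParallel g (leftInv q) ↔ ∃ t : ℝ, q = t • e 2 := by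
  rw [isParallel_leftInv_iff hg he, h.structureConst_eq, parallel_table1, eq_smul_iff]
  simp [Fin.forall_fin_succ]

lemma parallel_algebra2 (hg : IsLeftInvariantMetric g)
    (he : ∀ i j, g.inner 1 (e i) (e j) = if i = j then 1 else 0) (h : IsAlgebra2 e)
    (q : GroupLieAlgebra (𝓡 4) G) : IsParallel g (leftInv q) ↔ ∃ t : ℝ, q = t • e 3 := by
  rw [isParallel_leftInv_iff hg he, h.structureConst_eq, parallel_table2, eq_smul_iff]
  simp [Fin.forall_fin_succ]

lemma parallel_algebra3 (hg : IsLeftInvariantMetric g)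
    (he : ∀ i j, g.inner 1 (e i) (e j) = if i = j then 1 else 0) (h : IsAlgebra3 e)
    (q : GroupLieAlgebra (𝓡 4) G) :
    IsParallel g (leftInv q) ↔ ∃ t₁ t₂ : ℝ, q = t₁ • e 2 + t₂ • e 3 := by
  rw [isParallel_leftInv_iff hg he, h.structureConst_eq, parallel_table3]
  constructor
  · rintro ⟨h0, h1⟩
    refine ⟨e.repr q 2, e.repr q 3, ?_⟩
    conv_lhs => rw [← e.sum_repr q]
    rw [Fin.sum_univ_four, h0, h1, zero_smul, zero_smul, zero_add, zero_add]
  · rintro ⟨t₁, t₂, rfl⟩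
    simp

lemma exists_parallel_algebra4_iff (hg : IsLeftInvariantMetric g)
    (he : ∀ i j, g.inner 1 (e i) (e j) = if i = j then 1 else 0) {α β : ℝ}
    (h : IsAlgebra4 e α β) :
    (∃ q, q ≠ 0 ∧ IsParallel g (leftInv q)) ↔ α = -1 ∧ β = 0 := by
  simp only [isParallel_leftInv_iff hg he, h.structureConst_eq, parallel_table4]
  constructor
  · rintro ⟨q, hq, h0, h1, h2, h3, h4⟩
    -- A parallel `q` is a multiple of `W`; being nonzero, its coefficient can be cancelled from `(1
    -- + α) q 3 = 0` and `β q 3 = 0`.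
    have h5 : e.repr q 3 ≠ 0 := by
      intro h5
      refine hq (e.ext_elem fun j => ?_)
      rw [coe_repr_zero]
      fin_cases j
      exacts [h0, h1, h2, h5]
    exact ⟨by linarith [(mul_eq_zero.1 h3).resolve_right h5], (mul_eq_zero.1 h4).resolve_right h5⟩
  · rintro ⟨rfl, rfl⟩
    exact ⟨e 3, e.ne_zero 3, by simp⟩

lemma parallel_algebra4 (hg : IsLeftInvariantMetric g)
    (he : ∀ i j, g.inner 1 (e i) (e j) = if i = j then 1 else 0) (h : IsAlgebra4 e (-1) 0)
    (q : GroupLieAlgebra (𝓡 4) G) : IsParallel g (leftInv q) ↔ ∃ t : ℝ, q = t • e 3 := by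
  rw [isParallel_leftInv_iff hg he, h.structureConst_eq, parallel_table4, eq_smul_iff]
  simp [Fin.forall_fin_succ]

lemma parallel_algebra6 (hg : IsLeftInvariantMetric g)
    (he : ∀ i j, g.inner 1 (e i) (e j) = if i = j then 1 else 0) (h : IsAlgebra6 e)
    (q : GroupLieAlgebra (𝓡 4) G) : IsParallel g (leftInv q) ↔ ∃ t : ℝ, q = t • e 2 := by
  rw [isParallel_leftInv_iff hg he, h.structureConst_eq, parallel_table6, eq_smul_iff]
  simp [Fin.forall_fin_succ]

lemma linearIndependent_leftInv (hg : IsLeftInvariantMetric g) (a : G)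
    {u v : GroupLieAlgebra (𝓡 4) G} (h : LinearIndependent ℝ ![u, v]) :
    LinearIndependent ℝ ![leftInv u a, leftInv v a] := by
  rw [LinearIndependent.pair_iff] at h ⊢
  intro s t hst
  refine h s t (leftInv_injective hg a ?_)
  rw [map_zero, map_add, map_smul, map_smul]
  exact hst

/-- The flag curvature of a flag spanned by basis vectors, for a field orthogonal to the pole. -/
lemma flagCurvature_basis (hg : IsLeftInvariantMetric g)
    (he : ∀ i j, g.inner 1 (e i) (e j) = if i = j then 1 else 0) {q : GroupLieAlgebra (𝓡 4) G}
    (hq : IsParallel g (leftInv q)) (hs : g.inner 1 q q < 1) (a : G) {i j : Fin 4} (hij : i ≠ j)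
    (hi : g.inner 1 q (e i) = 0) :
    flagCurvature (randers g (leftInv q)) a (leftInv (e i) a) (leftInv (e j) a)
      = sectionalNumerator (structureConst e) (Pi.single i 1) (Pi.single j 1) := by
  have := (flagCurvatureFormula hg he hq hs).1 a (e i) (e j) (by simp [he]) (by simp [he])
    (by simp [he, hij])
  rw [this, hi, e.equivFun_apply, e.equivFun_apply, coe_repr_self, coe_repr_self]
  simp

end Cases

end FinslerLie
end

/-! ### The general formula and the five algebras together. -/

theorem mainTheorem5 {G : Type*} [TopologicalSpace G] [ChartedSpace (FinslerLie.Coord 4) G]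
    [Group G] [LieGroup (𝓡 4) ∞ G]
    (g : FinslerLie.RiemMetric 4 G) (hg : FinslerLie.IsLeftInvariantMetric g)
    (e : Module.Basis (Fin 4) ℝ (GroupLieAlgebra (𝓡 4) G))
    (he : ∀ i j, g.inner 1 (e i) (e j) = if i = j then 1 else 0) :
    -- Randers metrics from parallel left-invariant fields, and their flag curvature
    (∀ q : GroupLieAlgebra (𝓡 4) G,
      FinslerLie.IsParallel g (FinslerLie.leftInv q) →
      0 < FinslerLie.gNorm g 1 q → FinslerLie.gNorm g 1 q < 1 →
      FinslerLie.IsLeftInvariantBerwaldRanders g q ∧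
      ∀ (p : G) (y u : TangentSpace (𝓡 4) p), LinearIndependent ℝ ![y, u] →
        FinslerLie.flagCurvature (FinslerLie.randers g (FinslerLie.leftInv q)) p y u
          = g.inner p (FinslerLie.riemCurvature g p u y y) u /
            (FinslerLie.gram g p y u *
              (1 + g.inner p (FinslerLie.leftInv q p) y / FinslerLie.gNorm g p y) ^ 2)) ∧
    -- Case 1
    (FinslerLie.IsAlgebra1 e →
      (∀ q, FinslerLie.IsParallel g (FinslerLie.leftInv q) ↔ ∃ t : ℝ, q = t • e 2) ∧
      ∀ t : ℝ, 0 < |t| → |t| < 1 →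
        FinslerLie.IsLeftInvariantBerwaldRanders g (t • e 2) ∧
        FinslerLie.FlagCurvatureFormula g e (t • e 2) (fun a b =>
          -((a 0 * b 1 - a 1 * b 0) ^ 2 + (a 0 * b 3 - a 3 * b 0) ^ 2
            + (a 1 * b 3 - a 3 * b 1) ^ 2)) ∧
        FinslerLie.NonposFlagCurvature
          (FinslerLie.randers g (FinslerLie.leftInv (t • e 2)))) ∧
    -- Case 2
    (FinslerLie.IsAlgebra2 e →
      (∀ q, FinslerLie.IsParallel g (FinslerLie.leftInv q) ↔ ∃ t : ℝ, q = t • e 3) ∧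
      ∀ t : ℝ, 0 < |t| → |t| < 1 →
        FinslerLie.IsLeftInvariantBerwaldRanders g (t • e 3) ∧
        FinslerLie.FlagCurvatureFormula g e (t • e 3) (fun a b =>
          ((a 0 * b 2 - a 2 * b 0) ^ 2 + (a 1 * b 2 - a 2 * b 1) ^ 2
            - 3 * (a 0 * b 1 - a 1 * b 0) ^ 2) / 4)) ∧
    -- Case 3
    (FinslerLie.IsAlgebra3 e →
      (∀ q, FinslerLie.IsParallel g (FinslerLie.leftInv q) ↔
        ∃ t₁ t₂ : ℝ, q = t₁ • e 2 + t₂ • e 3) ∧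
      ∀ t₁ t₂ : ℝ, 0 < t₁ ^ 2 + t₂ ^ 2 → t₁ ^ 2 + t₂ ^ 2 < 1 →
        FinslerLie.IsLeftInvariantBerwaldRanders g (t₁ • e 2 + t₂ • e 3) ∧
        FinslerLie.FlagCurvatureFormula g e (t₁ • e 2 + t₂ • e 3) (fun a b =>
          -(a 0 * b 1 - a 1 * b 0) ^ 2) ∧
        FinslerLie.NonposFlagCurvature
          (FinslerLie.randers g (FinslerLie.leftInv (t₁ • e 2 + t₂ • e 3)))) ∧
    -- Case 4
    (∀ α β : ℝ, FinslerLie.IsAlgebra4 e α β →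
      ((∃ q, q ≠ 0 ∧ FinslerLie.IsParallel g (FinslerLie.leftInv q)) ↔ α = -1 ∧ β = 0)) ∧
    (FinslerLie.IsAlgebra4 e (-1) 0 →
      (∀ q, FinslerLie.IsParallel g (FinslerLie.leftInv q) ↔ ∃ t : ℝ, q = t • e 3) ∧
      ∀ t : ℝ, 0 < |t| → |t| < 1 →
        FinslerLie.IsLeftInvariantBerwaldRanders g (t • e 3) ∧
        FinslerLie.FlagCurvatureFormula g e (t • e 3) (fun a b =>
          -((a 0 * b 1 - a 1 * b 0) ^ 2 + (a 0 * b 2 - a 2 * b 0) ^ 2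
            + (a 1 * b 2 - a 2 * b 1) ^ 2)) ∧
        FinslerLie.NonposFlagCurvature
          (FinslerLie.randers g (FinslerLie.leftInv (t • e 3)))) ∧
    -- Case 6
    (FinslerLie.IsAlgebra6 e →
      (∀ q, FinslerLie.IsParallel g (FinslerLie.leftInv q) ↔ ∃ t : ℝ, q = t • e 2) ∧
      ∀ t : ℝ, 0 < |t| → |t| < 1 →
        FinslerLie.IsLeftInvariantBerwaldRanders g (t • e 2) ∧
        FinslerLie.FlagCurvatureFormula g e (t • e 2) (fun a b =>
          ((a 0 * b 1 - a 1 * b 0) ^ 2 + (a 0 * b 3 - a 3 * b 0) ^ 2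
            - 7 * (a 1 * b 3 - a 3 * b 1) ^ 2) / 4) ∧
        ∀ p : G,
          (∃ y u : TangentSpace (𝓡 4) p, LinearIndependent ℝ ![y, u] ∧
            0 < FinslerLie.flagCurvature
              (FinslerLie.randers g (FinslerLie.leftInv (t • e 2))) p y u) ∧
          (∃ y u : TangentSpace (𝓡 4) p, LinearIndependent ℝ ![y, u] ∧
            FinslerLie.flagCurvature
              (FinslerLie.randers g (FinslerLie.leftInv (t • e 2))) p y u < 0)) := by
  open FinslerLie in
  refine ⟨?_, ?_, ?_, ?_, ?_, ?_, ?_⟩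
  · intro q hq _ h1
    have hs : g.inner 1 q q < 1 := by
      rw [gNorm, Real.sqrt_lt' one_pos, one_pow] at h1
      exact h1
    exact ⟨isLeftInvariantBerwaldRanders hg hq hs, fun p y u hyu =>
      flagCurvature_leftInv hg he hq hs p (hyu.ne_zero 0)⟩
  · intro h
    refine ⟨parallel_algebra1 hg he h, fun t _ ht => ?_⟩
    have hq := (parallel_algebra1 hg he h _).2 ⟨t, rfl⟩
    have hs := inner_smul_basis_lt he ht 2
    have hF := flagCurvatureFormula hg he hq hs
    have hK := nonposFlagCurvature hg he hq hs
    rw [h.structureConst_eq] at hF hK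
    refine ⟨isLeftInvariantBerwaldRanders hg hq hs, ?_, hK fun a b => ?_⟩
    · simpa only [FlagCurvatureFormula, sectionalNumerator_table1] using hF
    · rw [sectionalNumerator_table1]
      exact neg_nonpos.2 (by positivity)
  · intro h
    refine ⟨parallel_algebra2 hg he h, fun t _ ht => ?_⟩
    have hq := (parallel_algebra2 hg he h _).2 ⟨t, rfl⟩
    have hs := inner_smul_basis_lt he ht 3
    have hF := flagCurvatureFormula hg he hq hs
    rw [h.structureConst_eq] at hF
    refine ⟨isLeftInvariantBerwaldRanders hg hq hs, ?_⟩
    simpa only [FlagCurvatureFormula, sectionalNumerator_table2] using hF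
  · intro h
    refine ⟨parallel_algebra3 hg he h, fun t₁ t₂ _ ht => ?_⟩
    have hq := (parallel_algebra3 hg he h _).2 ⟨t₁, t₂, rfl⟩
    have hs : g.inner 1 (t₁ • e 2 + t₂ • e 3) (t₁ • e 2 + t₂ • e 3) < 1 := by
      have h0 : g.inner 1 (t₁ • e 2 + t₂ • e 3) (t₁ • e 2 + t₂ • e 3) = t₁ ^ 2 + t₂ ^ 2 := by
        simp only [map_add, map_smul]
        rw [add_apply, add_apply, smul_apply, smul_apply, smul_apply, smul_apply]
        simp [he, pow_two]
      exact h0.trans_lt ht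
    have hF := flagCurvatureFormula hg he hq hs
    have hK := nonposFlagCurvature hg he hq hs
    rw [h.structureConst_eq] at hF hK
    refine ⟨isLeftInvariantBerwaldRanders hg hq hs, ?_, hK fun a b => ?_⟩
    · simpa only [FlagCurvatureFormula, sectionalNumerator_table3] using hF
    · rw [sectionalNumerator_table3]
      exact neg_nonpos.2 (by positivity)
  · exact fun α β h => exists_parallel_algebra4_iff hg he h
  · intro h
    refine ⟨parallel_algebra4 hg he h, fun t _ ht => ?_⟩
    have hq := (parallel_algebra4 hg he h _).2 ⟨t, rfl⟩
    have hs := inner_smul_basis_lt he ht 3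
    have hF := flagCurvatureFormula hg he hq hs
    have hK := nonposFlagCurvature hg he hq hs
    rw [h.structureConst_eq] at hF hK
    refine ⟨isLeftInvariantBerwaldRanders hg hq hs, ?_, hK fun a b => ?_⟩
    · simpa only [FlagCurvatureFormula, sectionalNumerator_table4] using hF
    · rw [sectionalNumerator_table4]
      exact neg_nonpos.2 (by positivity)
  · intro h
    refine ⟨parallel_algebra6 hg he h, fun t _ ht => ?_⟩
    have hq := (parallel_algebra6 hg he h _).2 ⟨t, rfl⟩
    have hs := inner_smul_basis_lt he ht 2
    have hF := flagCurvatureFormula hg he hq hs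
    -- A basis pole other than `Z` is orthogonal to `Q = tZ`, so the Randers factor is `1` and the
    -- flag curvature is the sectional curvature.
    have hK : ∀ (p : G) (i j : Fin 4), i ≠ j → i ≠ 2 →
        flagCurvature (randers g (leftInv (t • e 2))) p (leftInv (e i) p) (leftInv (e j) p)
          = sectionalNumerator table6 (Pi.single i 1) (Pi.single j 1) := by
      intro p i j hij hi
      rw [← h.structureConst_eq]
      refine flagCurvature_basis hg he hq hs p hij ?_
      rw [map_smul, smul_apply, he, if_neg hi.symm, smul_zero]
    rw [h.structureConst_eq] at hF
    refine ⟨isLeftInvariantBerwaldRanders hg hq hs, ?_, fun p => ⟨?_, ?_⟩⟩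
    · simpa only [FlagCurvatureFormula, sectionalNumerator_table6] using hF
    -- Pole `X` in the plane of `X, Y`: flag curvature `1/4`.
    · refine ⟨_, _, linearIndependent_leftInv hg p
        (linearIndependent_basis_pair (e := e) (i := 0) (j := 1) (by decide)), ?_⟩
      rw [hK p 0 1 (by decide) (by decide), sectionalNumerator_table6]
      simp
    -- Pole `Y` in the plane of `Y, W`: flag curvature `-7/4`.
    · refine ⟨_, _, linearIndependent_leftInv hg p
        (linearIndependent_basis_pair (e := e) (i := 1) (j := 3) (by decide)), ?_⟩
      rw [hK p 1 3 (by decide) (by decide), sectionalNumerator_table6]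
      simp
      norm_num
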